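/- **Notation.** Fix $q\in\mathbb C$ with $0<|q|<1$ together with a choice of $\ln q$ (so $q^x=e^{x\ln q}$ for $x\in\mathbb C$), and real numbers $k\ne-2$ and $r>0$ with $r^*:=r-k>0$. Put $[n]=\frac{q^n-q^{-n}}{q-q^{-1}}$, $p=q^{2r}$, $p^*=q^{2r^*}$, $(x;t)_\infty=\prod_{n\ge0}(1-xt^n)$, $\Theta_t(x)=(x;t)_\infty(tx^{-1};t)_\infty(t;t)_\infty$, $\theta_\nu(u)=q^{u^2/\nu-u}\,\Theta_{q^{2\nu}}(q^{2u})/(q^{2\nu};q^{2\nu})_\infty^3$, $\theta=\theta_r$, $\theta^*=\theta_{r^*}$; always $z=q^{2u}$, $w=q^{2v}$. **Fock space.** Let $a_n,b_n,c_n$ $(n\ne0)$ and $p_a,q_a,p_b,q_b,p_c,q_c,\hat p,\hat q$ have the nonzero commutators $[a_n,a_m]=\frac{[(k+2)n][2n]}{n}\delta_{n+m,0}$, $[b_n,b_m]=-\frac{[n]^2}{n}\delta_{n+m,0}$, $[c_n,c_m]=\frac{[n]^2}{n}\delta_{n+m,0}$, $[p_a,q_a]=2(k+2)$, $[p_b,q_b]=-1$,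 $[p_c,q_c]=1$, $[\hat q,\hat p]=1$. They act on the Fock spaces $\mathcal F_{l,m_1,m_2}\otimes\mathcal F_n$ $(l,m_1,m_2,n\in\mathbb C)$, generated by $a_{-n},b_{-n},c_{-n}$ $(n>0)$ from a highest weight vector on which $p_a,p_b,p_c,\hat p$ have eigenvalues $l,-m_1,m_2,-n$. Normal ordering puts annihilation modes and $p$'s to the right of creation modes and $q$'s. For $B\in\{a,b,c\}$ put $B(z)=-\sum_{n\ne0}\frac{B_n}{[n]}z^{-n}+q_B+p_B\ln z$, $B_\pm(z)=\pm\big((q-q^{-1})\sum_{n>0}B_{\pm n}z^{\mp n}+p_B\ln q\big)$, $B^*_+(z)=-\sum_{n>0}\frac{B_n}{[rn]}z^{-n}$, $B^*_-(z)=\sum_{n>0}\frac{B_{-n}}{[r^*n]}z^n$, and $(b+c)(z)=b(z)+c(z)$. **Wakimoto fields.** $\psi_\pm(z)=\,:\exp[b_\pm(q^{\pm k/2}z)+a_\pm(q^{\pm1}z)+b_\pm(q^{\pm(k/2+2)}z)]:$, $e^+(z)=\frac{-1}{(q-q^{-1})z}:\{\exp[b_+(z)-(b+c)(qz)]-\exp[b_-(z)-(b+c)(q^{-1}z)]\}:$,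 $e^-(z)=\frac{-1}{(q-q^{-1})z}:\{\exp[(b+c)(q^{-(k+1)}z)+a_-(q^{-\frac{k+2}2}z)+b_-(q^{-(k+2)}z)]-\exp[(b+c)(q^{k+1}z)+a_+(q^{\frac{k+2}2}z)+b_+(q^{k+2}z)]\}:$. **Twisted fields.** With $U^+(z)=\exp[a^*_-(q^{r^*+\frac k2-1}z)+b^*_-(q^{r^*}z)+b^*_-(q^{r^*-2}z)]$ and $U^-(z)=\exp[a^*_+(q^{-(r-\frac k2-1)}z)+b^*_+(q^{-(r-k-1)+1}z)+b^*_+(q^{-(r-k-1)-1}z)]$, put $\Psi^\pm(z)=U^+(q^{\pm k/2}z)\,\psi_\pm(z)\,U^-(q^{\mp k/2}z)$, $e(z)=U^+(z)e^+(z)$, $f(z)=e^-(z)U^-(z)$. **Dressed fields.** $H^\pm(u)=\Psi^\pm(z)\,e^{2\hat q}\,(q^{\mp k/2}z)^{\frac{2p_b+p_a}r}\,(q^{\pm(r-\frac k2)}z)^{\frac{\hat p-1}r-\frac{\hat p-1}{r^*}}$, $E(u)=e(z)\,e^{2\hat q}\,z^{-\frac{\hat p-1}{r^*}}$, $F(u)=f(z)\,z^{\frac{2p_b+p_a}r}\,z^{\frac{\hat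 p-1}r}$. **Theorem.** With $c=k$, these fields satisfy $$H^\pm(u)H^\pm(v)=\frac{\theta(u-v-1)}{\theta(u-v+1)}\frac{\theta^*(u-v+1)}{\theta^*(u-v-1)}H^\pm(v)H^\pm(u),$$ $$H^+(u)H^-(v)=\frac{\theta(u-v-\frac c2-1)}{\theta(u-v-\frac c2+1)}\frac{\theta^*(u-v+\frac c2+1)}{\theta^*(u-v+\frac c2-1)}H^-(v)H^+(u),$$ $$H^\pm(u)E(v)=\frac{\theta^*(u-v\pm\frac c4+1)}{\theta^*(u-v\pm\frac c4-1)}E(v)H^\pm(u),\qquad H^\pm(u)F(v)=\frac{\theta(u-v\mp\frac c4-1)}{\theta(u-v\mp\frac c4+1)}F(v)H^\pm(u),$$ $$[E(u),F(v)]=\frac1{(q-q^{-1})zw}\Big[\delta(u-v-\tfrac c2)H^+(u-\tfrac c4)-\delta(u-v+\tfrac c2)H^-(v-\tfrac c4)\Big],$$ $$E(u)E(v)=\frac{\theta^*(u-v+1)}{\theta^*(u-v-1)}E(v)E(u),\qquad F(u)F(v)=\frac{\theta(u-v-1)}{\theta(u-v+1)}F(v)F(u).$$ Equivalently, in the multiplicative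 variables $z,w$, they satisfy the defining relations of the elliptic algebra $U_{q,p}(\widehat{sl_2})$ with the central element $c$ acting as $k$: $$H^\pm(z)H^\pm(w)=(\tfrac zw)^{2(\frac1{r^*}-\frac1r)}\frac{\Theta_p(q^{-2}\frac zw)}{\Theta_p(q^2\frac zw)}\frac{\Theta_{p^*}(q^2\frac zw)}{\Theta_{p^*}(q^{-2}\frac zw)}H^\pm(w)H^\pm(z),$$ $$H^+(z)H^-(w)=q^{2c(\frac1{r^*}+\frac1r)}(\tfrac zw)^{2(\frac1{r^*}-\frac1r)}\frac{\Theta_p(pq^{-2-c}\frac zw)}{\Theta_p(pq^{2-c}\frac zw)}\frac{\Theta_{p^*}(p^*q^{2+c}\frac zw)}{\Theta_{p^*}(p^*q^{-2+c}\frac zw)}H^-(w)H^+(z),$$ $$H^\pm(z)E(w)=q^{\pm\frac c{r^*}-2}(\tfrac zw)^{\frac2{r^*}}\frac{\Theta_{p^*}(q^{2\pm\frac c2}\frac zw)}{\Theta_{p^*}(q^{-2\pm\frac c2}\frac zw)}E(w)H^\pm(z),$$ $$H^\pm(z)F(w)=q^{\pm\frac cr+2}(\tfrac zw)^{-\frac2r}\frac{\Theta_p(q^{-2\mp\frac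 c2}\frac zw)}{\Theta_p(q^{2\mp\frac c2}\frac zw)}F(w)H^\pm(z),$$ $$E(z)E(w)=q^{-2}(\tfrac zw)^{\frac2{r^*}}\frac{\Theta_{p^*}(q^2\frac zw)}{\Theta_{p^*}(q^{-2}\frac zw)}E(w)E(z),\qquad F(z)F(w)=q^2(\tfrac zw)^{-\frac2r}\frac{\Theta_p(q^{-2}\frac zw)}{\Theta_p(q^2\frac zw)}F(w)F(z),$$ together with the relation for $[E,F]$ above. Hence (Corollary) they give a free-boson realization of $U_{q,p}(\widehat{sl_2})$ at arbitrary level $k$. **Meaning of the relations.** An exchange relation $A(u)B(v)=\frac{g(u-v)}{d(u-v)}B(v)A(u)$ means: every matrix element of $A(u)B(v)$ converges absolutely for $|z|\gg|w|$, every matrix element of $B(v)A(u)$ for $|w|\gg|z|$, and $d(u-v)A(u)B(v)$ and $g(u-v)B(v)A(u)$ continue analytically to the same entire function of $(u,v)$. The relation for $[E(u),F(v)]$ is an identity of formal series in complex powers of $z$ and $w$, where $\delta(u)=\delta(q^{2u})$ and $\delta(x)=\sum_jx^j$, with $j$ running over the coset of $\mathbb Z$ in $\mathbb C$ for which both sides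 involve the same powers of $z$ and $w$ on the sector in question (over $\mathbb Z$ itself when $E$ and $F$ have integral powers there). -/

import Mathlib

namespace EllipticWakimoto

noncomputable section

open scoped Classical

/-! Throughout, `h` is a fixed logarithm of the deformation parameter: `q = exp h`, so that
`q ^ x = exp (h * x)` for every complex `x`.  A point `z = q ^ y` of the punctured plane is
given by its logarithm `y` to the base `q`; the additive variable `u` of a current is
`z = q ^ (2 * u)`. -/

/-- `q ^ x`. -/
def qp (h x : ℂ) : ℂ := Complex.exp (h * x)

/-- The `q`-number `[x] = (q ^ x - q ^ (-x)) / (q - q⁻¹)`. -/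
def qnum (h x : ℂ) : ℂ := (qp h x - qp h (-x)) / (qp h 1 - qp h (-1))

/-! ### Theta functions -/

/-- `(x; t)_∞ = ∏_{n ≥ 0} (1 - x t ^ n)`. -/
def qPoch (x t : ℂ) : ℂ := ∏' n : ℕ, (1 - x * t ^ n)

/-- `Θ_t(x) = (x; t)_∞ (t x⁻¹; t)_∞ (t; t)_∞`. -/
def bigTheta (t x : ℂ) : ℂ := qPoch x t * qPoch (t * x⁻¹) t * qPoch t t

/-- `θ_ν(u) = q ^ (u² / ν - u) Θ_{q ^ (2ν)}(q ^ (2u)) / (q ^ (2ν); q ^ (2ν))_∞ ³`. -/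
def theta (h ν u : ℂ) : ℂ :=
  qp h (u ^ 2 / ν - u) * bigTheta (qp h (2 * ν)) (qp h (2 * u)) /
    qPoch (qp h (2 * ν)) (qp h (2 * ν)) ^ 3

/-! ### The Fock space

The three bosons have oscillators `B_n`, `B ∈ {a, b, c}`, `n ∈ ℤ \ {0}`, and zero modes
`q_B`, `p_B`; the extra Heisenberg pair is `q̂`, `p̂`.  In each charge sector the Fock space is the
polynomial ring in the `B_{-n}`, `n > 0`. -/

/-- The three free bosons. -/
inductive Boson : Type
  | a | b | c

/-- The zero-mode pairs `(q_a, p_a)`, `(q_b, p_b)`, `(q_c, p_c)`, `(q̂, p̂)`. -/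
inductive ZeroMode : Type
  | a | b | c | hat

/-- The zero-mode pair of a boson. -/
def Boson.zero : Boson → ZeroMode
  | .a => .a
  | .b => .b
  | .c => .c

/-- `(B, n)` labels the creation operator `B_{-n}` and the annihilation operator `B_n`. -/
abbrev Mode : Type := Boson × ℕ+

/-- The labels `(l, m₁, m₂, n)` of the sector `𝓕_{l, m₁, m₂} ⊗ 𝓕_n`. -/
abbrev Charge : Type := ZeroMode → ℂ

/-- Basis of the Fock space: the vector `∏ B_{-n} ^ (e (B, n)) |l, m₁, m₂⟩ ⊗ |n⟩` is the pair of
its charge and its occupation numbers `e`. -/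
abbrev State : Type := Charge × (Mode →₀ ℕ)

/-- Operators from a space with basis `ι` to its completion (arbitrary infinite combinations of
basis vectors), as matrices: `A s t` is the coefficient of `s` in the image of `t`. -/
abbrev Op (ι : Type) : Type := ι → ι → ℂ

/-- Composition of operators. -/
def opMul {ι : Type} (A B : Op ι) : Op ι := fun s t => ∑' m, A s m * B m t

/-- Eigenvalues of `p_a, p_b, p_c, p̂` on `𝓕_{l, m₁, m₂} ⊗ 𝓕_n`: they are `l, -m₁, m₂, -n`. -/
def pEig (μ : Charge) : ZeroMode → ℂ
  | .a => μ .a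
  | .b => -μ .b
  | .c => μ .c
  | .hat => -μ .hat

/-- Change of the charge under `exp (x_a q_a + x_b q_b + x_c q_c + x̂ q̂)`; it reflects
`[p_a, q_a] = 2(k+2)`, `[p_b, q_b] = -1`, `[p_c, q_c] = 1`, `[p̂, q̂] = -1`. -/
def qShift (k : ℝ) (x : ZeroMode → ℂ) : Charge
  | .a => 2 * ((k : ℂ) + 2) * x .a
  | .b => x .b
  | .c => x .c
  | .hat => x .hat

/-- The value of the commutator `[B_n, B_{-n}]`, `n > 0`. -/
def kappa (h : ℂ) (k : ℝ) : Mode → ℂ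
  | (.a, n) => qnum h (((k : ℂ) + 2) * (n : ℕ)) * qnum h (2 * (n : ℕ)) / (n : ℕ)
  | (.b, n) => -(qnum h (n : ℕ) ^ 2 / (n : ℕ))
  | (.c, n) => qnum h (n : ℕ) ^ 2 / (n : ℕ)

/-- The operator `∑_i y_i B_i` (sum over all annihilation operators): `B_{-n}` acts as
multiplication by the variable and `B_n` as `[B_n, B_{-n}]` times its derivative. -/
def annih (h : ℂ) (k : ℝ) (y : Mode → ℂ) :
    Derivation ℂ (MvPolynomial Mode ℂ) (MvPolynomial Mode ℂ) :=
  MvPolynomial.mkDerivation ℂ fun i => MvPolynomial.C (y i * kappa h k i)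

/-- `exp (∑_i y_i B_i)` on polynomials, where the exponential series is finite. -/
def annihExp (h : ℂ) (k : ℝ) (y : Mode → ℂ) (f : MvPolynomial Mode ℂ) : MvPolynomial Mode ℂ :=
  ∑ᶠ j : ℕ, ((j.factorial : ℂ)⁻¹) • ((annih h k y : MvPolynomial Mode ℂ → _)^[j] f)

/-- `exp (∑_i x_i B_{-i})` in the completed polynomial ring. -/
def creatExp (x : Mode → ℂ) : MvPowerSeries Mode ℂ :=
  fun e => e.prod fun i n => x i ^ n / (n.factorial : ℂ)

/-! ### Linear forms in the modes and their normal-ordered exponentials -/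

/-- Linear forms in the modes, given by the coefficients of the `B_{-n}`, of the `B_n` (`n > 0`),
of the zero modes `q` and of the zero modes `p`, in this order. -/
abbrev LinForm : Type := (Mode → ℂ) × (Mode → ℂ) × (ZeroMode → ℂ) × (ZeroMode → ℂ)

/-- `∑_{n > 0} f n • B_{-n}`. -/
def crForm (B : Boson) (f : ℕ+ → ℂ) : LinForm := (fun i => if i.1 = B then f i.2 else 0, 0, 0, 0)

/-- `∑_{n > 0} f n • B_n`. -/
def anForm (B : Boson) (f : ℕ+ → ℂ) : LinForm := (0, fun i => if i.1 = B then f i.2 else 0, 0, 0)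

/-- `x • q_i`. -/
def qForm (i : ZeroMode) (x : ℂ) : LinForm := (0, 0, Pi.single i x, 0)

/-- `x • p_i`. -/
def pForm (i : ZeroMode) (x : ℂ) : LinForm := (0, 0, 0, Pi.single i x)

/-- The normal-ordered exponential `:exp φ:`, that is
`exp (creation part) exp (q part) exp (p part) exp (annihilation part)`. -/
def normExp (h : ℂ) (k : ℝ) (φ : LinForm) : Op State := fun s t =>
  if s.1 = t.1 + qShift k φ.2.2.1 then
    Complex.exp (φ.2.2.2 .a * pEig t.1 .a + φ.2.2.2 .b * pEig t.1 .b +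
        φ.2.2.2 .c * pEig t.1 .c + φ.2.2.2 .hat * pEig t.1 .hat) *
      MvPowerSeries.coeff s.2 (creatExp φ.1 *
        (annihExp h k φ.2.1 (MvPolynomial.monomial t.2 1) : MvPowerSeries Mode ℂ))
  else 0

/-- `(q ^ x) ^ D`, where `D` is a function of the zero modes `p`, with the given eigenvalues. -/
def powOp (h x : ℂ) (D : Charge → ℂ) : Op State := fun s t =>
  if s = t then qp h (x * D t.1) else 0

/-- `B(z) = -∑_{n ≠ 0} B_n / [n] z ^ (-n) + q_B + p_B ln z` at `z = q ^ y`. -/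
def fld (h : ℂ) (B : Boson) (y : ℂ) : LinForm :=
  crForm B (fun n => -(qp h ((n : ℕ) * y) / qnum h (-((n : ℕ) : ℂ)))) +
    anForm B (fun n => -(qp h (-((n : ℕ) * y)) / qnum h ((n : ℕ) : ℂ))) +
    qForm B.zero 1 + pForm B.zero (h * y)

/-- `B_+(z) = (q - q⁻¹) ∑_{n > 0} B_n z ^ (-n) + p_B ln q` at `z = q ^ y`. -/
def fldPlus (h : ℂ) (B : Boson) (y : ℂ) : LinForm :=
  anForm B (fun n => (qp h 1 - qp h (-1)) * qp h (-((n : ℕ) * y))) + pForm B.zero h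

/-- `B_-(z) = -((q - q⁻¹) ∑_{n > 0} B_{-n} z ^ n + p_B ln q)` at `z = q ^ y`. -/
def fldMinus (h : ℂ) (B : Boson) (y : ℂ) : LinForm :=
  -(crForm B (fun n => (qp h 1 - qp h (-1)) * qp h ((n : ℕ) * y)) + pForm B.zero h)

/-- `B_+^*(z) = -∑_{n > 0} B_n / [r n] z ^ (-n)` at `z = q ^ y`. -/
def twPlus (h : ℂ) (r : ℝ) (B : Boson) (y : ℂ) : LinForm :=
  anForm B (fun n => -(qp h (-((n : ℕ) * y)) / qnum h (r * (n : ℕ))))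

/-- `B_-^*(z) = ∑_{n > 0} B_{-n} / [r^* n] z ^ n` at `z = q ^ y`; here `rs` is `r^*`. -/
def twMinus (h : ℂ) (rs : ℝ) (B : Boson) (y : ℂ) : LinForm :=
  crForm B (fun n => qp h ((n : ℕ) * y) / qnum h (rs * (n : ℕ)))

/-- `(b + c)(z)` at `z = q ^ y`. -/
def fldBC (h : ℂ) (y : ℂ) : LinForm := fld h .b y + fld h .c y

/-! ### The Wakimoto currents of `U_q(sl₂^)` at `z = q ^ y` -/

/-- `ψ_+(z)`. -/
def psiPlus (h : ℂ) (k : ℝ) (y : ℂ) : Op State :=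
  normExp h k (fldPlus h .b (k / 2 + y) + fldPlus h .a (1 + y) + fldPlus h .b (k / 2 + 2 + y))

/-- `ψ_-(z)`. -/
def psiMinus (h : ℂ) (k : ℝ) (y : ℂ) : Op State :=
  normExp h k
    (fldMinus h .b (-(k / 2) + y) + fldMinus h .a (-1 + y) + fldMinus h .b (-(k / 2 + 2) + y))

/-- `e^+(z)`. -/
def ePlus (h : ℂ) (k : ℝ) (y : ℂ) : Op State :=
  (-1 / ((qp h 1 - qp h (-1)) * qp h y)) •
    (normExp h k (fldPlus h .b y - fldBC h (1 + y)) -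
      normExp h k (fldMinus h .b y - fldBC h (-1 + y)))

/-- `e^-(z)`. -/
def eMinus (h : ℂ) (k : ℝ) (y : ℂ) : Op State :=
  (-1 / ((qp h 1 - qp h (-1)) * qp h y)) •
    (normExp h k (fldBC h (-(k + 1) + y) +
        (fldMinus h .a (-((k + 2) / 2) + y) + fldMinus h .b (-(k + 2) + y))) -
      normExp h k (fldBC h (k + 1 + y) +
        (fldPlus h .a ((k + 2) / 2 + y) + fldPlus h .b (k + 2 + y))))

/-! ### The twisting currents and the elliptic currents, at level `k`, with `r^* = r - k` -/

/-- `U^+(z; r, r^*) = exp [a_-^*(q ^ (r^* + k/2 - 1) z) + b_-^*(q ^ r^* z) + b_-^*(q ^ (r^* - 2) z)]`;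
the last two terms are what is abbreviated as `b_-^*(q ^ (r^* - 1) (q + q⁻¹) z)`. -/
def twistU (h : ℂ) (r k : ℝ) (y : ℂ) : Op State :=
  normExp h k (twMinus h (r - k) .a ((r - k) + k / 2 - 1 + y) +
    (twMinus h (r - k) .b ((r - k) - 1 + 1 + y) + twMinus h (r - k) .b ((r - k) - 1 - 1 + y)))

/-- `U^-(z; r, r^*) = exp [a_+^*(q ^ (-(r - k/2 - 1)) z) + b_+^*(q ^ (-(r - k - 1)) q z)
+ b_+^*(q ^ (-(r - k - 1)) q⁻¹ z)]`. -/
def twistD (h : ℂ) (r k : ℝ) (y : ℂ) : Op State :=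
  normExp h k (twPlus h r .a (-(r - k / 2 - 1) + y) +
    (twPlus h r .b (-(r - k - 1) + 1 + y) + twPlus h r .b (-(r - k - 1) - 1 + y)))

/-- `Ψ^+(z) = U^+(q ^ (k/2) z) ψ_+(z) U^-(q ^ (-k/2) z)`. -/
def PsiPlus (h : ℂ) (r k : ℝ) (y : ℂ) : Op State :=
  opMul (opMul (twistU h r k (k / 2 + y)) (psiPlus h k y)) (twistD h r k (-(k / 2) + y))

/-- `Ψ^-(z) = U^+(q ^ (-k/2) z) ψ_-(z) U^-(q ^ (k/2) z)`. -/
def PsiMinus (h : ℂ) (r k : ℝ) (y : ℂ) : Op State :=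
  opMul (opMul (twistU h r k (-(k / 2) + y)) (psiMinus h k y)) (twistD h r k (k / 2 + y))

/-- `e(z) = U^+(z) e^+(z)`. -/
def eCur (h : ℂ) (r k : ℝ) (y : ℂ) : Op State := opMul (twistU h r k y) (ePlus h k y)

/-- `f(z) = e^-(z) U^-(z)`. -/
def fCur (h : ℂ) (r k : ℝ) (y : ℂ) : Op State := opMul (eMinus h k y) (twistD h r k y)

/-! ### The dressed currents, in the additive variable `u`, `z = q ^ (2u)` -/

/-- `exp (2 q̂)`. -/
def expTwoQhat (h : ℂ) (k : ℝ) : Op State := normExp h k (qForm .hat 2)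

/-- `2 p_b + p_a`. -/
def pDiag (μ : Charge) : ℂ := 2 * pEig μ .b + pEig μ .a

/-- `p̂ - 1`. -/
def pHat (μ : Charge) : ℂ := pEig μ .hat - 1

/-- `H^+(u) = Ψ^+(z) e ^ (2 q̂) (q ^ (-k/2) z) ^ ((2 p_b + p_a) / r)
(q ^ (r - k/2) z) ^ ((p̂ - 1) / r - (p̂ - 1) / r^*)`. -/
def HPlus (h : ℂ) (r k : ℝ) (u : ℂ) : Op State :=
  opMul (opMul (opMul (PsiPlus h r k (2 * u)) (expTwoQhat h k))
    (powOp h (-(k / 2) + 2 * u) fun μ => pDiag μ / r))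
    (powOp h ((r - k / 2) + 2 * u) fun μ => pHat μ / r - pHat μ / (r - k))

/-- `H^-(u) = Ψ^-(z) e ^ (2 q̂) (q ^ (k/2) z) ^ ((2 p_b + p_a) / r)
(q ^ (-(r - k/2)) z) ^ ((p̂ - 1) / r - (p̂ - 1) / r^*)`. -/
def HMinus (h : ℂ) (r k : ℝ) (u : ℂ) : Op State :=
  opMul (opMul (opMul (PsiMinus h r k (2 * u)) (expTwoQhat h k))
    (powOp h (k / 2 + 2 * u) fun μ => pDiag μ / r))
    (powOp h (-(r - k / 2) + 2 * u) fun μ => pHat μ / r - pHat μ / (r - k))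

/-- `E(u) = e(z) e ^ (2 q̂) z ^ (-(p̂ - 1) / r^*)`. -/
def ECur (h : ℂ) (r k : ℝ) (u : ℂ) : Op State :=
  opMul (opMul (eCur h r k (2 * u)) (expTwoQhat h k))
    (powOp h (2 * u) fun μ => -(pHat μ / (r - k)))

/-- `F(u) = f(z) z ^ ((2 p_b + p_a) / r) z ^ ((p̂ - 1) / r)`. -/
def FCur (h : ℂ) (r k : ℝ) (u : ℂ) : Op State :=
  opMul (opMul (fCur h r k (2 * u)) (powOp h (2 * u) fun μ => pDiag μ / r))
    (powOp h (2 * u) fun μ => pHat μ / r)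

/-- The powers of `z` in `E(u)` on the sector of `t` lie in `zExp r k t + ℤ`. -/
def zExp (r k : ℝ) (t : State) : ℂ := -(pHat t.1 / (r - k)) - (pEig t.1 .b + pEig t.1 .c)

/-- The powers of `w` in `F(v)` on the sector of `t` lie in `wExp r t + ℤ`. -/
def wExp (r : ℝ) (t : State) : ℂ :=
  pDiag t.1 / r + pHat t.1 / r + (pEig t.1 .b + pEig t.1 .c)

/-! ### The meaning of the relations -/

/-- The exchange relation `A(u) B(v) = (num (u - v) / den (u - v)) B(v) A(u)`.

Every matrix element of `A(u) B(v)` converges absolutely for `|z| ≫ |w|`, every matrix element of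
`B(v) A(u)` for `|w| ≫ |z|`, where `z = q ^ (2u)` and `w = q ^ (2v)`, and `den (u - v) A(u) B(v)`
and `num (u - v) B(v) A(u)` continue analytically to one and the same entire function of
`(u, v)`. -/
def Exchange {ι : Type} (h : ℂ) (A B : ℂ → Op ι) (num den : ℂ → ℂ) : Prop :=
  ∃ ρ : ℝ, 0 < ρ ∧ ∀ s t : ι, ∃ N : ℂ × ℂ → ℂ, Differentiable ℂ N ∧
    (∀ u v : ℂ, ‖qp h (2 * v)‖ < ρ * ‖qp h (2 * u)‖ →
      Summable (fun m => A u s m * B v m t) ∧ den (u - v) * opMul (A u) (B v) s t = N (u, v)) ∧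
    (∀ u v : ℂ, ‖qp h (2 * u)‖ < ρ * ‖qp h (2 * v)‖ →
      Summable (fun m => B v s m * A u m t) ∧ num (u - v) * opMul (B v) (A u) s t = N (u, v))

/-- `A(u) = ∑_α M_α z ^ α` with `z = q ^ (2u)`: each matrix element is a finite sum of complex
powers of `z`. -/
def HasModes {ι : Type} (h : ℂ) (A : ℂ → Op ι) (M : ℂ → Op ι) : Prop :=
  ∀ s t : ι, (Function.support fun α => M α s t).Finite ∧
    ∀ u : ℂ, A u s t = ∑ᶠ α, M α s t * qp h (2 * u * α)

/-- The coefficient of `x ^ j` in `δ(x) = ∑_{j ∈ ε + ℤ} x ^ j`. -/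
def deltaCoeff (ε j : ℂ) : ℂ := if ∃ n : ℤ, j = ε + n then 1 else 0

/-- The coefficient of `z ^ a w ^ b` in `δ(q ^ x z / w) ∑_γ M_γ (q ^ y z) ^ γ`. -/
def deltaLeft {ι : Type} (h ε x y : ℂ) (M : ℂ → Op ι) (a b : ℂ) (s t : ι) : ℂ :=
  deltaCoeff ε (-b) * qp h (x * (-b)) * (qp h (y * (a + b)) * M (a + b) s t)

/-- The coefficient of `z ^ a w ^ b` in `δ(q ^ x z / w) ∑_γ M_γ (q ^ y w) ^ γ`. -/
def deltaRight {ι : Type} (h ε x y : ℂ) (M : ℂ → Op ι) (a b : ℂ) (s t : ι) : ℂ :=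
  deltaCoeff ε a * qp h (x * a) * (qp h (y * (a + b)) * M (a + b) s t)

/-- The relation
`[E(u), F(v)] = ((q - q⁻¹) z w)⁻¹ (δ(q ^ (-c) z/w) H^+(q ^ (-c/2) z)
  - δ(q ^ c z/w) H^-(q ^ (-c/2) w))`
as an identity of formal series in complex powers of `z` and `w`, coefficient by coefficient (the
coefficient of `z ^ α w ^ β` on the left is that of `z ^ (α+1) w ^ (β+1)` in the bracket on the
right).  Here `ez t + ℤ` and `ew t + ℤ` contain the powers of `z` and of `w` that occur on the
left when the operators act on `t`, and `δ` runs over the coset of `ℤ` that makes the powers on the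
right the same; if `ez t` and `ew t` are integers, this is the usual `δ(x) = ∑_{n ∈ ℤ} x ^ n`. -/
def CommEF {ι : Type} (h c : ℂ) (Hp Hm E F : ℂ → Op ι) (ez ew : ι → ℂ) : Prop :=
  ∃ Mp Mm ME MF : ℂ → Op ι,
    HasModes h Hp Mp ∧ HasModes h Hm Mm ∧ HasModes h E ME ∧ HasModes h F MF ∧
    ∀ (α β : ℂ) (s t : ι),
      (Function.support fun m => ME α s m * MF β m t).Finite ∧
      (Function.support fun m => MF β s m * ME α m t).Finite ∧
      (∑ᶠ m, ME α s m * MF β m t) - (∑ᶠ m, MF β s m * ME α m t) =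
        (qp h 1 - qp h (-1))⁻¹ *
          (deltaLeft h (-ew t) (-c) (-(c / 2)) Mp (α + 1) (β + 1) s t -
            deltaRight h (ez t) c (-(c / 2)) Mm (α + 1) (β + 1) s t)

/-- The defining relations of the elliptic algebra `U_{q,p}(sl₂^)` in the multiplicative form, with
the central element acting as the number `c` and `r^* = r - c`, `p = q ^ (2r)`,
`p^* = q ^ (2r^*)`.  The variable `x` is `u - v`, so that `z / w = q ^ (2x)`. -/
structure IsRealization {ι : Type} (h : ℂ) (r c : ℝ) (Hp Hm E F : ℂ → Op ι) (ez ew : ι → ℂ) :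
    Prop where
  HpHp : Exchange h Hp Hp
    (fun x => qp h (2 * x * (2 * (1 / (r - c) - 1 / r))) *
      (bigTheta (qp h (2 * r)) (qp h (-2 + 2 * x)) *
        bigTheta (qp h (2 * (r - c))) (qp h (2 + 2 * x))))
    (fun x => bigTheta (qp h (2 * r)) (qp h (2 + 2 * x)) *
      bigTheta (qp h (2 * (r - c))) (qp h (-2 + 2 * x)))
  HmHm : Exchange h Hm Hm
    (fun x => qp h (2 * x * (2 * (1 / (r - c) - 1 / r))) *
      (bigTheta (qp h (2 * r)) (qp h (-2 + 2 * x)) *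
        bigTheta (qp h (2 * (r - c))) (qp h (2 + 2 * x))))
    (fun x => bigTheta (qp h (2 * r)) (qp h (2 + 2 * x)) *
      bigTheta (qp h (2 * (r - c))) (qp h (-2 + 2 * x)))
  HpHm : Exchange h Hp Hm
    (fun x => qp h (2 * c * (1 / (r - c) + 1 / r)) * qp h (2 * x * (2 * (1 / (r - c) - 1 / r))) *
      (bigTheta (qp h (2 * r)) (qp h (2 * r - 2 - c + 2 * x)) *
        bigTheta (qp h (2 * (r - c))) (qp h (2 * (r - c) + 2 + c + 2 * x))))
    (fun x => bigTheta (qp h (2 * r)) (qp h (2 * r + 2 - c + 2 * x)) *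
      bigTheta (qp h (2 * (r - c))) (qp h (2 * (r - c) - 2 + c + 2 * x)))
  HpE : Exchange h Hp E
    (fun x => qp h (c / (r - c) - 2) * qp h (2 * x * (2 / (r - c))) *
      bigTheta (qp h (2 * (r - c))) (qp h (2 + c / 2 + 2 * x)))
    (fun x => bigTheta (qp h (2 * (r - c))) (qp h (-2 + c / 2 + 2 * x)))
  HmE : Exchange h Hm E
    (fun x => qp h (-(c / (r - c)) - 2) * qp h (2 * x * (2 / (r - c))) *
      bigTheta (qp h (2 * (r - c))) (qp h (2 - c / 2 + 2 * x)))
    (fun x => bigTheta (qp h (2 * (r - c))) (qp h (-2 - c / 2 + 2 * x)))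
  HpF : Exchange h Hp F
    (fun x => qp h (c / r + 2) * qp h (2 * x * (-(2 / r))) *
      bigTheta (qp h (2 * r)) (qp h (-2 - c / 2 + 2 * x)))
    (fun x => bigTheta (qp h (2 * r)) (qp h (2 - c / 2 + 2 * x)))
  HmF : Exchange h Hm F
    (fun x => qp h (-(c / r) + 2) * qp h (2 * x * (-(2 / r))) *
      bigTheta (qp h (2 * r)) (qp h (-2 + c / 2 + 2 * x)))
    (fun x => bigTheta (qp h (2 * r)) (qp h (2 + c / 2 + 2 * x)))
  EF : CommEF h c Hp Hm E F ez ew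
  EE : Exchange h E E
    (fun x => qp h (-2) * qp h (2 * x * (2 / (r - c))) *
      bigTheta (qp h (2 * (r - c))) (qp h (2 + 2 * x)))
    (fun x => bigTheta (qp h (2 * (r - c))) (qp h (-2 + 2 * x)))
  FF : Exchange h F F
    (fun x => qp h 2 * qp h (2 * x * (-(2 / r))) *
      bigTheta (qp h (2 * r)) (qp h (-2 + 2 * x)))
    (fun x => bigTheta (qp h (2 * r)) (qp h (2 + 2 * x)))

/-- The same relations in the additive form, through the theta functions `θ = θ_r` and
`θ^* = θ_{r^*}`, `r^* = r - c`; the variable `x` is `u - v`. -/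
structure ThetaRelations {ι : Type} (h : ℂ) (r c : ℝ) (Hp Hm E F : ℂ → Op ι) (ez ew : ι → ℂ) :
    Prop where
  HpHp : Exchange h Hp Hp
    (fun x => theta h r (x - 1) * theta h (r - c) (x + 1))
    (fun x => theta h r (x + 1) * theta h (r - c) (x - 1))
  HmHm : Exchange h Hm Hm
    (fun x => theta h r (x - 1) * theta h (r - c) (x + 1))
    (fun x => theta h r (x + 1) * theta h (r - c) (x - 1))
  HpHm : Exchange h Hp Hm
    (fun x => theta h r (x - c / 2 - 1) * theta h (r - c) (x + c / 2 + 1))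
    (fun x => theta h r (x - c / 2 + 1) * theta h (r - c) (x + c / 2 - 1))
  HpE : Exchange h Hp E
    (fun x => theta h (r - c) (x + c / 4 + 1)) (fun x => theta h (r - c) (x + c / 4 - 1))
  HmE : Exchange h Hm E
    (fun x => theta h (r - c) (x - c / 4 + 1)) (fun x => theta h (r - c) (x - c / 4 - 1))
  HpF : Exchange h Hp F
    (fun x => theta h r (x - c / 4 - 1)) (fun x => theta h r (x - c / 4 + 1))
  HmF : Exchange h Hm F
    (fun x => theta h r (x + c / 4 - 1)) (fun x => theta h r (x + c / 4 + 1))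
  EF : CommEF h c Hp Hm E F ez ew
  EE : Exchange h E E
    (fun x => theta h (r - c) (x + 1)) (fun x => theta h (r - c) (x - 1))
  FF : Exchange h F F (fun x => theta h r (x - 1)) (fun x => theta h r (x + 1))

end

end EllipticWakimoto

/-! The currents are treated as matrices in the monomial basis of the Fock space. After all the
normal ordering in their definitions is carried out, `H^±` is a single vertex operator
`χ(p) exp (∑ g_i z ^ n B_{-i}) exp (∑ f_i z ^ (-n) B_i)` (`vtx`), and each of `E`, `F` is a
difference of two such operators (`HPlus_eq`, `HMinus_eq`, `ECur_eq`, `FCur_eq`).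

*Products.* On polynomials the exponential of annihilation operators is a translation
`X_i ↦ X_i + c_i` (`annihExp_eq_transl`), and the exponential of creation operators is a coherent
state, on which a translation acts by a scalar. Hence the product of two vertex operators is the
exponential of the contraction `∑ f_i g'_i x ^ n`, `x = w / z`, times their normal-ordered product;
its matrix elements converge absolutely wherever the contraction does (`hasSum_matEl_mul_matEl`).
The contractions are combinations of Lambert series, whose exponentials are quotients of infinite
products `(q ^ a x; q ^ τ)_∞` (`exists_hasSum_log_qPoch`), and of logarithms of linear functions;
they are computed in the lemmas `contraction_*`.

*Exchange relations.* The normal-ordered product does not depend on the order of the factors, apart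
from powers of `z` and `w` produced by the zero modes, so the two orderings differ by a quotient of
infinite products in `w / z` by one in `z / w`. These combine to theta functions, whose zeros are
exactly the poles of the two products, so that after multiplication by them both orderings continue
to one entire function (`Balanced`, `exchange_vtx`). An exchange relation with the same two
functions is inherited by differences of currents, and `num` and `den` may be multiplied by a common
entire function (`Exchange.gauge`); the latter gives the passage from `Θ` to `θ` and the
quasi-periods in the relation between `H^+` and `H^-`.

*The commutator of `E` and `F`.* Of the four pairs of summands, two have trivial contraction in both
orders, and commute. The other two have a simple pole, with contraction
`(1 - Q ^ 2 c x) / (1 - c x)`. A matrix element of the normal-ordered product is a polynomial in `x`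
up to a power of `x` (`exists_polynomial_matEl`), so the coefficients of either ordering satisfy a
first-order recursion, and their difference is a geometric sequence: a delta function times the
value of the normal-ordered product at the pole (`commutator_of_recursion`,
`levelSum_commutator`). At the pole `x = c⁻¹` the coefficients of `E` and `F` add up to those of
`H^+` or `H^-` (`crE_add_crFp` and the lemmas following it), which gives the right-hand side.
-/

namespace EllipticWakimoto

noncomputable section

open scoped Classical
open Filter Topology

set_option linter.unusedSimpArgs false

/-! ### Divided powers -/

/-- The divided-power monomial `∏ x_i ^ (e i) / (e i)!` in a commutative `ℂ`-algebra. -/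
def divPow {A : Type*} [CommRing A] [Algebra ℂ A] (x : Mode → A) (e : Mode →₀ ℕ) : A :=
  e.prod fun i n => ((n.factorial : ℂ)⁻¹) • x i ^ n

section DivPow

variable {A : Type*} [CommRing A] [Algebra ℂ A]

lemma divPow_zero (x : Mode → A) : divPow x 0 = 1 := Finsupp.prod_zero_index

lemma divPow_add_single (x : Mode → A) (e : Mode →₀ ℕ) (i : Mode) :
    ((e i + 1 : ℕ) : ℂ) • divPow x (e + Finsupp.single i 1) = x i * divPow x e := by
  have h0 : ∀ j, (fun (i : Mode) (n : ℕ) => ((n.factorial : ℂ)⁻¹) • x i ^ n) j 0 = 1 :=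
    fun j => by simp
  rw [divPow, divPow, ← Finsupp.mul_prod_erase' _ i _ h0, ← Finsupp.mul_prod_erase' e i _ h0]
  have he : (e + Finsupp.single i 1).erase i = e.erase i := by
    rw [Finsupp.erase_add, Finsupp.erase_single, add_zero]
  rw [he]
  simp only [Finsupp.add_apply, Finsupp.single_eq_same, Nat.factorial_succ, pow_succ]
  rw [← mul_assoc, ← smul_mul_assoc, smul_smul]
  congr 1
  have h1 : ((e i + 1 : ℕ) : ℂ) ≠ 0 := Nat.cast_ne_zero.mpr (Nat.succ_ne_zero _)
  have h2 : ((e i).factorial : ℂ) ≠ 0 := Nat.cast_ne_zero.mpr (Nat.factorial_ne_zero _)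
  rw [show ((e i + 1 : ℕ) : ℂ) * (((e i + 1) * (e i).factorial : ℕ) : ℂ)⁻¹
    = ((e i).factorial : ℂ)⁻¹ by push_cast at h1 ⊢; field_simp]
  rw [mul_smul_comm, mul_comm (x i)]

/-- The divided powers are the only solution of the differential equations `∂_i F = x_i F` with
constant term `1`. -/
lemma eq_divPow_of_recursion (x : Mode → A) (F : (Mode →₀ ℕ) → A) (h0 : F 0 = 1)
    (hF : ∀ e i, ((e i + 1 : ℕ) : ℂ) • F (e + Finsupp.single i 1) = x i * F e) (e : Mode →₀ ℕ) :
    F e = divPow x e := by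
  induction hn : e.degree generalizing e with
  | zero =>
    rw [Finsupp.degree_eq_zero_iff] at hn
    rw [hn, h0, divPow_zero]
  | succ n ih =>
    obtain ⟨i, hi⟩ : ∃ i, e i ≠ 0 := by
      by_contra! hc
      have : e = 0 := Finsupp.ext hc
      simp [this] at hn
    obtain ⟨e', rfl⟩ : ∃ e', e = e' + Finsupp.single i 1 :=
      ⟨e - Finsupp.single i 1, (tsub_add_cancel_of_le (Finsupp.single_le_iff.mpr (by omega))).symm⟩
    have hd : e'.degree = n := by
      rw [map_add, Finsupp.degree_single] at hn; omega
    have h1 : ((e' i + 1 : ℕ) : ℂ) ≠ 0 := Nat.cast_ne_zero.mpr (Nat.succ_ne_zero _)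
    have := (hF e' i).trans ((congrArg (x i * ·) (ih e' hd)).trans (divPow_add_single x e' i).symm)
    exact (smul_right_injective A h1) this

/-- The binomial theorem for divided powers. -/
lemma divPow_add (x y : Mode → A) (e : Mode →₀ ℕ) :
    divPow (x + y) e =
      ∑ p ∈ Finset.HasAntidiagonal.antidiagonal e, divPow x p.1 * divPow y p.2 := by
  let S : (Mode → A) → MvPowerSeries Mode A := fun z e => divPow z e
  let F := S x
  let G := S y
  have hcoeff : ∀ e, MvPowerSeries.coeff e (F * G) =
      ∑ p ∈ Finset.HasAntidiagonal.antidiagonal e, divPow x p.1 * divPow y p.2 := fun e =>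
    MvPowerSeries.coeff_mul e F G
  have hF : ∀ (z : Mode → A) (i : Mode), MvPowerSeries.pderiv A i (S z) =
      MvPowerSeries.C (z i) * S z := by
    intro z i
    ext e
    rw [MvPowerSeries.coeff_pderiv, MvPowerSeries.coeff_C_mul]
    have := divPow_add_single z e i
    rw [Algebra.smul_def, map_natCast] at this
    rw [mul_comm]
    push_cast at this
    exact this
  rw [← hcoeff]
  refine (eq_divPow_of_recursion (x + y) (fun e => MvPowerSeries.coeff e (F * G)) ?_ ?_ e).symm
  · simp only [hcoeff, Finset.HasAntidiagonal.antidiagonal_zero, Finset.sum_singleton]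
    simp [divPow_zero]
  · intro e i
    have := congrArg (MvPowerSeries.coeff e) ((MvPowerSeries.pderiv A i).leibniz F G)
    rw [MvPowerSeries.coeff_pderiv, hF x i, hF y i] at this
    rw [Algebra.smul_def, map_natCast, mul_comm]
    push_cast
    rw [this, Pi.add_apply, ← MvPowerSeries.coeff_C_mul]
    congr 1
    simp only [smul_eq_mul, map_add]
    ring

end DivPow

lemma creatExp_eq_divPow (x : Mode → ℂ) : creatExp x = divPow x := by
  funext e
  simp only [creatExp, divPow, smul_eq_mul]
  exact Finsupp.prod_congr fun i _ => by rw [div_eq_inv_mul]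

lemma coeff_creatExp (x : Mode → ℂ) (e : Mode →₀ ℕ) :
    MvPowerSeries.coeff e (creatExp x) = divPow x e := by
  rw [creatExp_eq_divPow]; rfl

lemma creatExp_add (x y : Mode → ℂ) : creatExp (x + y) = creatExp x * creatExp y := by
  ext e
  rw [coeff_creatExp, divPow_add, MvPowerSeries.coeff_mul]
  simp only [coeff_creatExp]

lemma divPow_zero_left (e : Mode →₀ ℕ) : divPow (0 : Mode → ℂ) e = if e = 0 then 1 else 0 := by
  split_ifs with h
  · rw [h, divPow_zero]
  · obtain ⟨i, hi⟩ : ∃ i, e i ≠ 0 := by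
      by_contra! hc
      exact h (Finsupp.ext hc)
    rw [divPow, Finsupp.prod]
    exact Finset.prod_eq_zero (Finsupp.mem_support_iff.mpr hi) (by simp [hi])

lemma creatExp_zero : creatExp 0 = 1 := by
  ext e
  rw [coeff_creatExp, divPow_zero_left, MvPowerSeries.coeff_one]

lemma divPow_mul (x y : Mode → ℂ) (e : Mode →₀ ℕ) :
    divPow (fun i => x i * y i) e = divPow x e * (e.prod fun i n => y i ^ n) := by
  simp only [divPow, ← Finsupp.prod_mul]
  exact Finsupp.prod_congr fun i _ => by rw [mul_pow, smul_eq_mul, smul_eq_mul]; ring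

/-! ### Annihilation operators act by translations -/

/-- The translation `X_i ↦ X_i + c_i` of the polynomial ring. -/
def transl (c : Mode → ℂ) : MvPolynomial Mode ℂ →ₐ[ℂ] MvPolynomial Mode ℂ :=
  MvPolynomial.aeval fun i => MvPolynomial.X i + MvPolynomial.C (c i)

/-- The Taylor expansion of `f (X + τ c)` in powers of `τ`. -/
lemma coeff_taylor (D : Derivation ℂ (MvPolynomial Mode ℂ) (MvPolynomial Mode ℂ)) (c : Mode → ℂ)
    (hD : ∀ i, D (MvPolynomial.X i) = MvPolynomial.C (c i)) (f : MvPolynomial Mode ℂ) (j : ℕ) :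
    (MvPolynomial.aeval (R := ℂ) (fun i => Polynomial.C (MvPolynomial.X i : MvPolynomial Mode ℂ) +
      Polynomial.X * Polynomial.C (MvPolynomial.C (c i))) f).coeff j =
      ((j.factorial : ℂ)⁻¹) • ((D : MvPolynomial Mode ℂ → _)^[j] f) := by
  set Ψ : MvPolynomial Mode ℂ →ₐ[ℂ] Polynomial (MvPolynomial Mode ℂ) :=
    MvPolynomial.aeval (fun i => Polynomial.C (MvPolynomial.X i : MvPolynomial Mode ℂ) +
      Polynomial.X * Polynomial.C (MvPolynomial.C (c i))) with hΨ
  have hder : ∀ f, Polynomial.derivative (Ψ f) = Ψ (D f) := by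
    intro f
    induction f using MvPolynomial.induction_on with
    | C a =>
      have h1 : Ψ (MvPolynomial.C a) = algebraMap ℂ _ a := by rw [hΨ, MvPolynomial.aeval_C]
      have h2 : D (MvPolynomial.C a) = 0 := D.map_algebraMap a
      rw [h1, h2, map_zero]
      exact Polynomial.derivative_C
    | add p q hp hq => simp only [map_add, hp, hq]
    | mul_X p i hp =>
      have hC : Ψ (MvPolynomial.C (c i)) = Polynomial.C (MvPolynomial.C (c i)) := by
        rw [hΨ, MvPolynomial.aeval_C]; rfl
      have hX : Ψ (MvPolynomial.X i) = Polynomial.C (MvPolynomial.X i) +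
          Polynomial.X * Polynomial.C (MvPolynomial.C (c i)) := by rw [hΨ, MvPolynomial.aeval_X]
      rw [map_mul, Polynomial.derivative_mul, hp, D.leibniz, hD, map_add, smul_eq_mul, smul_eq_mul,
        map_mul, map_mul, hC, hX]
      simp
      ring
  induction j generalizing f with
  | zero =>
    simp only [Nat.factorial_zero, Nat.cast_one, inv_one, one_smul, Function.iterate_zero, id]
    rw [Polynomial.coeff_zero_eq_eval_zero]
    have : (Polynomial.evalRingHom (0 : MvPolynomial Mode ℂ)).comp (Ψ : _ →+* _) =
        RingHom.id _ := by
      refine MvPolynomial.ringHom_ext (fun a => ?_) (fun i => ?_)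
      · simp [hΨ]
      · simp [hΨ]
    exact congrArg (fun g : MvPolynomial Mode ℂ →+* MvPolynomial Mode ℂ => g f) this
  | succ j ih =>
    have h1 := Polynomial.coeff_derivative (Ψ f) j
    rw [hder, ih, ← Function.iterate_succ_apply] at h1
    have h2 : ((j : ℂ) + 1) ≠ 0 := by exact_mod_cast Nat.succ_ne_zero j
    have h3 : (Ψ f).coeff (j + 1) * ((j : MvPolynomial Mode ℂ) + 1) =
        ((j : ℂ) + 1) • (Ψ f).coeff (j + 1) := by
      rw [Algebra.smul_def, map_add, map_natCast, map_one, mul_comm]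
    rw [h3] at h1
    rw [Nat.factorial_succ]
    push_cast
    rw [mul_inv, ← smul_smul, h1, smul_smul, inv_mul_cancel₀ h2, one_smul]

lemma annihExp_eq_transl (h : ℂ) (k : ℝ) (y : Mode → ℂ) (f : MvPolynomial Mode ℂ) :
    annihExp h k y f = transl (fun i => y i * kappa h k i) f := by
  have hD : ∀ i, annih h k y (MvPolynomial.X i) = MvPolynomial.C (y i * kappa h k i) := fun i =>
    MvPolynomial.mkDerivation_X _ _ _
  simp only [annihExp, ← coeff_taylor _ _ hD]
  set P := (MvPolynomial.aeval (R := ℂ) (fun i => Polynomial.C (MvPolynomial.X i :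
    MvPolynomial Mode ℂ) + Polynomial.X * Polynomial.C (MvPolynomial.C (y i * kappa h k i))) f)
    with hP
  have h1 : (∑ᶠ j, P.coeff j) = P.eval 1 := by
    rw [Polynomial.eval_eq_sum, Polynomial.sum, finsum_eq_sum_of_support_subset (s := P.support)]
    · simp
    · intro j hj; simpa using hj
  rw [h1, hP]
  have : (Polynomial.evalRingHom (1 : MvPolynomial Mode ℂ)).comp
      ((MvPolynomial.aeval (R := ℂ) (fun i => Polynomial.C (MvPolynomial.X i :
    MvPolynomial Mode ℂ) + Polynomial.X * Polynomial.C (MvPolynomial.C (y i * kappa h k i))) :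
      MvPolynomial Mode ℂ →ₐ[ℂ] _) : _ →+* _) =
      (transl (fun i => y i * kappa h k i) : MvPolynomial Mode ℂ →+* MvPolynomial Mode ℂ) := by
    refine MvPolynomial.ringHom_ext (fun a => ?_) (fun i => ?_)
    · simp [transl]
    · simp [transl]
  exact congrArg (fun g : MvPolynomial Mode ℂ →+* MvPolynomial Mode ℂ => g f) this

lemma transl_transl (c d : Mode → ℂ) (f : MvPolynomial Mode ℂ) :
    transl c (transl d f) = transl (c + d) f := by
  have : (transl c).comp (transl d) = transl (c + d) := by
    refine MvPolynomial.algHom_ext fun i => ?_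
    simp [transl]
    ring
  exact congrArg (fun g : MvPolynomial Mode ℂ →ₐ[ℂ] MvPolynomial Mode ℂ => g f) this

lemma transl_zero (f : MvPolynomial Mode ℂ) : transl 0 f = f := by
  simp [transl]

/-- The product of the factorials of the occupation numbers. -/
def occFact (e : Mode →₀ ℕ) : ℂ := e.prod fun _ n => (n.factorial : ℂ)

lemma occFact_ne_zero (e : Mode →₀ ℕ) : occFact e ≠ 0 :=
  Finset.prod_ne_zero_iff.mpr fun _ _ => Nat.cast_ne_zero.mpr (Nat.factorial_ne_zero _)

lemma divPow_eq {A : Type*} [CommRing A] [Algebra ℂ A] (x : Mode → A) (e : Mode →₀ ℕ) :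
    divPow x e = (occFact e)⁻¹ • e.prod fun i n => x i ^ n := by
  simp only [divPow, occFact, Finsupp.prod, Algebra.smul_def, Finset.prod_mul_distrib,
    ← map_prod, Finset.prod_inv_distrib]

lemma divPow_X (e : Mode →₀ ℕ) :
    divPow (fun i => (MvPolynomial.X i : MvPolynomial Mode ℂ)) e =
      (occFact e)⁻¹ • MvPolynomial.monomial e 1 := by
  rw [divPow_eq, MvPolynomial.monomial_eq, map_one, one_mul]

/-- Matrix elements of a translation in the monomial basis. -/
lemma coeff_transl_monomial (c : Mode → ℂ) (d g : Mode →₀ ℕ) :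
    (transl c (MvPolynomial.monomial g 1)).coeff d =
      if d ≤ g then occFact g * (occFact d)⁻¹ * divPow c (g - d) else 0 := by
  have h1 : transl c (MvPolynomial.monomial g 1) = occFact g • divPow
      ((fun i => (MvPolynomial.X i : MvPolynomial Mode ℂ)) + fun i => MvPolynomial.C (c i)) g := by
    rw [divPow_eq, smul_smul, mul_inv_cancel₀ (occFact_ne_zero g), one_smul, transl,
      MvPolynomial.aeval_monomial, map_one, one_mul]
    rfl
  have h2 : ∀ e, divPow (fun i => (MvPolynomial.C (c i) : MvPolynomial Mode ℂ)) e =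
      MvPolynomial.C (divPow c e) := by
    intro e
    simp only [divPow, Finsupp.prod, map_prod, smul_eq_mul, map_mul, map_pow,
      MvPolynomial.smul_eq_C_mul]
  have h3 : ∀ p : (Mode →₀ ℕ) × (Mode →₀ ℕ), MvPolynomial.coeff d
      (divPow (fun i => (MvPolynomial.X i : MvPolynomial Mode ℂ)) p.1 *
        divPow (fun i => (MvPolynomial.C (c i) : MvPolynomial Mode ℂ)) p.2) =
      if p.1 = d then (occFact d)⁻¹ * divPow c p.2 else 0 := by
    intro p
    rw [divPow_X, h2, mul_comm, MvPolynomial.coeff_C_mul, MvPolynomial.coeff_smul,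
      MvPolynomial.coeff_monomial]
    split_ifs with h
    · rw [h, smul_eq_mul, mul_one, mul_comm]
    · simp
  rw [h1, divPow_add, MvPolynomial.coeff_smul, MvPolynomial.coeff_sum, smul_eq_mul]
  simp only [h3]
  split_ifs with h
  · rw [Finset.sum_eq_single (d, g - d)]
    · simp; ring
    · rintro ⟨a, b⟩ hab hne
      rw [if_neg]
      rintro rfl
      apply hne
      rw [Finset.HasAntidiagonal.mem_antidiagonal] at hab
      simp only [] at hab
      rw [← hab, add_tsub_cancel_left]
    · intro hn
      exact absurd (Finset.HasAntidiagonal.mem_antidiagonal.mpr (add_tsub_cancel_of_le h)) hn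
  · rw [Finset.sum_eq_zero, mul_zero]
    rintro ⟨a, b⟩ hab
    rw [if_neg]
    rintro rfl
    rw [Finset.HasAntidiagonal.mem_antidiagonal] at hab
    exact h (hab ▸ le_self_add)

/-! ### The exponential series in infinitely many variables -/

lemma hasSum_of_eq {ι : Type*} {f g : ι → ℂ} {a b : ℂ} (h : HasSum f a) (hfg : ∀ i, g i = f i)
    (hab : b = a) : HasSum g b := by
  rw [hab, funext hfg]; exact h

lemma divPow_erase_mul (z : Mode → ℂ) (e : Mode →₀ ℕ) (i : Mode) :
    divPow z e = z i ^ e i / ((e i).factorial : ℂ) * divPow z (e.erase i) := by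
  have h0 : ∀ j, (fun (i : Mode) (n : ℕ) => ((n.factorial : ℂ)⁻¹) • z i ^ n) j 0 = 1 :=
    fun j => by simp
  rw [divPow, ← Finsupp.mul_prod_erase' e i _ h0, divPow, smul_eq_mul, div_eq_inv_mul]

lemma hasSum_divPow_of_support_subset (z : Mode → ℂ) (S : Finset Mode) :
    HasSum (fun e : Mode →₀ ℕ => if e.support ⊆ S then divPow z e else 0)
      (∏ i ∈ S, Complex.exp (z i)) := by
  induction S using Finset.induction_on with
  | empty =>
    simp only [Finset.prod_empty, Finset.subset_empty, Finsupp.support_eq_empty]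
    convert hasSum_ite_eq (0 : Mode →₀ ℕ) (1 : ℂ) using 2 with e
    split_ifs with he
    · rw [he, divPow_zero]
    · rfl
  | insert a S ha ih =>
    rw [Finset.prod_insert ha]
    have h1 : HasSum (fun n : ℕ => z a ^ n / (n.factorial : ℂ)) (Complex.exp (z a)) := by
      rw [Complex.exp_eq_exp_ℂ]
      exact NormedSpace.expSeries_div_hasSum_exp (z a)
    have hmul : ∀ (f : ℕ → ℂ) (g : (Mode →₀ ℕ) → ℂ) (x y : ℂ), HasSum f x → HasSum g y →
        HasSum (fun p : ℕ × (Mode →₀ ℕ) => f p.1 * g p.2) (x * y) := fun f g x y hf hg =>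
      hf.mul hg (summable_mul_of_summable_norm hf.summable.norm hg.summable.norm)
    have h2 := hmul _ _ _ _ h1 ih
    refine (hasSum_iff_hasSum_of_ne_zero_bij
      (fun e : Function.support (fun e : Mode →₀ ℕ =>
        if e.support ⊆ insert a S then divPow z e else 0) => (e.1 a, e.1.erase a))
      ?_ ?_ ?_).mp h2
    · rintro ⟨e, _⟩ ⟨e', _⟩ h
      simp only [Prod.mk.injEq] at h
      apply Subtype.ext
      change e = e'
      rw [← Finsupp.single_add_erase a e, ← Finsupp.single_add_erase a e', h.1, h.2]
    · rintro ⟨n, e⟩ hne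
      simp only [Function.mem_support, ne_eq, mul_eq_zero, not_or] at hne
      have hS : e.support ⊆ S := by
        by_contra hc
        exact hne.2 (if_neg hc)
      have hae : e a = 0 := by
        by_contra hc
        exact ha (hS (Finsupp.mem_support_iff.mpr hc))
      have hE1 : (Finsupp.single a n + e) a = n := by simp [hae]
      have hE2 : (Finsupp.single a n + e).erase a = e := by
        rw [Finsupp.erase_add, Finsupp.erase_single, zero_add, Finsupp.erase_of_notMem_support]
        simpa using hae
      refine ⟨⟨Finsupp.single a n + e, ?_⟩, by simp only [hE1, hE2]⟩
      have hsub : (Finsupp.single a n + e).support ⊆ insert a S := by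
        intro j hj
        rw [Finset.mem_insert]
        by_contra! hc
        have h3 : e j = 0 := by
          by_contra h4
          exact hc.2 (hS (Finsupp.mem_support_iff.mpr h4))
        simp [h3, hc.1.symm] at hj
      rw [Function.mem_support, if_pos hsub, divPow_erase_mul z _ a, hE1, hE2]
      rw [if_pos hS] at hne
      exact mul_ne_zero hne.1 hne.2
    · rintro ⟨e, he⟩
      have hsub : e.support ⊆ insert a S := by
        by_contra hc
        exact he (if_neg hc)
      have hS : (e.erase a).support ⊆ S := by
        rw [Finsupp.support_erase]
        exact Finset.subset_insert_iff.mp hsub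
      simp only [if_pos hsub, if_pos hS]
      exact (divPow_erase_mul z e a).symm

lemma norm_divPow (z : Mode → ℂ) (e : Mode →₀ ℕ) :
    (‖divPow z e‖ : ℂ) = divPow (fun i => (‖z i‖ : ℂ)) e := by
  simp only [divPow, Finsupp.prod, smul_eq_mul, norm_prod, norm_mul, norm_inv, norm_pow,
    Complex.norm_natCast]
  push_cast
  rfl

lemma summable_norm_divPow {z : Mode → ℂ} (hz : Summable z) :
    Summable fun e => ‖divPow z e‖ := by
  refine summable_of_sum_le (c := Real.exp (∑' i, ‖z i‖)) (fun _ => norm_nonneg _) fun F => ?_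
  set S : Finset Mode := F.biUnion fun e => e.support
  have h1 := hasSum_divPow_of_support_subset (fun i => (‖z i‖ : ℂ)) S
  have h3 : ∀ e, (if e.support ⊆ S then divPow (fun i => (‖z i‖ : ℂ)) e else 0) =
      ((if e.support ⊆ S then ‖divPow z e‖ else 0 : ℝ) : ℂ) := by
    intro e
    rw [← norm_divPow]
    split_ifs <;> simp
  have h4 : HasSum (fun e : Mode →₀ ℕ => if e.support ⊆ S then ‖divPow z e‖ else 0)
      (Real.exp (∑ i ∈ S, ‖z i‖)) := by
    rw [← Complex.hasSum_ofReal]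
    simp only [h3] at h1
    convert h1 using 1
    rw [Complex.ofReal_exp, Complex.ofReal_sum, Complex.exp_sum]
  calc ∑ e ∈ F, ‖divPow z e‖ = ∑ e ∈ F, if e.support ⊆ S then ‖divPow z e‖ else 0 :=
        Finset.sum_congr rfl fun e he => by
          rw [if_pos (Finset.subset_biUnion_of_mem (fun e : Mode →₀ ℕ => e.support) he)]
    _ ≤ Real.exp (∑ i ∈ S, ‖z i‖) := sum_le_hasSum F (fun e _ => by positivity) h4
    _ ≤ _ := Real.exp_le_exp.mpr (hz.norm.sum_le_tsum S fun _ _ => norm_nonneg _)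

/-- `∑_e ∏_i z_i ^ (e i) / (e i)! = exp (∑ z_i)`, the sum being over all occupation numbers of
infinitely many modes. -/
lemma hasSum_divPow {z : Mode → ℂ} {L : ℂ} (hz : HasSum z L) :
    HasSum (divPow z) (Complex.exp L) := by
  have hs := summable_norm_divPow hz.summable
  have h1 : Tendsto (fun S : Finset Mode => ∑' e : Mode →₀ ℕ,
      if e.support ⊆ S then divPow z e else 0) atTop (𝓝 (∑' e, divPow z e)) := by
    refine tendsto_tsum_of_dominated_convergence hs (fun e => ?_)
      (Eventually.of_forall fun S e => ?_)
    · refine tendsto_const_nhds.congr' ?_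
      filter_upwards [eventually_ge_atTop e.support] with S hS
      rw [if_pos hS]
    · split_ifs
      · exact le_rfl
      · simp
  have h2 : Tendsto (fun S : Finset Mode => ∑' e : Mode →₀ ℕ,
      if e.support ⊆ S then divPow z e else 0) atTop (𝓝 (Complex.exp L)) := by
    refine ((Complex.continuous_exp.tendsto L).comp hz).congr fun S => ?_
    rw [(hasSum_divPow_of_support_subset z S).tsum_eq]
    exact Complex.exp_sum _ _
  rw [← tendsto_nhds_unique h1 h2]
  exact hs.of_norm.hasSum

/-! ### Matrix elements of normal-ordered exponentials -/

/-- The matrix element of `exp (∑ x_i B_{-i}) T_c` between occupation numbers, where `T_c`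
translates the variables by `c`. -/
def matEl (x c : Mode → ℂ) (s t : Mode →₀ ℕ) : ℂ :=
  MvPowerSeries.coeff s
    (creatExp x * (transl c (MvPolynomial.monomial t 1) : MvPowerSeries Mode ℂ))

lemma matEl_eq_sum (x c : Mode → ℂ) (s t : Mode →₀ ℕ) :
    matEl x c s t = ∑ p ∈ Finset.HasAntidiagonal.antidiagonal s, divPow x p.1 *
      (if p.2 ≤ t then occFact t * (occFact p.2)⁻¹ * divPow c (t - p.2) else 0) := by
  rw [matEl, MvPowerSeries.coeff_mul]
  simp only [coeff_creatExp, MvPolynomial.coeff_coe, coeff_transl_monomial]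

lemma matEl_zero_zero (s t : Mode →₀ ℕ) : matEl 0 0 s t = if s = t then 1 else 0 := by
  rw [matEl, creatExp_zero, one_mul, MvPolynomial.coeff_coe, transl_zero,
    MvPolynomial.coeff_monomial]
  simp only [eq_comm]

/-- Coherent states: translating and resumming the exponential of the creation operators
multiplies it by the exponential of the contraction `∑ c_i x_i`. -/
lemma hasSum_coeff_transl_mul_divPow {c x : Mode → ℂ} {L : ℂ} (h : HasSum (fun i => c i * x i) L)
    (d : Mode →₀ ℕ) :
    HasSum (fun g => (transl c (MvPolynomial.monomial g 1)).coeff d * divPow x g)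
      (Complex.exp L * divPow x d) := by
  have hinj : Function.Injective (fun g : Mode →₀ ℕ => d + g) := add_right_injective d
  refine (hinj.hasSum_iff ?_).mp ?_
  · intro g hg
    rw [coeff_transl_monomial, if_neg, zero_mul]
    intro hle
    exact hg ⟨g - d, add_tsub_cancel_of_le hle⟩
  · have h1 := (hasSum_divPow h).mul_right (divPow x d)
    refine hasSum_of_eq h1 (fun g => ?_) rfl
    rw [Function.comp_apply, coeff_transl_monomial, if_pos le_self_add, add_tsub_cancel_left,
      divPow_mul,
      divPow_eq x (d + g), divPow_eq x d, smul_eq_mul, smul_eq_mul,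
      Finsupp.prod_add_index' (fun _ => pow_zero _) (fun _ _ _ => pow_add _ _ _)]
    field_simp [occFact_ne_zero]

lemma hasSum_coeff_transl_mul_coeff {c x : Mode → ℂ} {L : ℂ} (h : HasSum (fun i => c i * x i) L)
    (d f : Mode →₀ ℕ) :
    HasSum (fun m => (transl c (MvPolynomial.monomial m 1)).coeff d *
        MvPowerSeries.coeff m (creatExp x *
          ((MvPolynomial.monomial f 1 : MvPolynomial Mode ℂ) : MvPowerSeries Mode ℂ)))
      (Complex.exp L * MvPowerSeries.coeff d
        (creatExp x * (transl c (MvPolynomial.monomial f 1) : MvPowerSeries Mode ℂ))) := by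
  have hinj : Function.Injective (fun g : Mode →₀ ℕ => g + f) := add_left_injective f
  have hco : ∀ m, MvPowerSeries.coeff m
      (creatExp x * ((MvPolynomial.monomial f 1 : MvPolynomial Mode ℂ) : MvPowerSeries Mode ℂ)) =
      if f ≤ m then divPow x (m - f) else 0 := by
    intro m
    rw [MvPolynomial.coe_monomial, MvPowerSeries.coeff_mul_monomial, mul_one, coeff_creatExp]
  refine (hinj.hasSum_iff ?_).mp ?_
  · intro m hm
    rw [hco, if_neg, mul_zero]
    intro hle
    exact hm ⟨m - f, tsub_add_cancel_of_le hle⟩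
  · have h1 : HasSum (fun g => ∑ p ∈ Finset.HasAntidiagonal.antidiagonal d,
        (transl c (MvPolynomial.monomial f 1)).coeff p.2 *
          ((transl c (MvPolynomial.monomial g 1)).coeff p.1 * divPow x g))
        (∑ p ∈ Finset.HasAntidiagonal.antidiagonal d,
          (transl c (MvPolynomial.monomial f 1)).coeff p.2 * (Complex.exp L * divPow x p.1)) :=
      hasSum_sum fun p _ => (hasSum_coeff_transl_mul_divPow h p.1).mul_left _
    refine hasSum_of_eq h1 (fun g => ?_) ?_
    · rw [Function.comp_apply, hco, if_pos le_add_self, add_tsub_cancel_right,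
        show (MvPolynomial.monomial (g + f) (1 : ℂ)) =
          MvPolynomial.monomial g 1 * MvPolynomial.monomial f 1 by
          rw [MvPolynomial.monomial_mul, one_mul], map_mul, MvPolynomial.coeff_mul, Finset.sum_mul]
      exact Finset.sum_congr rfl fun p _ => by ring
    · rw [MvPowerSeries.coeff_mul, Finset.mul_sum]
      refine Finset.sum_congr rfl fun p _ => ?_
      rw [coeff_creatExp, MvPolynomial.coeff_coe]
      ring

/-- The composition of two normal-ordered exponentials: the matrix product converges as soon as the
contraction does, and equals `exp (contraction)` times the normal-ordered product. -/
lemma hasSum_matEl_mul_matEl {x c x' c' : Mode → ℂ} {L : ℂ} (h : HasSum (fun i => c i * x' i) L)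
    (s t : Mode →₀ ℕ) :
    HasSum (fun m => matEl x c s m * matEl x' c' m t)
      (Complex.exp L * matEl (x + x') (c + c') s t) := by
  set P := transl c' (MvPolynomial.monomial t 1) with hP
  have hPsum : P = ∑ f ∈ P.support, MvPolynomial.C (P.coeff f) * MvPolynomial.monomial f 1 := by
    conv_lhs => rw [P.as_sum]
    exact Finset.sum_congr rfl fun f _ => by rw [MvPolynomial.C_mul_monomial, mul_one]
  have hpoly : ∀ (Q : MvPolynomial Mode ℂ →ₐ[ℂ] MvPolynomial Mode ℂ) (y : Mode → ℂ)
      (m : Mode →₀ ℕ), MvPowerSeries.coeff m (creatExp y * (Q P : MvPowerSeries Mode ℂ)) =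
      ∑ f ∈ P.support, P.coeff f * MvPowerSeries.coeff m (creatExp y *
        (Q (MvPolynomial.monomial f 1) : MvPowerSeries Mode ℂ)) := by
    intro Q y m
    conv_lhs => rw [hPsum]
    have hco : ∀ p : MvPolynomial Mode ℂ, (p : MvPowerSeries Mode ℂ) =
      MvPolynomial.coeToMvPowerSeries.ringHom p := fun p => rfl
    simp only [map_sum, map_mul, hco, Finset.mul_sum]
    refine Finset.sum_congr rfl fun f _ => ?_
    rw [← MvPowerSeries.coeff_C_mul, show Q (MvPolynomial.C (P.coeff f)) =
      MvPolynomial.C (P.coeff f) from Q.commutes _]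
    congr 1
    simp
    ring
  have h1 : ∀ d, HasSum (fun m => (transl c (MvPolynomial.monomial m 1)).coeff d *
        MvPowerSeries.coeff m (creatExp x' * (P : MvPowerSeries Mode ℂ)))
      (Complex.exp L * MvPowerSeries.coeff d
        (creatExp x' * (transl c P : MvPowerSeries Mode ℂ))) := by
    intro d
    have := hasSum_sum (s := P.support) fun f _ =>
      (hasSum_coeff_transl_mul_coeff h d f).mul_left (P.coeff f)
    refine hasSum_of_eq this (fun m => ?_) ?_
    · rw [show (P : MvPowerSeries Mode ℂ) = (AlgHom.id ℂ _ P : MvPolynomial Mode ℂ) from rfl, hpoly,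
        Finset.mul_sum]
      exact Finset.sum_congr rfl fun f _ => by
        rw [AlgHom.id_apply]; ring
    · rw [hpoly, Finset.mul_sum]
      exact Finset.sum_congr rfl fun f _ => by ring
  have h2 := hasSum_sum (s := Finset.HasAntidiagonal.antidiagonal s) fun p _ =>
    (h1 p.2).mul_left (divPow x p.1)
  refine hasSum_of_eq h2 (fun m => ?_) ?_
  · rw [matEl, matEl, MvPowerSeries.coeff_mul, Finset.sum_mul]
    exact Finset.sum_congr rfl fun p _ => by
      rw [coeff_creatExp, MvPolynomial.coeff_coe]; ring
  · rw [matEl, creatExp_add, ← transl_transl, ← hP, mul_assoc, MvPowerSeries.coeff_mul,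
      Finset.mul_sum]
    exact Finset.sum_congr rfl fun p _ => by rw [coeff_creatExp]; ring

/-! ### The grading -/

/-- The degree `∑ n · e (B, n)` of a vector of the Fock space. -/
def level (e : Mode →₀ ℕ) : ℕ := e.sum fun i n => n * (i.2 : ℕ)

lemma level_add (d e : Mode →₀ ℕ) : level (d + e) = level d + level e :=
  Finsupp.sum_add_index' (fun _ => Nat.zero_mul _) (fun _ _ _ => Nat.add_mul _ _ _)

lemma divPow_scale (x : Mode → ℂ) (z : ℂ) (e : Mode →₀ ℕ) :
    divPow (fun i => x i * z ^ (i.2 : ℕ)) e = divPow x e * z ^ level e := by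
  rw [divPow_mul, level, Finsupp.sum, ← Finset.prod_pow_eq_pow_sum]
  simp only [Finsupp.prod, ← pow_mul, mul_comm]

/-- Homogeneity under `B_n ↦ z ^ (-n) B_n`: it trades a power of the argument for the degrees of the
two vectors. -/
lemma matEl_scale (x c : Mode → ℂ) {z : ℂ} (hz : z ≠ 0) (s t : Mode →₀ ℕ) :
    matEl (fun i => x i * z ^ (i.2 : ℕ)) (fun i => c i * (z⁻¹) ^ (i.2 : ℕ)) s t * z ^ level t =
      matEl x c s t * z ^ level s := by
  rw [matEl_eq_sum, matEl_eq_sum, Finset.sum_mul, Finset.sum_mul]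
  refine Finset.sum_congr rfl fun p hp => ?_
  rw [Finset.HasAntidiagonal.mem_antidiagonal] at hp
  split_ifs with hle
  · rw [divPow_scale, divPow_scale, ← hp, level_add]
    obtain ⟨g, rfl⟩ := exists_add_of_le hle
    rw [add_tsub_cancel_left, level_add]
    have : z⁻¹ ^ level g * z ^ level g = 1 := by
      rw [← mul_pow, inv_mul_cancel₀ hz, one_pow]
    rw [pow_add, pow_add]
    linear_combination (divPow x p.1 * z ^ level p.1 * (occFact (p.2 + g) * (occFact p.2)⁻¹ *
      divPow c g) * z ^ level p.2) * this
  · simp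

lemma finite_level_eq (N : ℕ) : {e : Mode →₀ ℕ | level e = N}.Finite := by
  have hfin : Finite Boson := by
    refine Finite.of_surjective (fun i : Fin 3 => match i with
      | 0 => Boson.a | 1 => Boson.b | 2 => Boson.c) fun B => ?_
    cases B
    · exact ⟨0, rfl⟩
    · exact ⟨1, rfl⟩
    · exact ⟨2, rfl⟩
  have hM : {i : Mode | (i.2 : ℕ) ≤ N}.Finite := by
    have : {i : Mode | (i.2 : ℕ) ≤ N} ⊆ Set.univ ×ˢ {n : ℕ+ | (n : ℕ) ≤ N} :=
      fun i hi => ⟨trivial, hi⟩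
    refine Set.Finite.subset (Set.finite_univ.prod ?_) this
    exact Set.Finite.preimage PNat.coe_injective.injOn (Set.finite_Iic N)
  set S := hM.toFinset
  have key : ∀ e : Mode →₀ ℕ, level e = N → ∀ i, e i * (i.2 : ℕ) ≤ N := by
    intro e he i
    by_cases hi : i ∈ e.support
    · rw [← he]
      exact Finset.single_le_sum (f := fun i : Mode => e i * (i.2 : ℕ))
        (fun _ _ => Nat.zero_le _) hi
    · simp [Finsupp.notMem_support_iff.mp hi]
  refine Set.Finite.subset
    (Set.finite_Iic (Finsupp.onFinset S (fun i => if i ∈ S then N else 0) (by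
      intro i hi; by_contra hc; exact hi (if_neg hc)))) ?_
  intro e he i
  rw [Finsupp.onFinset_apply]
  by_cases hi : e i = 0
  · rw [hi]; exact Nat.zero_le _
  · have h1 := key e he i
    have h2 : (i.2 : ℕ) ≤ N := le_trans (Nat.le_mul_of_pos_left _ (Nat.pos_of_ne_zero hi)) h1
    rw [if_pos (by simpa [S] using h2)]
    exact le_trans (Nat.le_mul_of_pos_right _ i.2.pos) h1

/-! ### Vertex operators on the Fock space -/

lemma qp_add (h x y : ℂ) : qp h (x + y) = qp h x * qp h y := by
  rw [qp, mul_add, Complex.exp_add, qp, qp]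

lemma qp_neg (h x : ℂ) : qp h (-x) = (qp h x)⁻¹ := by
  rw [qp, mul_neg, Complex.exp_neg, qp]

lemma qp_sub (h x y : ℂ) : qp h (x - y) = qp h x * (qp h y)⁻¹ := by
  rw [sub_eq_add_neg, qp_add, qp_neg]

lemma qp_zero (h : ℂ) : qp h 0 = 1 := by simp [qp]

lemma qp_ne_zero (h x : ℂ) : qp h x ≠ 0 := Complex.exp_ne_zero _

lemma qp_nat_mul (h x : ℂ) (n : ℕ) : qp h (n * x) = qp h x ^ n := by
  rw [qp, qp, ← Complex.exp_nat_mul]; congr 1; ring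

lemma qp_pow (h x : ℂ) (n : ℕ) : qp h x ^ n = qp h (n * x) := (qp_nat_mul h x n).symm

/-- The operator `exp (∑ x_i B_{-i}) T_c χ(p)`, followed by a shift of the charge by `σ`. -/
def vop (σ : Charge) (χ : Charge → ℂ) (x c : Mode → ℂ) : Op State := fun s t =>
  if s.1 = t.1 + σ then χ t.1 * matEl x c s.2 t.2 else 0

lemma normExp_eq_vop (h : ℂ) (k : ℝ) (φ : LinForm) :
    normExp h k φ = vop (qShift k φ.2.2.1)
      (fun μ => Complex.exp (φ.2.2.2 .a * pEig μ .a + φ.2.2.2 .b * pEig μ .b +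
        φ.2.2.2 .c * pEig μ .c + φ.2.2.2 .hat * pEig μ .hat))
      φ.1 (fun i => φ.2.1 i * kappa h k i) := by
  funext s t
  simp only [normExp, vop, matEl, annihExp_eq_transl]

lemma powOp_eq_vop (h x : ℂ) (D : Charge → ℂ) :
    powOp h x D = vop 0 (fun μ => qp h (x * D μ)) 0 0 := by
  funext s t
  simp only [powOp, vop, matEl_zero_zero, add_zero, Prod.ext_iff]
  by_cases h1 : s.1 = t.1 <;> by_cases h2 : s.2 = t.2 <;> simp [h1, h2]

lemma hasSum_vop_mul_vop {σ σ' : Charge} {χ χ' : Charge → ℂ} {x c x' c' : Mode → ℂ} {L : ℂ}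
    (h : HasSum (fun i => c i * x' i) L) (s t : State) :
    HasSum (fun m => vop σ χ x c s m * vop σ' χ' x' c' m t)
      (Complex.exp L * vop (σ + σ') (fun μ => χ (μ + σ') * χ' μ) (x + x') (c + c') s t) := by
  have hinj : Function.Injective (fun e : Mode →₀ ℕ => ((t.1 + σ', e) : State)) := fun e e' he => by
    simpa using he
  refine (hinj.hasSum_iff ?_).mp ?_
  · rintro ⟨μ, e⟩ hm
    have : μ ≠ t.1 + σ' := by
      rintro rfl
      exact hm ⟨e, rfl⟩
    simp [vop, this]
  · have hiff : (s.1 = t.1 + (σ + σ')) ↔ s.1 = t.1 + σ' + σ := by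
      rw [add_comm σ σ', add_assoc]
    by_cases hs : s.1 = t.1 + σ' + σ
    · refine hasSum_of_eq
        ((hasSum_matEl_mul_matEl (x := x) (c' := c') h s.2 t.2).mul_left (χ (t.1 + σ') *
        χ' t.1)) (fun e => ?_) ?_
      · simp only [Function.comp, vop, if_pos hs, if_true]
        ring
      · simp only [vop, if_pos (hiff.mpr hs)]
        ring
    · refine hasSum_of_eq (hasSum_zero (α := ℂ) (β := Mode →₀ ℕ)) (fun e => ?_) ?_
      · simp only [Function.comp, vop, if_neg hs, zero_mul]
      · simp only [vop, if_neg (fun h' => hs (hiff.mp h')), mul_zero]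

lemma hasSum_vop_mul_vop_of_zero {σ σ' : Charge} {χ χ' : Charge → ℂ} {x c x' c' : Mode → ℂ}
    (h : ∀ i, c i * x' i = 0) (s t : State) :
    HasSum (fun m => vop σ χ x c s m * vop σ' χ' x' c' m t)
      (vop (σ + σ') (fun μ => χ (μ + σ') * χ' μ) (x + x') (c + c') s t) := by
  have h0 : HasSum (fun i => c i * x' i) 0 := by simp only [h]; exact hasSum_zero
  have := hasSum_vop_mul_vop (σ := σ) (σ' := σ') (χ := χ) (χ' := χ') (x := x) (c' := c') h0 s t
  rwa [Complex.exp_zero, one_mul] at this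

/-- Vertex operators compose without a scalar factor if no annihilation operator of the first meets
a creation operator of the second. -/
lemma opMul_vop {σ σ' : Charge} {χ χ' : Charge → ℂ} {x c x' c' : Mode → ℂ}
    (h : ∀ i, c i * x' i = 0) :
    opMul (vop σ χ x c) (vop σ' χ' x' c') =
      vop (σ + σ') (fun μ => χ (μ + σ') * χ' μ) (x + x') (c + c') := by
  funext s t
  exact (hasSum_vop_mul_vop_of_zero h s t).tsum_eq

lemma opMul_zeroMode (A : Op State) (σ : Charge) (χ : Charge → ℂ) (s t : State) :
    opMul A (vop σ χ 0 0) s t = A s (t.1 + σ, t.2) * χ t.1 := by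
  rw [opMul, tsum_eq_single (t.1 + σ, t.2)]
  · simp [vop, matEl_zero_zero]
  · rintro ⟨μ, e⟩ hne
    simp only [vop, matEl_zero_zero]
    by_cases h1 : μ = t.1 + σ
    · by_cases h2 : e = t.2
      · exact absurd (by rw [h1, h2]) hne
      · simp [h2]
    · simp [h1]

/-- The homogeneous family of vertex operators `χ(u, p) exp (∑ g_i z ^ n B_{-i}) T_{f z ^ (-n)}`
with `z = q ^ (2u)`. -/
def vtx (h : ℂ) (σ : Charge) (χ : ℂ → Charge → ℂ) (g f : Mode → ℂ) (u : ℂ) : Op State :=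
  vop σ (χ u) (fun i => g i * qp h (2 * u) ^ (i.2 : ℕ))
    (fun i => f i * (qp h (2 * u))⁻¹ ^ (i.2 : ℕ))

lemma vtx_apply (h : ℂ) (σ : Charge) (χ : ℂ → Charge → ℂ) (g f : Mode → ℂ) (u : ℂ) (s t : State) :
    vtx h σ χ g f u s t = if s.1 = t.1 + σ then
      χ u t.1 * (matEl g f s.2 t.2 * qp h (2 * u * ((level s.2 : ℂ) - level t.2))) else 0 := by
  simp only [vtx, vop]
  split_ifs with hs
  · have h1 := matEl_scale g f (qp_ne_zero h (2 * u)) s.2 t.2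
    rw [qp_pow, qp_pow] at h1
    rw [mul_sub, qp_sub, mul_comm (2 * u), mul_comm (2 * u) (level t.2 : ℂ),
      ← mul_assoc (matEl g f s.2 t.2), ← h1, mul_inv_cancel_right₀ (qp_ne_zero h _)]
  · rfl

/-! ### The coefficients of the currents -/

/-- A family indexed by the modes, given boson by boson. -/
def byBoson (fa fb fc : ℕ+ → ℂ) : Mode → ℂ
  | (.a, n) => fa n
  | (.b, n) => fb n
  | (.c, n) => fc n

/-- Creation part of `H^+`. -/
def crHp (h : ℂ) (r k : ℝ) : Mode → ℂ := byBoson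
  (fun n => qp h (n * (r - 1)) / qnum h ((r - k) * n))
  (fun n => qp h (n * (r - k / 2 - 1)) * (qp h n + qp h (-n)) / qnum h ((r - k) * n)) 0

/-- Annihilation part of `H^+`. -/
def anHp (h : ℂ) (r k : ℝ) : Mode → ℂ := byBoson
  (fun n => -(qp h (-(n * (r + 1))) / qnum h (r * n)))
  (fun n => -(qp h (-(n * (r + k / 2 + 1))) * (qp h n + qp h (-n)) / qnum h (r * n))) 0

/-- Creation part of `H^-`. -/
def crHm (h : ℂ) (r k : ℝ) : Mode → ℂ := byBoson
  (fun n => qp h (-(n * (r - k + 1))) / qnum h ((r - k) * n))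
  (fun n => qp h (-(n * (r - k / 2 + 1))) * (qp h n + qp h (-n)) / qnum h ((r - k) * n)) 0

/-- Annihilation part of `H^-`. -/
def anHm (h : ℂ) (r k : ℝ) : Mode → ℂ := byBoson
  (fun n => -(qp h (n * (r - k - 1)) / qnum h (r * n)))
  (fun n => -(qp h (n * (r - k - k / 2 - 1)) * (qp h n + qp h (-n)) / qnum h (r * n))) 0

/-- Creation part of the summand of `E` that contains `c(q ^ ε z)`, `ε = ±1`. -/
def crE (h : ℂ) (r k : ℝ) (ε : ℂ) : Mode → ℂ := byBoson
  (fun n => qp h (n * (r - k / 2 - 1)) / qnum h ((r - k) * n))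
  (fun n => -(qp h n / qnum h n) +
    qp h (n * (r - k - 1)) * (qp h n + qp h (-n)) / qnum h ((r - k) * n))
  (fun n => -(qp h (n * ε) / qnum h n))

/-- Annihilation part of the summand of `E` that contains `c(q ^ ε z)`, `ε = ±1`. -/
def anE (h : ℂ) (ε : ℂ) : Mode → ℂ := byBoson 0
  (fun n => qp h n / qnum h n) (fun n => qp h (-(n * ε)) / qnum h n)

/-- Creation part of the summand of `F` that contains `a_+`. -/
def crFp (h : ℂ) (k : ℝ) : Mode → ℂ := byBoson 0
  (fun n => qp h (n * (k + 1)) / qnum h n) (fun n => qp h (n * (k + 1)) / qnum h n)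

/-- Annihilation part of the summand of `F` that contains `a_+`. -/
def anFp (h : ℂ) (r k : ℝ) : Mode → ℂ := byBoson
  (fun n => -(qp h (-(n * (r + k / 2 + 1))) / qnum h (r * n)))
  (fun n => -(qp h (-(n * (k + 3))) / qnum h n) -
    qp h (n * (r - k - 1)) * (qp h n + qp h (-n)) / qnum h (r * n))
  (fun n => -(qp h (-(n * (k + 1))) / qnum h n))

/-- Creation part of the summand of `F` that contains `a_-`. -/
def crFm (h : ℂ) (k : ℝ) : Mode → ℂ := byBoson
  (fun n => -((qp h 1 - qp h (-1)) * qp h (-(n * (k / 2 + 1)))))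
  (fun n => qp h (-(n * (k + 3))) / qnum h n) (fun n => qp h (-(n * (k + 1))) / qnum h n)

/-- Annihilation part of the summand of `F` that contains `a_-`. -/
def anFm (h : ℂ) (r k : ℝ) : Mode → ℂ := byBoson
  (fun n => -(qp h (n * (r - k / 2 - 1)) / qnum h (r * n)))
  (fun n => -(qp h (n * (k + 1)) / qnum h n) -
    qp h (n * (r - k - 1)) * (qp h n + qp h (-n)) / qnum h (r * n))
  (fun n => -(qp h (n * (k + 1)) / qnum h n))

/-! ### Nonvanishing of the `q`-numbers -/

lemma norm_qp (h x : ℂ) : ‖qp h x‖ = Real.exp (h * x).re := by rw [qp, Complex.norm_exp]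

lemma norm_qp_ofReal_lt_one {h : ℂ} (hq : h.re < 0) {x : ℝ} (hx : 0 < x) : ‖qp h x‖ < 1 := by
  rw [norm_qp, Real.exp_lt_one_iff, Complex.re_mul_ofReal]
  exact mul_neg_of_neg_of_pos hq hx

/-- The exponentials attached to a fixed mode number `n` are monomials in `Q = q ^ n`,
`W = q ^ (n k / 2)`, `R = q ^ (n r)`, `Z = z ^ n` and `e = q ^ (n ε)`; the numbers `1 - q ^ 2`,
`1 - Q ^ 2`, `1 - R ^ 2` and `1 - R ^ 2 W ^ (-4)` do not vanish. -/
lemma exists_monomials {h : ℂ} (hq : h.re < 0) {r k : ℝ} (hr : 0 < r) (hrs : 0 < r - k) (n : ℕ+)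
    (u ε : ℂ) :
    ∃ q Q W R Z e : ℂ, q ≠ 0 ∧ Q ≠ 0 ∧ W ≠ 0 ∧ R ≠ 0 ∧ Z ≠ 0 ∧ e ≠ 0 ∧
      q ^ 2 - 1 ≠ 0 ∧ Q ^ 2 - 1 ≠ 0 ∧ 1 - Q ^ 2 ≠ 0 ∧ R ^ 2 - 1 ≠ 0 ∧ 1 - R ^ 2 ≠ 0 ∧
      R ^ 2 - W ^ 4 ≠ 0 ∧ W ^ 4 - R ^ 2 ≠ 0 ∧
      qp h 1 = q ∧ qp h n = Q ∧ qp h (n * (2 / 2)) = Q ∧ qp h (n * 2) = Q ^ 2 ∧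
      qp h (2 * n) = Q ^ 2 ∧
      qp h (n * 3) = Q ^ 3 ∧ qp h (n * k) = W ^ 2 ∧ qp h (k * n) = W ^ 2 ∧
      qp h (n * (k / 2)) = W ∧ qp h (n * r) = R ∧ qp h (r * n) = R ∧
      qp h (n * (2 * u)) = Z ∧ qp h (2 * u) ^ (n : ℕ) = Z ∧
      qp h (n * ε) = e ∧ qp h (2 * (n * r)) = R ^ 2 ∧ qp h (2 * (n * k)) = W ^ 4 := by
  have hn : (0 : ℝ) < (n : ℕ) := Nat.cast_pos.mpr n.pos
  have key : ∀ x y : ℂ, ∀ t : ℝ, x * y⁻¹ = qp h t → 0 < t → y ≠ 0 → x ^ 2 - y ^ 2 ≠ 0 := by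
    intro x y t hxy ht hy h0
    have h1 := norm_qp_ofReal_lt_one hq ht
    have h2 : qp h t * qp h t = 1 := by
      rw [← hxy]
      field_simp
      linear_combination h0
    have h4 := congrArg norm h2
    rw [norm_mul, norm_one] at h4
    nlinarith [norm_nonneg (qp h t)]
  have hsq : ∀ x : ℂ, qp h (2 * x) = qp h x ^ 2 := fun x => by
    rw [two_mul, qp_add, sq]
  have hQ : qp h n ^ 2 - 1 ≠ 0 := by
    simpa using key (qp h n) 1 (n : ℕ) (by simp) hn one_ne_zero
  have hR : qp h (n * r) ^ 2 - 1 ≠ 0 := by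
    simpa using key (qp h (n * r)) 1 ((n : ℕ) * r) (by simp) (mul_pos hn hr) one_ne_zero
  have hS : qp h (n * r) ^ 2 - qp h (n * (k / 2)) ^ 4 ≠ 0 := by
    have := key (qp h (n * r)) (qp h (n * (k / 2)) ^ 2) ((n : ℕ) * (r - k)) (by
      rw [← hsq, ← qp_sub]
      congr 1
      push_cast
      ring) (mul_pos hn hrs) (pow_ne_zero _ (qp_ne_zero h _))
    rwa [← pow_mul] at this
  refine ⟨qp h 1, qp h n, qp h (n * (k / 2)), qp h (n * r), qp h (n * (2 * u)), qp h (n * ε),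
    qp_ne_zero h _, qp_ne_zero h _, qp_ne_zero h _, qp_ne_zero h _, qp_ne_zero h _,
    qp_ne_zero h _, ?_, hQ, sub_ne_zero.mpr (sub_ne_zero.mp hQ).symm, hR,
    sub_ne_zero.mpr (sub_ne_zero.mp hR).symm, hS, sub_ne_zero.mpr (sub_ne_zero.mp hS).symm,
    rfl, rfl, ?_, ?_, hsq _, ?_, ?_, ?_, rfl, rfl, ?_, rfl, ?_, rfl, hsq _, ?_⟩
  · simpa using key (qp h 1) 1 1 (by simp) one_pos one_ne_zero
  · rw [div_self two_ne_zero, mul_one]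
  · rw [mul_comm, hsq]
  · rw [← qp_nat_mul]; congr 1; push_cast; ring
  · rw [← hsq]; congr 1; ring
  · rw [← hsq]; congr 1; ring
  · rw [mul_comm]
  · rw [qp_nat_mul]
  · rw [← qp_nat_mul]; congr 1; push_cast; ring

/-! ### The currents as vertex operators -/

section

/-- Charge of `H^±`. -/
def chH : Charge
  | .hat => 2
  | _ => 0

/-- Charge of `E`. -/
def chE : Charge
  | .b => -1
  | .c => -1
  | .a => 0
  | .hat => 2

/-- Charge of `F`. -/
def chF : Charge
  | .b => 1
  | .c => 1
  | _ => 0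

/-- Zero-mode factor of `H^+`. -/
def zmHp (h : ℂ) (r k : ℝ) (u : ℂ) (μ : Charge) : ℂ :=
  qp h (pDiag μ + (-(k / 2) + 2 * u) * (pDiag μ / r) +
    ((r - k / 2) + 2 * u) * (pHat μ / r - pHat μ / (r - k)))

/-- Zero-mode factor of `H^-`. -/
def zmHm (h : ℂ) (r k : ℝ) (u : ℂ) (μ : Charge) : ℂ :=
  qp h (-pDiag μ + (k / 2 + 2 * u) * (pDiag μ / r) +
    (-(r - k / 2) + 2 * u) * (pHat μ / r - pHat μ / (r - k)))

/-- Zero-mode factor of the summands of `E`. -/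
def zmE (h : ℂ) (r k : ℝ) (ε : ℂ) (u : ℂ) (μ : Charge) : ℂ :=
  -(qp h 1 - qp h (-1))⁻¹ * qp h (-(ε * pEig μ .c) - 2 * u * (pEig μ .b + pEig μ .c + 1) -
    2 * u * (pHat μ / (r - k)))

/-- Zero-mode factor of the summands of `F`. -/
def zmF (h : ℂ) (r k : ℝ) (ε : ℂ) (u : ℂ) (μ : Charge) : ℂ :=
  -(qp h 1 - qp h (-1))⁻¹ * qp h (ε * ((k + 2) * pEig μ .b + (k + 1) * pEig μ .c + pEig μ .a) +
    2 * u * (pEig μ .b + pEig μ .c - 1) + 2 * u * (pDiag μ / r) + 2 * u * (pHat μ / r))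

/-- Absorbs the commutator `[B_n, B_{-n}]` into the coefficients of the `B_n`. -/
def withKappa (h : ℂ) (k : ℝ) (f : Mode → ℂ) : Mode → ℂ := fun i => f i * kappa h k i

/-- `H^+` as a vertex operator. -/
def vHp (h : ℂ) (r k : ℝ) : ℂ → Op State :=
  vtx h chH (zmHp h r k) (crHp h r k) (withKappa h k (anHp h r k))

/-- `H^-` as a vertex operator. -/
def vHm (h : ℂ) (r k : ℝ) : ℂ → Op State :=
  vtx h chH (zmHm h r k) (crHm h r k) (withKappa h k (anHm h r k))

/-- The summand of `E` that contains `c(q ^ ε z)`, `ε = ±1`, as a vertex operator. -/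
def vE (h : ℂ) (r k : ℝ) (ε : ℂ) : ℂ → Op State :=
  vtx h chE (zmE h r k ε) (crE h r k ε) (withKappa h k (anE h ε))

/-- The summand of `F` that contains `a_+`, as a vertex operator. -/
def vFp (h : ℂ) (r k : ℝ) : ℂ → Op State :=
  vtx h chF (zmF h r k 1) (crFp h k) (withKappa h k (anFp h r k))

/-- The summand of `F` that contains `a_-`, as a vertex operator. -/
def vFm (h : ℂ) (r k : ℝ) : ℂ → Op State :=
  vtx h chF (zmF h r k (-1)) (crFm h k) (withKappa h k (anFm h r k))

lemma vop_congr {σ σ' : Charge} {χ χ' : Charge → ℂ} {x c x' c' : Mode → ℂ} (h1 : σ = σ')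
    (h2 : ∀ μ, χ μ = χ' μ) (h3 : ∀ i, x i = x' i) (h4 : ∀ i, c i = c' i) :
    vop σ χ x c = vop σ' χ' x' c' := by
  rw [h1, funext h2, funext h3, funext h4]

lemma qShift_a (k : ℝ) (x : ZeroMode → ℂ) : qShift k x .a = 2 * ((k : ℂ) + 2) * x .a := rfl
lemma qShift_b (k : ℝ) (x : ZeroMode → ℂ) : qShift k x .b = x .b := rfl
lemma qShift_c (k : ℝ) (x : ZeroMode → ℂ) : qShift k x .c = x .c := rfl
lemma qShift_hat (k : ℝ) (x : ZeroMode → ℂ) : qShift k x .hat = x .hat := rfl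

variable {h : ℂ} {r k : ℝ}

/-- The three factors of `Ψ^+` are already in normal order, so no contraction arises; the
coefficients of equal modes are added up. -/
lemma HPlus_eq (hq : h.re < 0) (hr : 0 < r) (hrs : 0 < r - k) (u : ℂ) :
    HPlus h r k u = vHp h r k u := by
  simp only [HPlus, PsiPlus, twistU, psiPlus, twistD, expTwoQhat, normExp_eq_vop, powOp_eq_vop]
  rw [opMul_vop, opMul_vop, opMul_vop, opMul_vop, opMul_vop, vHp, vtx]
  · refine vop_congr ?_ ?_ ?_ ?_
    · funext i
      cases i <;> simp [qShift, chH, twMinus, twPlus, fldPlus, crForm, anForm, pForm, qForm]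
    · intro μ
      simp only [twMinus, twPlus, fldPlus, crForm, anForm, pForm, qForm, pEig, zmHp, Boson.zero,
        pDiag, pHat]
      simp [qp, ← Complex.exp_add, qShift_a, qShift_b, qShift_c, qShift_hat]
      ring_nf
    · rintro ⟨B, n⟩
      obtain ⟨q, Q, W, R, Z, e, _, _, _, _, _, _, _, _, _, _, _, _, _, hE⟩ :=
        exists_monomials hq hr hrs n u 0
      cases B <;> simp [twMinus, twPlus, fldPlus, crForm, anForm, pForm, qForm, crHp, byBoson, qnum,
        withKappa]
      all_goals
        simp only [mul_add, mul_sub, add_mul, sub_mul, mul_neg, neg_add, neg_sub, neg_neg,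
          qp_add, qp_sub, qp_neg, mul_one, one_mul, hE]
        field_simp
        try ring
    · rintro ⟨B, n⟩
      obtain ⟨q, Q, W, R, Z, e, _, _, _, _, _, _, _, _, _, _, _, _, _, hE⟩ :=
        exists_monomials hq hr hrs n u 0
      cases B <;> simp [twMinus, twPlus, fldPlus, crForm, anForm, pForm, qForm, anHp, byBoson, qnum,
        withKappa]
      all_goals
        simp only [mul_add, mul_sub, add_mul, sub_mul, mul_neg, neg_add, neg_sub, neg_neg,
          qp_add, qp_sub, qp_neg, mul_one, one_mul, hE]
        field_simp
        try ring
  all_goals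
    intro i
    simp [twMinus, twPlus, fldPlus, crForm, anForm, pForm, qForm]

lemma HMinus_eq (hq : h.re < 0) (hr : 0 < r) (hrs : 0 < r - k) (u : ℂ) :
    HMinus h r k u = vHm h r k u := by
  simp only [HMinus, PsiMinus, twistU, psiMinus, twistD, expTwoQhat, normExp_eq_vop, powOp_eq_vop]
  rw [opMul_vop, opMul_vop, opMul_vop, opMul_vop, opMul_vop, vHm, vtx]
  · refine vop_congr ?_ ?_ ?_ ?_
    · funext i
      cases i <;> simp [qShift, chH, twMinus, twPlus, fldMinus, crForm, anForm, pForm, qForm]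
    · intro μ
      simp only [twMinus, twPlus, fldMinus, crForm, anForm, pForm, qForm, pEig, zmHm, Boson.zero,
        pDiag, pHat]
      simp [qp, ← Complex.exp_add, qShift_a, qShift_b, qShift_c, qShift_hat]
      ring_nf
    · rintro ⟨B, n⟩
      obtain ⟨q, Q, W, R, Z, e, _, _, _, _, _, _, _, _, _, _, _, _, _, hE⟩ :=
        exists_monomials hq hr hrs n u 0
      cases B <;> simp [twMinus, twPlus, fldMinus, crForm, anForm, pForm, qForm, crHm, byBoson,
          qnum,
        withKappa]
      all_goals
        simp only [mul_add, mul_sub, add_mul, sub_mul, mul_neg, neg_add, neg_sub, neg_neg,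
          qp_add, qp_sub, qp_neg, mul_one, one_mul, hE]
        field_simp
        try ring
    · rintro ⟨B, n⟩
      obtain ⟨q, Q, W, R, Z, e, _, _, _, _, _, _, _, _, _, _, _, _, _, hE⟩ :=
        exists_monomials hq hr hrs n u 0
      cases B <;> simp [twMinus, twPlus, fldMinus, crForm, anForm, pForm, qForm, anHm, byBoson,
          qnum,
        withKappa]
      all_goals
        simp only [mul_add, mul_sub, add_mul, sub_mul, mul_neg, neg_add, neg_sub, neg_neg,
          qp_add, qp_sub, qp_neg, mul_one, one_mul, hE]
        field_simp
        try ring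
  all_goals
    intro i
    simp [twMinus, twPlus, fldMinus, crForm, anForm, pForm, qForm]

lemma opMul_smul_sub {A B C : Op State} (c : ℂ) (hB : ∀ s t, Summable fun m => A s m * B m t)
    (hC : ∀ s t, Summable fun m => A s m * C m t) :
    opMul A (c • (B - C)) = c • (opMul A B - opMul A C) := by
  funext s t
  simp only [opMul, Pi.smul_apply, Pi.sub_apply, smul_eq_mul]
  rw [← (hB s t).tsum_sub (hC s t), ← tsum_mul_left]
  exact tsum_congr fun m => by ring

lemma smul_sub_opMul {A B C : Op State} (c : ℂ) (hB : ∀ s t, Summable fun m => B s m * A m t)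
    (hC : ∀ s t, Summable fun m => C s m * A m t) :
    opMul (c • (B - C)) A = c • (opMul B A - opMul C A) := by
  funext s t
  simp only [opMul, Pi.smul_apply, Pi.sub_apply, smul_eq_mul]
  rw [← (hB s t).tsum_sub (hC s t), ← tsum_mul_left]
  exact tsum_congr fun m => by ring

lemma summable_vop_mul_vop {σ σ' : Charge} {χ χ' : Charge → ℂ} {x c x' c' : Mode → ℂ}
    (h : ∀ i, c i * x' i = 0) (s t : State) :
    Summable fun m => vop σ χ x c s m * vop σ' χ' x' c' m t :=
  (hasSum_vop_mul_vop_of_zero h s t).summable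

lemma smul_vop (a : ℂ) (σ : Charge) (χ : Charge → ℂ) (x c : Mode → ℂ) :
    a • vop σ χ x c = vop σ (fun μ => a * χ μ) x c := by
  funext s t
  simp only [vop, Pi.smul_apply, smul_eq_mul]
  split_ifs <;> ring

lemma sub_opMul_zeroMode (A B : Op State) (σ : Charge) (χ : Charge → ℂ) :
    opMul (A - B) (vop σ χ 0 0) = opMul A (vop σ χ 0 0) - opMul B (vop σ χ 0 0) := by
  funext s t
  simp only [Pi.sub_apply, opMul_zeroMode]
  ring

/-- The prefactor `-1 / ((q - q⁻¹) z)` is absorbed into the zero-mode factors of the summands. -/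
lemma ECur_eq (hq : h.re < 0) (hr : 0 < r) (hrs : 0 < r - k) (u : ℂ) :
    ECur h r k u = vE h r k 1 u - vE h r k (-1) u := by
  simp only [ECur, eCur, twistU, ePlus, expTwoQhat, normExp_eq_vop, powOp_eq_vop]
  rw [opMul_smul_sub, opMul_vop, opMul_vop, smul_sub, smul_vop, smul_vop]
  · have hx : ((qForm .hat 2 : LinForm).1 = 0) := rfl
    have hc : (fun i => (qForm .hat 2 : LinForm).2.1 i * kappa h k i) = 0 := by
      funext i; simp [qForm]
    rw [hx, hc, sub_opMul_zeroMode, sub_opMul_zeroMode]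
    rw [opMul_vop (fun i => by simp), opMul_vop (fun i => by simp), opMul_vop (fun i => by simp),
      opMul_vop (fun i => by simp), vE, vE, vtx, vtx]
    congr 1
    all_goals
      refine vop_congr ?_ ?_ ?_ ?_
      · funext i
        cases i <;> simp [qShift, chE, twMinus, fldPlus, fldMinus, fldBC, fld, crForm, anForm,
          pForm, qForm, Boson.zero]
      · intro μ
        simp only [twMinus, fldPlus, fldMinus, fldBC, fld, crForm, anForm, pForm, qForm, pEig, zmE,
          Boson.zero, pDiag, pHat]
        simp [← Complex.exp_add, qShift_a, qShift_b, qShift_c, qShift_hat]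
        have hz : -1 / ((qp h 1 - qp h (-1)) * qp h (2 * u)) =
            -((qp h 1 - qp h (-1))⁻¹ * qp h (-(2 * u))) := by
          rw [qp_neg h (2 * u), neg_div, one_div, mul_inv]
        rw [hz]
        generalize (qp h 1 - qp h (-1))⁻¹ = δ
        simp only [qp, neg_mul, mul_assoc, ← Complex.exp_add]
        congr 3
        ring
      · rintro ⟨B, n⟩
        obtain ⟨q, Q, W, R, Z, e, _, _, _, _, _, _, _, _, _, _, _, _, _, hE⟩ :=
          exists_monomials hq hr hrs n u 0
        cases B <;> simp [twMinus, fldPlus, fldMinus, fldBC, fld, crForm, anForm, pForm, qForm,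
          crE, byBoson, qnum, withKappa]
        all_goals
          simp only [mul_add, mul_sub, add_mul, sub_mul, mul_neg, neg_add, neg_sub, neg_neg,
            qp_add, qp_sub, qp_neg, mul_one, one_mul, hE]
          field_simp
          try ring
      · rintro ⟨B, n⟩
        obtain ⟨q, Q, W, R, Z, e, _, _, _, _, _, _, _, _, _, _, _, _, _, hE⟩ :=
          exists_monomials hq hr hrs n u 0
        cases B <;> simp [twMinus, fldPlus, fldMinus, fldBC, fld, crForm, anForm, pForm, qForm,
          anE, byBoson, qnum, withKappa]
        all_goals
          simp only [mul_add, mul_sub, add_mul, sub_mul, mul_neg, neg_add, neg_sub, neg_neg,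
            qp_add, qp_sub, qp_neg, mul_one, one_mul, hE]
          field_simp
          try ring
  all_goals
    intros
    first
      | refine summable_vop_mul_vop (fun i => ?_) _ _
        simp [twMinus, fldPlus, fldMinus, fldBC, fld, crForm, anForm, pForm, qForm]
      | simp [twMinus, fldPlus, fldMinus, fldBC, fld, crForm, anForm, pForm, qForm]

lemma FCur_eq (hq : h.re < 0) (hr : 0 < r) (hrs : 0 < r - k) (u : ℂ) :
    FCur h r k u = vFm h r k u - vFp h r k u := by
  simp only [FCur, fCur, twistD, eMinus, normExp_eq_vop, powOp_eq_vop]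
  rw [smul_sub_opMul, opMul_vop, opMul_vop, smul_sub, smul_vop, smul_vop]
  · rw [sub_opMul_zeroMode, sub_opMul_zeroMode]
    rw [opMul_vop (fun i => by simp), opMul_vop (fun i => by simp), opMul_vop (fun i => by simp),
      opMul_vop (fun i => by simp), vFm, vFp, vtx, vtx]
    congr 1
    all_goals
      refine vop_congr ?_ ?_ ?_ ?_
      · funext i
        cases i <;> simp [qShift, chF, twPlus, fldPlus, fldMinus, fldBC, fld, crForm, anForm,
          pForm, qForm, Boson.zero]
      · intro μ
        simp only [twPlus, fldPlus, fldMinus, fldBC, fld, crForm, anForm, pForm, qForm, pEig, zmF,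
          Boson.zero, pDiag, pHat]
        simp [← Complex.exp_add, qShift_a, qShift_b, qShift_c, qShift_hat]
        have hz : -1 / ((qp h 1 - qp h (-1)) * qp h (2 * u)) =
            -((qp h 1 - qp h (-1))⁻¹ * qp h (-(2 * u))) := by
          rw [qp_neg h (2 * u), neg_div, one_div, mul_inv]
        rw [hz]
        generalize (qp h 1 - qp h (-1))⁻¹ = δ
        simp only [qp, neg_mul, mul_assoc, ← Complex.exp_add]
        congr 3
        ring
      · rintro ⟨B, n⟩
        obtain ⟨q, Q, W, R, Z, e, _, _, _, _, _, _, _, _, _, _, _, _, _, hE⟩ :=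
          exists_monomials hq hr hrs n u 0
        cases B <;> simp [twPlus, fldPlus, fldMinus, fldBC, fld, crForm, anForm, pForm, qForm,
          crFp, crFm, byBoson, qnum, withKappa]
        all_goals
          simp only [mul_add, mul_sub, add_mul, sub_mul, mul_neg, neg_add, neg_sub, neg_neg,
            qp_add, qp_sub, qp_neg, mul_one, one_mul, add_div, hE]
          field_simp
          try ring
      · rintro ⟨B, n⟩
        obtain ⟨q, Q, W, R, Z, e, _, _, _, _, _, _, _, _, _, _, _, _, _, hE⟩ :=
          exists_monomials hq hr hrs n u 0
        cases B <;> simp [twPlus, fldPlus, fldMinus, fldBC, fld, crForm, anForm, pForm, qForm,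
          anFp, anFm, byBoson, qnum, withKappa]
        all_goals
          simp only [mul_add, mul_sub, add_mul, sub_mul, mul_neg, neg_add, neg_sub, neg_neg,
            qp_add, qp_sub, qp_neg, mul_one, one_mul, add_div, hE]
          field_simp
          try ring
  all_goals
    intros
    first
      | refine summable_vop_mul_vop (fun i => ?_) _ _
        simp [twPlus, fldPlus, fldMinus, fldBC, fld, crForm, anForm, pForm, qForm]
      | simp [twPlus, fldPlus, fldMinus, fldBC, fld, crForm, anForm, pForm, qForm]

end

/-! ### Infinite products -/

lemma summable_mul_pow (x : ℂ) {t : ℂ} (ht : ‖t‖ < 1) : Summable fun n : ℕ => ‖-(x * t ^ n)‖ := by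
  simp only [norm_neg, norm_mul, norm_pow]
  exact (summable_geometric_of_lt_one (norm_nonneg t) ht).mul_left _

lemma qPoch_eq_mul {t : ℂ} (ht : ‖t‖ < 1) (x : ℂ) : qPoch x t = (1 - x) * qPoch (x * t) t := by
  have hm : Multipliable fun n : ℕ => 1 - x * t * t ^ n := by
    simpa only [sub_eq_add_neg] using
      multipliable_one_add_of_summable (summable_mul_pow (x * t) ht)
  rw [qPoch, qPoch, tprod_eq_zero_mul' (f := fun n : ℕ => 1 - x * t ^ n)]
  · simp only [pow_zero, mul_one, pow_succ', mul_assoc]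
  · simpa only [pow_succ', mul_assoc] using hm

lemma differentiable_qPoch {t : ℂ} (ht : ‖t‖ < 1) : Differentiable ℂ fun x => qPoch x t := by
  have key : ∀ R : ℝ, DifferentiableOn ℂ (fun x => qPoch x t) (Metric.ball 0 R) := by
    intro R
    have h1 := Summable.hasProdLocallyUniformlyOn_nat_one_add (K := Metric.ball (0 : ℂ) R)
      (f := fun n x => -(x * t ^ n)) (u := fun n => R * ‖t‖ ^ n) Metric.isOpen_ball
      ((summable_geometric_of_lt_one (norm_nonneg t) ht).mul_left _)
      (Eventually.of_forall fun n x hx => by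
        rw [norm_neg, norm_mul, norm_pow]
        exact mul_le_mul_of_nonneg_right (mem_ball_zero_iff.mp hx).le (by positivity))
      (fun n => by fun_prop)
    have h2 := h1.tendstoLocallyUniformlyOn_finsetRange
    refine (h2.differentiableOn (Eventually.of_forall fun n => ?_) Metric.isOpen_ball).congr
      fun x _ => by simp only [qPoch, sub_eq_add_neg]
    fun_prop
  intro x
  exact (key (‖x‖ + 1)).differentiableAt (Metric.isOpen_ball.mem_nhds (by simp))

lemma hasSum_neg_log {z : ℂ} (hz : ‖z‖ < 1) :
    HasSum (fun n : ℕ+ => z ^ (n : ℕ) / (n : ℕ)) (-Complex.log (1 - z)) := by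
  refine (PNat.coe_injective.hasSum_iff (f := fun n : ℕ => z ^ n / (n : ℂ)) ?_).mpr
    (Complex.hasSum_taylorSeries_neg_log hz)
  intro n hn
  have : n = 0 := by
    by_contra h0
    exact hn ⟨⟨n, Nat.pos_of_ne_zero h0⟩, rfl⟩
  simp [this]

lemma one_sub_ne_zero {z : ℂ} (hz : ‖z‖ < 1) : 1 - z ≠ 0 := by
  intro h0
  rw [← sub_eq_zero.mp h0] at hz
  simp at hz

/-- The logarithm of `(x; t)_∞` as a Lambert series. -/
lemma exists_hasSum_log_qPoch {t : ℂ} (ht : ‖t‖ < 1) {x : ℂ} (hx : ‖x‖ < 1) :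
    ∃ L, HasSum (fun n : ℕ+ => x ^ (n : ℕ) / ((n : ℕ) * (1 - t ^ (n : ℕ)))) L ∧
      Complex.exp (-L) = qPoch x t := by
  have hxt : ∀ m : ℕ, ‖x * t ^ m‖ < 1 := fun m => by
    rw [norm_mul, norm_pow]
    exact mul_lt_one_of_nonneg_of_lt_one_left (norm_nonneg x) hx (pow_le_one₀ (norm_nonneg t) ht.le)
  have hsum : Summable fun p : ℕ × ℕ+ => (x * t ^ p.1) ^ (p.2 : ℕ) / ((p.2 : ℕ) : ℂ) := by
    have h1 : Summable fun p : ℕ × ℕ+ => ‖t‖ ^ p.1 * ‖x‖ ^ (p.2 : ℕ) :=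
      (summable_geometric_of_lt_one (norm_nonneg t) ht).mul_of_nonneg
        ((summable_geometric_of_lt_one (norm_nonneg x) hx).comp_injective PNat.coe_injective)
        (fun _ => pow_nonneg (norm_nonneg _) _) (fun _ => pow_nonneg (norm_nonneg _) _)
    refine Summable.of_norm_bounded h1 fun p => ?_
    rw [norm_div, mul_pow, norm_mul, Complex.norm_natCast, norm_pow, norm_pow, norm_pow, mul_comm,
      ← pow_mul]
    have h2 : ‖t‖ ^ (p.1 * (p.2 : ℕ)) ≤ ‖t‖ ^ p.1 :=
      pow_le_pow_of_le_one (norm_nonneg t) ht.le (Nat.le_mul_of_pos_right _ p.2.pos)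
    have h3 : (1 : ℝ) ≤ (p.2 : ℕ) := by exact_mod_cast p.2.pos
    exact (div_le_self (by positivity) h3).trans (by gcongr)
  obtain ⟨L, hL⟩ := hsum
  refine ⟨L, ?_, ?_⟩
  · have h2 := (Equiv.prodComm ℕ+ ℕ).hasSum_iff.mpr hL
    refine h2.prod_fiberwise fun n => ?_
    have h3 : ‖t ^ (n : ℕ)‖ < 1 := by
      rw [norm_pow]; exact pow_lt_one₀ (norm_nonneg t) ht n.ne_zero
    refine hasSum_of_eq ((hasSum_geometric_of_norm_lt_one h3).mul_left
      (x ^ (n : ℕ) / ((n : ℕ) : ℂ))) (fun m => ?_) ?_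
    · simp only [Function.comp, Equiv.prodComm_apply, Prod.swap]
      rw [mul_pow, ← pow_mul, ← pow_mul, mul_comm m]
      ring
    · have := one_sub_ne_zero h3
      have hn : ((n : ℕ) : ℂ) ≠ 0 := Nat.cast_ne_zero.mpr n.ne_zero
      field_simp
  · have h2 : HasSum (fun m : ℕ => -Complex.log (1 - x * t ^ m)) L := by
      refine HasSum.prod_fiberwise hL fun m => ?_
      have h3 := hasSum_neg_log (hxt m)
      exact h3
    have h3 : HasSum (fun m : ℕ => Complex.log (1 - x * t ^ m)) (-L) := by
      simpa only [neg_neg] using h2.neg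
    exact (Complex.hasProd_of_hasSum_log (fun m => one_sub_ne_zero (hxt m)) h3).tprod_eq.symm

/-! ### Contractions -/

/-- The power series `∑ T_n x ^ n / n` converges near `0` and is a logarithm of `N / D`. -/
def LogSeries (T : ℕ+ → ℂ) (N D : ℂ → ℂ) : Prop :=
  ∀ᶠ x in 𝓝 (0 : ℂ), ∃ L, HasSum (fun n : ℕ+ => T n / (n : ℕ) * x ^ (n : ℕ)) L ∧
    Complex.exp L * D x = N x

lemma LogSeries.add {T T' : ℕ+ → ℂ} {N D N' D' : ℂ → ℂ} (h : LogSeries T N D)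
    (h' : LogSeries T' N' D') :
    LogSeries (fun n => T n + T' n) (fun x => N x * N' x) (fun x => D x * D' x) := by
  filter_upwards [h, h'] with x ⟨L, hL, hE⟩ ⟨L', hL', hE'⟩
  refine ⟨L + L', hasSum_of_eq (hL.add hL') (fun n => by ring) rfl, ?_⟩
  rw [Complex.exp_add, ← hE, ← hE']
  ring

lemma LogSeries.zero : LogSeries 0 (fun _ => 1) (fun _ => 1) := by
  refine Eventually.of_forall fun x => ⟨0, ?_, by simp⟩
  simp [hasSum_zero]

lemma eventually_norm_mul_lt (a : ℂ) : ∀ᶠ x in 𝓝 (0 : ℂ), ‖a * x‖ < 1 := by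
  have : Tendsto (fun x : ℂ => ‖a * x‖) (𝓝 0) (𝓝 ‖a * 0‖) :=
    (continuous_const.mul continuous_id).norm.tendsto 0
  rw [mul_zero, norm_zero] at this
  exact this.eventually_lt_const one_pos

lemma logSeries_qPoch (h a b : ℂ) {t : ℂ} (ht : ‖t‖ < 1) :
    LogSeries (fun n => (qp h ((n : ℕ) * a) - qp h ((n : ℕ) * b)) / (1 - t ^ (n : ℕ)))
      (fun x => qPoch (qp h b * x) t) (fun x => qPoch (qp h a * x) t) := by
  filter_upwards [eventually_norm_mul_lt (qp h a), eventually_norm_mul_lt (qp h b)] with x ha hb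
  obtain ⟨L, hL, hE⟩ := exists_hasSum_log_qPoch ht ha
  obtain ⟨L', hL', hE'⟩ := exists_hasSum_log_qPoch ht hb
  refine ⟨L - L', hasSum_of_eq (hL.sub hL') (fun n => ?_) rfl, ?_⟩
  · rw [qp_nat_mul, qp_nat_mul, mul_pow, mul_pow]
    have h3 : ‖t ^ (n : ℕ)‖ < 1 := by
      rw [norm_pow]; exact pow_lt_one₀ (norm_nonneg t) ht n.ne_zero
    have := one_sub_ne_zero h3
    have hn : ((n : ℕ) : ℂ) ≠ 0 := Nat.cast_ne_zero.mpr n.ne_zero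
    field_simp
  · rw [← hE, ← hE', ← Complex.exp_add]
    congr 1
    ring

lemma logSeries_linear (h a b : ℂ) :
    LogSeries (fun n => qp h ((n : ℕ) * a) - qp h ((n : ℕ) * b))
      (fun x => 1 - qp h b * x) (fun x => 1 - qp h a * x) := by
  filter_upwards [eventually_norm_mul_lt (qp h a), eventually_norm_mul_lt (qp h b)] with x ha hb
  refine ⟨_, hasSum_of_eq ((hasSum_neg_log ha).sub (hasSum_neg_log hb)) (fun n => ?_) rfl, ?_⟩
  · rw [qp_nat_mul, qp_nat_mul, mul_pow, mul_pow]
    ring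
  · rw [show -Complex.log (1 - qp h a * x) - -Complex.log (1 - qp h b * x) =
      Complex.log (1 - qp h b * x) - Complex.log (1 - qp h a * x) by ring, Complex.exp_sub,
      Complex.exp_log (one_sub_ne_zero ha), Complex.exp_log (one_sub_ne_zero hb),
      div_mul_cancel₀ _ (one_sub_ne_zero ha)]

/-- A sequence of at most geometric growth. -/
def GeomBdd (f : ℕ+ → ℂ) : Prop :=
  ∃ C ρ : ℝ, 0 ≤ C ∧ 0 ≤ ρ ∧ ∀ n : ℕ+, ‖f n‖ ≤ C * ρ ^ (n : ℕ)

lemma GeomBdd.mul {f g : ℕ+ → ℂ} (hf : GeomBdd f) (hg : GeomBdd g) :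
    GeomBdd fun n => f n * g n := by
  obtain ⟨C, ρ, hC, hρ, hf⟩ := hf
  obtain ⟨C', ρ', hC', hρ', hg⟩ := hg
  refine ⟨C * C', ρ * ρ', by positivity, by positivity, fun n => ?_⟩
  rw [norm_mul, mul_pow]
  calc ‖f n‖ * ‖g n‖ ≤ (C * ρ ^ (n : ℕ)) * (C' * ρ' ^ (n : ℕ)) := by
        gcongr
        exacts [hf n, hg n]
    _ = _ := by ring

lemma GeomBdd.add {f g : ℕ+ → ℂ} (hf : GeomBdd f) (hg : GeomBdd g) :
    GeomBdd fun n => f n + g n := by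
  obtain ⟨C, ρ, hC, hρ, hf⟩ := hf
  obtain ⟨C', ρ', hC', hρ', hg⟩ := hg
  refine ⟨C + C', max ρ ρ', by positivity, le_max_of_le_left hρ, fun n => ?_⟩
  rw [add_mul]
  refine (norm_add_le _ _).trans (add_le_add ((hf n).trans ?_) ((hg n).trans ?_))
  · gcongr; exact le_max_left _ _
  · gcongr; exact le_max_right _ _

lemma GeomBdd.neg {f : ℕ+ → ℂ} (hf : GeomBdd f) : GeomBdd fun n => -f n := by
  simpa only [GeomBdd, norm_neg] using hf

lemma GeomBdd.sub {f g : ℕ+ → ℂ} (hf : GeomBdd f) (hg : GeomBdd g) :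
    GeomBdd fun n => f n - g n := by
  simpa only [sub_eq_add_neg] using hf.add hg.neg

lemma geomBdd_const (c : ℂ) : GeomBdd fun _ => c :=
  ⟨‖c‖, 1, norm_nonneg c, zero_le_one, fun n => by simp⟩

lemma geomBdd_qp (h a : ℂ) : GeomBdd fun n => qp h ((n : ℕ) * a) :=
  ⟨1, ‖qp h a‖, zero_le_one, norm_nonneg _, fun n => by
    beta_reduce
    rw [qp_nat_mul, norm_pow, one_mul]⟩

lemma geomBdd_qp_neg (h a : ℂ) : GeomBdd fun n => qp h (-((n : ℕ) * a)) := by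
  simpa only [mul_neg] using geomBdd_qp h (-a)

lemma geomBdd_qp_coe (h : ℂ) : GeomBdd fun n => qp h ((n : ℕ) : ℂ) := by
  simpa only [mul_one] using geomBdd_qp h 1

lemma geomBdd_qp_neg_coe (h : ℂ) : GeomBdd fun n => qp h (-((n : ℕ) : ℂ)) := by
  simpa only [mul_neg, mul_one] using geomBdd_qp h (-1)

lemma geomBdd_qnum (h a : ℂ) : GeomBdd fun n => qnum h (a * (n : ℕ)) := by
  simp only [qnum, div_eq_mul_inv, mul_comm a]
  exact ((geomBdd_qp h a).sub (geomBdd_qp_neg h a)).mul (geomBdd_const _)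

lemma geomBdd_inv_natCast : GeomBdd fun n => (((n : ℕ) : ℂ))⁻¹ :=
  ⟨1, 1, zero_le_one, zero_le_one, fun n => by
    rw [norm_inv, Complex.norm_natCast, one_pow, one_mul]
    exact inv_le_one_of_one_le₀ (by exact_mod_cast n.pos)⟩

lemma GeomBdd.div_qnum {f : ℕ+ → ℂ} (hf : GeomBdd f) {h : ℂ} (hq : h.re < 0) {a : ℂ} {x : ℝ}
    (hax : a = x) (hx : 0 < x) : GeomBdd fun n => f n / qnum h (a * (n : ℕ)) := by
  simp only [div_eq_mul_inv]
  refine hf.mul ⟨‖qp h 1 - qp h (-1)‖ *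
    (1 - ‖qp h a‖ ^ 2)⁻¹, 1, ?_, zero_le_one, fun n => ?_⟩
  · have := norm_qp_ofReal_lt_one hq hx
    rw [← hax] at this
    have h2 : 0 < 1 - ‖qp h a‖ ^ 2 := by nlinarith [norm_nonneg (qp h a)]
    positivity
  · have hlt := norm_qp_ofReal_lt_one hq hx
    rw [← hax] at hlt
    beta_reduce
    rw [qnum, inv_div, norm_div, one_pow, mul_one, div_eq_mul_inv,
      qp_neg h (a * _), mul_comm a, qp_nat_mul]
    gcongr
    · nlinarith [norm_nonneg (qp h a)]
    set y := qp h a with hy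
    have hy0 : y ≠ 0 := qp_ne_zero h a
    have h1 : ‖y ^ (n : ℕ)‖ ≤ ‖y‖ := by
      rw [norm_pow]
      exact pow_le_of_le_one (norm_nonneg _) hlt.le n.ne_zero
    have h2 : (1 : ℝ) - ‖y ^ (n : ℕ)‖ ^ 2 ≤ ‖y ^ (n : ℕ) - (y ^ (n : ℕ))⁻¹‖ * ‖y ^ (n : ℕ)‖ := by
      rw [← norm_mul, sub_mul, inv_mul_cancel₀ (pow_ne_zero _ hy0), norm_sub_rev]
      have := norm_sub_norm_le (1 : ℂ) (y ^ (n : ℕ) * y ^ (n : ℕ))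
      rw [norm_one, norm_mul] at this
      linarith
    have h3 : 0 ≤ ‖y ^ (n : ℕ) - (y ^ (n : ℕ))⁻¹‖ := norm_nonneg _
    nlinarith [norm_nonneg (y ^ (n : ℕ)), norm_nonneg y]

instance : Fintype Boson := ⟨{.a, .b, .c}, fun B => by cases B <;> simp⟩

lemma sum_boson (f : Boson → ℂ) : ∑ B, f B = f .a + f .b + f .c := by
  simp only [Finset.univ, Fintype.elems]
  rw [Finset.sum_insert (by simp), Finset.sum_insert (by simp), Finset.sum_singleton, add_assoc]

/-- The contraction of annihilation coefficients `f` with creation coefficients `g`, as a power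
series in the ratio of the arguments, is a logarithm of `N / D` near `0`. -/
def Contraction (f g : Mode → ℂ) (N D : ℂ → ℂ) : Prop :=
  ∀ᶠ x in 𝓝 (0 : ℂ), ∃ L, HasSum (fun i : Mode => f i * g i * x ^ (i.2 : ℕ)) L ∧
    Complex.exp L * D x = N x

/-- A contraction is summed over the three bosons first; convergence over all modes only needs
geometric growth of the coefficients. -/
lemma contraction_of_logSeries {f g : Mode → ℂ} (hf : ∀ B, GeomBdd fun n => f (B, n))
    (hg : ∀ B, GeomBdd fun n => g (B, n)) {T : ℕ+ → ℂ} {N D : ℂ → ℂ} (h : LogSeries T N D)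
    (hT : ∀ n : ℕ+, ((n : ℕ) : ℂ) * (f (.a, n) * g (.a, n) + f (.b, n) * g (.b, n) +
      f (.c, n) * g (.c, n)) = T n) :
    Contraction f g N D := by
  have hB : ∀ B, ∀ᶠ x in 𝓝 (0 : ℂ), Summable fun n : ℕ+ => f (B, n) * g (B, n) * x ^ (n : ℕ) := by
    intro B
    obtain ⟨C, ρ, hC, hρ, hfg⟩ := (hf B).mul (hg B)
    filter_upwards [eventually_norm_mul_lt (ρ : ℂ)] with x hx
    have h1 : Summable fun n : ℕ+ => C * ‖(ρ : ℂ) * x‖ ^ (n : ℕ) :=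
      ((summable_geometric_of_lt_one (norm_nonneg _) hx).comp_injective
        PNat.coe_injective).mul_left C
    refine Summable.of_norm_bounded h1 fun n => ?_
    rw [norm_mul, norm_pow, norm_mul _ x, mul_pow, Complex.norm_real, Real.norm_of_nonneg hρ,
      ← mul_assoc]
    exact mul_le_mul_of_nonneg_right (hfg n) (by positivity)
  filter_upwards [h, hB .a, hB .b, hB .c] with x ⟨L, hL, hE⟩ ha hb hc
  have hS : Summable fun i : Mode => f i * g i * x ^ (i.2 : ℕ) := by
    refine (summable_prod_of_nonneg (f := fun i : Mode => ‖f i * g i * x ^ (i.2 : ℕ)‖)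
      (fun _ => norm_nonneg _)).mpr ⟨fun B => ?_, Summable.of_finite⟩ |>.of_norm
    cases B
    exacts [ha.norm, hb.norm, hc.norm]
  obtain ⟨S, hS⟩ := hS
  have h2 : HasSum (fun n : ℕ+ => T n / (n : ℕ) * x ^ (n : ℕ)) S := by
    refine ((Equiv.prodComm ℕ+ Boson).hasSum_iff.mpr hS).prod_fiberwise fun n => ?_
    refine hasSum_of_eq (hasSum_fintype _) (fun B => rfl) ?_
    rw [sum_boson, ← hT]
    have hn : ((n : ℕ) : ℂ) ≠ 0 := Nat.cast_ne_zero.mpr n.ne_zero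
    simp only [Function.comp, Equiv.prodComm_apply, Prod.swap]
    field_simp
  exact ⟨S, hS, by rw [h2.unique hL, hE]⟩

/-- The product `(q ^ (τ + a) x; q ^ τ)_∞`, that is `(q ^ a x; q ^ τ)_∞` without its first
factor. -/
def tailPoch (h τ a x : ℂ) : ℂ := qPoch (qp h (τ + a) * x) (qp h τ)

lemma qPoch_split {h τ : ℂ} (hτ : ‖qp h τ‖ < 1) (a x : ℂ) :
    qPoch (qp h a * x) (qp h τ) = (1 - qp h a * x) * tailPoch h τ a x := by
  rw [qPoch_eq_mul hτ, tailPoch, qp_add, show qp h a * x * qp h τ = qp h τ * qp h a * x by ring]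

lemma bigTheta_split {h τ : ℂ} (hτ : ‖qp h τ‖ < 1) (a y : ℂ) :
    bigTheta (qp h τ) (qp h a * y) =
      (1 - qp h a * y) * tailPoch h τ a y * tailPoch h τ (-a) y⁻¹ * qPoch (qp h τ) (qp h τ) := by
  rw [bigTheta, qPoch_split hτ, tailPoch, tailPoch, mul_inv, ← qp_neg, ← mul_assoc, ← qp_add]

lemma logSeries_tailPoch {h τ : ℂ} (a b : ℂ) (hτ : ‖qp h τ‖ < 1) :
    LogSeries (fun n => (qp h ((n : ℕ) * (τ + a)) - qp h ((n : ℕ) * (τ + b))) /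
        (1 - qp h τ ^ (n : ℕ)))
      (fun x => tailPoch h τ b x) (fun x => tailPoch h τ a x) :=
  logSeries_qPoch h (τ + a) (τ + b) hτ

/-! ### Contractions of the currents

In the names, `Ep` and `Em` are the summands of `E` with `ε = 1` and `ε = -1`, and `Fp` and `Fm`
those of `F` with `a_+` and `a_-`. Multiplied by `n`, the `n`-th coefficient of each contraction is
a rational function of `q ^ n`, `q ^ (n k / 2)` and `q ^ (n r)`; each evaluation is an identity of
such functions. -/

section

variable {h : ℂ} {r k : ℝ}

lemma GeomBdd.div_qnum_one {f : ℕ+ → ℂ} (hf : GeomBdd f) (hq : h.re < 0) :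
    GeomBdd fun n => f n / qnum h (n : ℕ) := by
  simpa only [one_mul] using hf.div_qnum hq (a := 1) (x := 1) (by simp) one_pos

lemma geomBdd_kappa (h : ℂ) (k : ℝ) (B : Boson) : GeomBdd fun n => kappa h k (B, n) := by
  have h1 : GeomBdd fun n => qnum h (n : ℕ) := by
    simpa only [one_mul] using geomBdd_qnum h 1
  have h2 : GeomBdd fun n => qnum h (n : ℕ) ^ 2 / ((n : ℕ) : ℂ) := by
    simp only [sq, div_eq_mul_inv]
    exact (h1.mul h1).mul geomBdd_inv_natCast
  cases B
  · simp only [kappa, div_eq_mul_inv]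
    exact ((geomBdd_qnum h _).mul (geomBdd_qnum h _)).mul geomBdd_inv_natCast
  · exact h2.neg
  · exact h2

lemma geomBdd_withKappa {f : Mode → ℂ} (hf : ∀ B, GeomBdd fun n => f (B, n)) (B : Boson) :
    GeomBdd fun n => withKappa h k f (B, n) :=
  (hf B).mul (geomBdd_kappa h k B)

lemma geomBdd_byBoson {fa fb fc : ℕ+ → ℂ} (ha : GeomBdd fa) (hb : GeomBdd fb) (hc : GeomBdd fc)
    (B : Boson) : GeomBdd fun n => byBoson fa fb fc (B, n) := by
  cases B
  exacts [ha, hb, hc]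

lemma geomBdd_zero : GeomBdd 0 := geomBdd_const 0

lemma geomBdd_crHp (hq : h.re < 0) (hrs : 0 < r - k) (B : Boson) :
    GeomBdd fun n => crHp h r k (B, n) :=
  geomBdd_byBoson ((geomBdd_qp h _).div_qnum hq (Complex.ofReal_sub r k).symm hrs)
    (((geomBdd_qp h _).mul ((geomBdd_qp_coe h).add (geomBdd_qp_neg_coe h))).div_qnum hq
      (Complex.ofReal_sub r k).symm hrs)
    geomBdd_zero B

lemma geomBdd_anHp (hq : h.re < 0) (hr : 0 < r) (B : Boson) :
    GeomBdd fun n => anHp h r k (B, n) :=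
  geomBdd_byBoson (((geomBdd_qp_neg h _).div_qnum hq rfl hr).neg)
    (((geomBdd_qp_neg h _).mul
      ((geomBdd_qp_coe h).add (geomBdd_qp_neg_coe h))).div_qnum hq rfl hr).neg
    geomBdd_zero B

lemma geomBdd_crHm (hq : h.re < 0) (hrs : 0 < r - k) (B : Boson) :
    GeomBdd fun n => crHm h r k (B, n) :=
  geomBdd_byBoson ((geomBdd_qp_neg h _).div_qnum hq (Complex.ofReal_sub r k).symm hrs)
    (((geomBdd_qp_neg h _).mul ((geomBdd_qp_coe h).add (geomBdd_qp_neg_coe h))).div_qnum hq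
      (Complex.ofReal_sub r k).symm hrs)
    geomBdd_zero B

lemma geomBdd_anHm (hq : h.re < 0) (hr : 0 < r) (B : Boson) :
    GeomBdd fun n => anHm h r k (B, n) :=
  geomBdd_byBoson (((geomBdd_qp h _).div_qnum hq rfl hr).neg)
    (((geomBdd_qp h _).mul
      ((geomBdd_qp_coe h).add (geomBdd_qp_neg_coe h))).div_qnum hq rfl hr).neg
    geomBdd_zero B

lemma geomBdd_crE (hq : h.re < 0) (hrs : 0 < r - k) (ε : ℂ) (B : Boson) :
    GeomBdd fun n => crE h r k ε (B, n) :=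
  geomBdd_byBoson ((geomBdd_qp h _).div_qnum hq (Complex.ofReal_sub r k).symm hrs)
    (((geomBdd_qp_coe h).div_qnum_one hq).neg.add
      (((geomBdd_qp h _).mul ((geomBdd_qp_coe h).add (geomBdd_qp_neg_coe h))).div_qnum hq
      (Complex.ofReal_sub r k).symm hrs))
    (((geomBdd_qp h _).div_qnum_one hq).neg) B

lemma geomBdd_anE (hq : h.re < 0) (ε : ℂ) (B : Boson) :
    GeomBdd fun n => anE h ε (B, n) :=
  geomBdd_byBoson geomBdd_zero
    ((geomBdd_qp_coe h).div_qnum_one hq)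
    ((geomBdd_qp_neg h _).div_qnum_one hq) B

lemma geomBdd_crFp (hq : h.re < 0) (B : Boson) :
    GeomBdd fun n => crFp h k (B, n) :=
  geomBdd_byBoson geomBdd_zero
    ((geomBdd_qp h _).div_qnum_one hq)
    ((geomBdd_qp h _).div_qnum_one hq) B

lemma geomBdd_anFp (hq : h.re < 0) (hr : 0 < r) (B : Boson) :
    GeomBdd fun n => anFp h r k (B, n) :=
  geomBdd_byBoson (((geomBdd_qp_neg h _).div_qnum hq rfl hr).neg)
    (((geomBdd_qp_neg h _).div_qnum_one hq).neg.sub (((geomBdd_qp h _).mul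
      ((geomBdd_qp_coe h).add (geomBdd_qp_neg_coe h))).div_qnum hq rfl hr))
    (((geomBdd_qp_neg h _).div_qnum_one hq).neg) B

lemma geomBdd_crFm (hq : h.re < 0) (B : Boson) :
    GeomBdd fun n => crFm h k (B, n) :=
  geomBdd_byBoson (((geomBdd_const _).mul (geomBdd_qp_neg h _)).neg)
    ((geomBdd_qp_neg h _).div_qnum_one hq)
    ((geomBdd_qp_neg h _).div_qnum_one hq) B

lemma geomBdd_anFm (hq : h.re < 0) (hr : 0 < r) (B : Boson) :
    GeomBdd fun n => anFm h r k (B, n) :=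
  geomBdd_byBoson (((geomBdd_qp h _).div_qnum hq rfl hr).neg)
    (((geomBdd_qp h _).div_qnum_one hq).neg.sub (((geomBdd_qp h _).mul
      ((geomBdd_qp_coe h).add (geomBdd_qp_neg_coe h))).div_qnum hq rfl hr))
    (((geomBdd_qp h _).div_qnum_one hq).neg) B

lemma norm_qp_two_mul_lt_one (hq : h.re < 0) (hr : 0 < r) : ‖qp h (2 * r)‖ < 1 := by
  have := norm_qp_ofReal_lt_one hq (x := 2 * r) (by positivity)
  push_cast at this
  exact this

lemma norm_qp_two_mul_sub_lt_one (hq : h.re < 0) (hrs : 0 < r - k) :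
    ‖qp h (2 * (r - k))‖ < 1 := by
  have := norm_qp_two_mul_lt_one hq hrs
  push_cast at this
  exact this

lemma contraction_Hp_Hp (hq : h.re < 0) (hr : 0 < r) (hrs : 0 < r - k) :
    Contraction (withKappa h k (anHp h r k)) (crHp h r k)
      (fun x => tailPoch h (2 * (r - k)) (-2) x * tailPoch h (2 * r) 2 x)
      (fun x => tailPoch h (2 * (r - k)) 2 x * tailPoch h (2 * r) (-2) x) := by
  refine contraction_of_logSeries (geomBdd_withKappa (geomBdd_anHp hq hr))
    (geomBdd_crHp hq hrs)
    ((logSeries_tailPoch 2 (-2) (norm_qp_two_mul_sub_lt_one hq hrs)).add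
      (logSeries_tailPoch (-2) 2 (norm_qp_two_mul_lt_one hq hr))) fun n => ?_
  have hn : ((n : ℕ) : ℂ) ≠ 0 := Nat.cast_ne_zero.mpr n.ne_zero
  obtain ⟨q, Q, W, R, Z, e, _, _, _, _, _, _, _, _, _, _, _, _, _, hE⟩ :=
    exists_monomials hq hr hrs n 0 0
  simp only [withKappa, anHp, crHp, byBoson, kappa, qnum, Pi.zero_apply, qp_pow]
  simp only [mul_add, mul_sub, add_mul, sub_mul, mul_neg, neg_mul, neg_add, neg_sub, neg_neg,
    qp_add, qp_sub, qp_neg, mul_one, one_mul, mul_zero, zero_mul, add_zero, zero_add, qp_zero,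
    mul_left_comm _ (2 : ℂ), hE]
  field_simp
  try ring

lemma contraction_Hm_Hm (hq : h.re < 0) (hr : 0 < r) (hrs : 0 < r - k) :
    Contraction (withKappa h k (anHm h r k)) (crHm h r k)
      (fun x => tailPoch h (2 * (r - k)) (-2) x * tailPoch h (2 * r) 2 x)
      (fun x => tailPoch h (2 * (r - k)) 2 x * tailPoch h (2 * r) (-2) x) := by
  refine contraction_of_logSeries (geomBdd_withKappa (geomBdd_anHm hq hr))
    (geomBdd_crHm hq hrs)
    ((logSeries_tailPoch 2 (-2) (norm_qp_two_mul_sub_lt_one hq hrs)).add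
      (logSeries_tailPoch (-2) 2 (norm_qp_two_mul_lt_one hq hr))) fun n => ?_
  have hn : ((n : ℕ) : ℂ) ≠ 0 := Nat.cast_ne_zero.mpr n.ne_zero
  obtain ⟨q, Q, W, R, Z, e, _, _, _, _, _, _, _, _, _, _, _, _, _, hE⟩ :=
    exists_monomials hq hr hrs n 0 0
  simp only [withKappa, anHm, crHm, byBoson, kappa, qnum, Pi.zero_apply, qp_pow]
  simp only [mul_add, mul_sub, add_mul, sub_mul, mul_neg, neg_mul, neg_add, neg_sub, neg_neg,
    qp_add, qp_sub, qp_neg, mul_one, one_mul, mul_zero, zero_mul, add_zero, zero_add, qp_zero,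
    mul_left_comm _ (2 : ℂ), hE]
  field_simp
  try ring

lemma contraction_Hp_Hm (hq : h.re < 0) (hr : 0 < r) (hrs : 0 < r - k) :
    Contraction (withKappa h k (anHp h r k)) (crHm h r k)
      (fun x => qPoch (qp h (-(2 + k)) * x) (qp h (2 * (r - k))) *
        qPoch (qp h (-(-2 - k)) * x) (qp h (2 * r)))
      (fun x => qPoch (qp h (-(-2 + k)) * x) (qp h (2 * (r - k))) *
        qPoch (qp h (-(2 - k)) * x) (qp h (2 * r))) := by
  refine contraction_of_logSeries (geomBdd_withKappa (geomBdd_anHp hq hr))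
    (geomBdd_crHm hq hrs)
    ((logSeries_qPoch h (-(-2 + k)) (-(2 + k)) (norm_qp_two_mul_sub_lt_one hq hrs)).add
      (logSeries_qPoch h (-(2 - k)) (-(-2 - k)) (norm_qp_two_mul_lt_one hq hr))) fun n => ?_
  have hn : ((n : ℕ) : ℂ) ≠ 0 := Nat.cast_ne_zero.mpr n.ne_zero
  obtain ⟨q, Q, W, R, Z, e, _, _, _, _, _, _, _, _, _, _, _, _, _, hE⟩ :=
    exists_monomials hq hr hrs n 0 0
  simp only [withKappa, anHp, crHm, byBoson, kappa, qnum, Pi.zero_apply, qp_pow]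
  simp only [mul_add, mul_sub, add_mul, sub_mul, mul_neg, neg_mul, neg_add, neg_sub, neg_neg,
    qp_add, qp_sub, qp_neg, mul_one, one_mul, mul_zero, zero_mul, add_zero, zero_add, qp_zero,
    mul_left_comm _ (2 : ℂ), hE]
  field_simp
  try ring

lemma contraction_Hm_Hp (hq : h.re < 0) (hr : 0 < r) (hrs : 0 < r - k) :
    Contraction (withKappa h k (anHm h r k)) (crHp h r k)
      (fun x => tailPoch h (2 * (r - k)) (-2 + k) x * tailPoch h (2 * r) (2 - k) x)
      (fun x => tailPoch h (2 * (r - k)) (2 + k) x * tailPoch h (2 * r) (-2 - k) x) := by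
  refine contraction_of_logSeries (geomBdd_withKappa (geomBdd_anHm hq hr))
    (geomBdd_crHp hq hrs)
    ((logSeries_tailPoch (2 + k) (-2 + k) (norm_qp_two_mul_sub_lt_one hq hrs)).add
      (logSeries_tailPoch (-2 - k) (2 - k) (norm_qp_two_mul_lt_one hq hr))) fun n => ?_
  have hn : ((n : ℕ) : ℂ) ≠ 0 := Nat.cast_ne_zero.mpr n.ne_zero
  obtain ⟨q, Q, W, R, Z, e, _, _, _, _, _, _, _, _, _, _, _, _, _, hE⟩ :=
    exists_monomials hq hr hrs n 0 0
  simp only [withKappa, anHm, crHp, byBoson, kappa, qnum, Pi.zero_apply, qp_pow]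
  simp only [mul_add, mul_sub, add_mul, sub_mul, mul_neg, neg_mul, neg_add, neg_sub, neg_neg,
    qp_add, qp_sub, qp_neg, mul_one, one_mul, mul_zero, zero_mul, add_zero, zero_add, qp_zero,
    mul_left_comm _ (2 : ℂ), hE]
  field_simp
  try ring

lemma contraction_Hp_E (hq : h.re < 0) (hr : 0 < r) (hrs : 0 < r - k) (ε : ℂ) :
    Contraction (withKappa h k (anHp h r k)) (crE h r k ε)
      (fun x => qPoch (qp h (-(2 + k / 2)) * x) (qp h (2 * (r - k))))
      (fun x => qPoch (qp h (-(-2 + k / 2)) * x) (qp h (2 * (r - k)))) := by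
  refine contraction_of_logSeries (geomBdd_withKappa (geomBdd_anHp hq hr))
    (geomBdd_crE hq hrs ε)
    (logSeries_qPoch h (-(-2 + k / 2)) (-(2 + k / 2))
      (norm_qp_two_mul_sub_lt_one hq hrs)) fun n => ?_
  have hn : ((n : ℕ) : ℂ) ≠ 0 := Nat.cast_ne_zero.mpr n.ne_zero
  obtain ⟨q, Q, W, R, Z, e, _, _, _, _, _, _, _, _, _, _, _, _, _, hE⟩ :=
    exists_monomials hq hr hrs n 0 ε
  simp only [withKappa, anHp, crE, byBoson, kappa, qnum, Pi.zero_apply, qp_pow]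
  simp only [mul_add, mul_sub, add_mul, sub_mul, mul_neg, neg_mul, neg_add, neg_sub, neg_neg,
    qp_add, qp_sub, qp_neg, mul_one, one_mul, mul_zero, zero_mul, add_zero, zero_add, qp_zero,
    mul_left_comm _ (2 : ℂ), hE]
  field_simp
  try ring

lemma contraction_E_Hp (hq : h.re < 0) (hr : 0 < r) (hrs : 0 < r - k) (ε : ℂ) :
    Contraction (withKappa h k (anE h ε)) (crHp h r k)
      (fun x => tailPoch h (2 * (r - k)) (-2 + k / 2) x)
      (fun x => tailPoch h (2 * (r - k)) (2 + k / 2) x) := by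
  refine contraction_of_logSeries (geomBdd_withKappa (geomBdd_anE hq ε))
    (geomBdd_crHp hq hrs)
    (logSeries_tailPoch (2 + k / 2) (-2 + k / 2) (norm_qp_two_mul_sub_lt_one hq hrs)) fun n => ?_
  have hn : ((n : ℕ) : ℂ) ≠ 0 := Nat.cast_ne_zero.mpr n.ne_zero
  obtain ⟨q, Q, W, R, Z, e, _, _, _, _, _, _, _, _, _, _, _, _, _, hE⟩ :=
    exists_monomials hq hr hrs n 0 ε
  simp only [withKappa, anE, crHp, byBoson, kappa, qnum, Pi.zero_apply, qp_pow]
  simp only [mul_add, mul_sub, add_mul, sub_mul, mul_neg, neg_mul, neg_add, neg_sub, neg_neg,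
    qp_add, qp_sub, qp_neg, mul_one, one_mul, mul_zero, zero_mul, add_zero, zero_add, qp_zero,
    mul_left_comm _ (2 : ℂ), hE]
  field_simp
  try ring

lemma contraction_Hm_E (hq : h.re < 0) (hr : 0 < r) (hrs : 0 < r - k) (ε : ℂ) :
    Contraction (withKappa h k (anHm h r k)) (crE h r k ε)
      (fun x => tailPoch h (2 * (r - k)) (-(2 - k / 2)) x)
      (fun x => tailPoch h (2 * (r - k)) (-(-2 - k / 2)) x) := by
  refine contraction_of_logSeries (geomBdd_withKappa (geomBdd_anHm hq hr))
    (geomBdd_crE hq hrs ε)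
    (logSeries_tailPoch (-(-2 - k / 2)) (-(2 - k / 2))
      (norm_qp_two_mul_sub_lt_one hq hrs)) fun n => ?_
  have hn : ((n : ℕ) : ℂ) ≠ 0 := Nat.cast_ne_zero.mpr n.ne_zero
  obtain ⟨q, Q, W, R, Z, e, _, _, _, _, _, _, _, _, _, _, _, _, _, hE⟩ :=
    exists_monomials hq hr hrs n 0 ε
  simp only [withKappa, anHm, crE, byBoson, kappa, qnum, Pi.zero_apply, qp_pow]
  simp only [mul_add, mul_sub, add_mul, sub_mul, mul_neg, neg_mul, neg_add, neg_sub, neg_neg,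
    qp_add, qp_sub, qp_neg, mul_one, one_mul, mul_zero, zero_mul, add_zero, zero_add, qp_zero,
    mul_left_comm _ (2 : ℂ), hE]
  field_simp
  try ring

lemma contraction_E_Hm (hq : h.re < 0) (hr : 0 < r) (hrs : 0 < r - k) (ε : ℂ) :
    Contraction (withKappa h k (anE h ε)) (crHm h r k)
      (fun x => qPoch (qp h (-2 - k / 2) * x) (qp h (2 * (r - k))))
      (fun x => qPoch (qp h (2 - k / 2) * x) (qp h (2 * (r - k)))) := by
  refine contraction_of_logSeries (geomBdd_withKappa (geomBdd_anE hq ε))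
    (geomBdd_crHm hq hrs)
    (logSeries_qPoch h (2 - k / 2) (-2 - k / 2) (norm_qp_two_mul_sub_lt_one hq hrs)) fun n => ?_
  have hn : ((n : ℕ) : ℂ) ≠ 0 := Nat.cast_ne_zero.mpr n.ne_zero
  obtain ⟨q, Q, W, R, Z, e, _, _, _, _, _, _, _, _, _, _, _, _, _, hE⟩ :=
    exists_monomials hq hr hrs n 0 ε
  simp only [withKappa, anE, crHm, byBoson, kappa, qnum, Pi.zero_apply, qp_pow]
  simp only [mul_add, mul_sub, add_mul, sub_mul, mul_neg, neg_mul, neg_add, neg_sub, neg_neg,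
    qp_add, qp_sub, qp_neg, mul_one, one_mul, mul_zero, zero_mul, add_zero, zero_add, qp_zero,
    mul_left_comm _ (2 : ℂ), hE]
  field_simp
  try ring

lemma contraction_Hp_Fp (hq : h.re < 0) (hr : 0 < r) (hrs : 0 < r - k) :
    Contraction (withKappa h k (anHp h r k)) (crFp h k)
      (fun x => qPoch (qp h (-(-2 - k / 2)) * x) (qp h (2 * r)))
      (fun x => qPoch (qp h (-(2 - k / 2)) * x) (qp h (2 * r))) := by
  refine contraction_of_logSeries (geomBdd_withKappa (geomBdd_anHp hq hr))
    (geomBdd_crFp hq)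
    (logSeries_qPoch h (-(2 - k / 2)) (-(-2 - k / 2)) (norm_qp_two_mul_lt_one hq hr)) fun n => ?_
  have hn : ((n : ℕ) : ℂ) ≠ 0 := Nat.cast_ne_zero.mpr n.ne_zero
  obtain ⟨q, Q, W, R, Z, e, _, _, _, _, _, _, _, _, _, _, _, _, _, hE⟩ :=
    exists_monomials hq hr hrs n 0 0
  simp only [withKappa, anHp, crFp, byBoson, kappa, qnum, Pi.zero_apply, qp_pow]
  simp only [mul_add, mul_sub, add_mul, sub_mul, mul_neg, neg_mul, neg_add, neg_sub, neg_neg,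
    qp_add, qp_sub, qp_neg, mul_one, one_mul, mul_zero, zero_mul, add_zero, zero_add, qp_zero,
    mul_left_comm _ (2 : ℂ), hE]
  field_simp
  try ring

lemma contraction_Fp_Hp (hq : h.re < 0) (hr : 0 < r) (hrs : 0 < r - k) :
    Contraction (withKappa h k (anFp h r k)) (crHp h r k)
      (fun x => tailPoch h (2 * r) (2 - k / 2) x)
      (fun x => tailPoch h (2 * r) (-2 - k / 2) x) := by
  refine contraction_of_logSeries (geomBdd_withKappa (geomBdd_anFp hq hr))
    (geomBdd_crHp hq hrs)
    (logSeries_tailPoch (-2 - k / 2) (2 - k / 2) (norm_qp_two_mul_lt_one hq hr)) fun n => ?_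
  have hn : ((n : ℕ) : ℂ) ≠ 0 := Nat.cast_ne_zero.mpr n.ne_zero
  obtain ⟨q, Q, W, R, Z, e, _, _, _, _, _, _, _, _, _, _, _, _, _, hE⟩ :=
    exists_monomials hq hr hrs n 0 0
  simp only [withKappa, anFp, crHp, byBoson, kappa, qnum, Pi.zero_apply, qp_pow]
  simp only [mul_add, mul_sub, add_mul, sub_mul, mul_neg, neg_mul, neg_add, neg_sub, neg_neg,
    qp_add, qp_sub, qp_neg, mul_one, one_mul, mul_zero, zero_mul, add_zero, zero_add, qp_zero,
    mul_left_comm _ (2 : ℂ), hE]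
  field_simp
  try ring

lemma contraction_Hm_Fp (hq : h.re < 0) (hr : 0 < r) (hrs : 0 < r - k) :
    Contraction (withKappa h k (anHm h r k)) (crFp h k)
      (fun x => tailPoch h (2 * r) (-(-2 + k / 2)) x)
      (fun x => tailPoch h (2 * r) (-(2 + k / 2)) x) := by
  refine contraction_of_logSeries (geomBdd_withKappa (geomBdd_anHm hq hr))
    (geomBdd_crFp hq)
    (logSeries_tailPoch (-(2 + k / 2)) (-(-2 + k / 2)) (norm_qp_two_mul_lt_one hq hr)) fun n => ?_
  have hn : ((n : ℕ) : ℂ) ≠ 0 := Nat.cast_ne_zero.mpr n.ne_zero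
  obtain ⟨q, Q, W, R, Z, e, _, _, _, _, _, _, _, _, _, _, _, _, _, hE⟩ :=
    exists_monomials hq hr hrs n 0 0
  simp only [withKappa, anHm, crFp, byBoson, kappa, qnum, Pi.zero_apply, qp_pow]
  simp only [mul_add, mul_sub, add_mul, sub_mul, mul_neg, neg_mul, neg_add, neg_sub, neg_neg,
    qp_add, qp_sub, qp_neg, mul_one, one_mul, mul_zero, zero_mul, add_zero, zero_add, qp_zero,
    mul_left_comm _ (2 : ℂ), hE]
  field_simp
  try ring

lemma contraction_Fp_Hm (hq : h.re < 0) (hr : 0 < r) (hrs : 0 < r - k) :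
    Contraction (withKappa h k (anFp h r k)) (crHm h r k)
      (fun x => qPoch (qp h (2 + k / 2) * x) (qp h (2 * r)))
      (fun x => qPoch (qp h (-2 + k / 2) * x) (qp h (2 * r))) := by
  refine contraction_of_logSeries (geomBdd_withKappa (geomBdd_anFp hq hr))
    (geomBdd_crHm hq hrs)
    (logSeries_qPoch h (-2 + k / 2) (2 + k / 2) (norm_qp_two_mul_lt_one hq hr)) fun n => ?_
  have hn : ((n : ℕ) : ℂ) ≠ 0 := Nat.cast_ne_zero.mpr n.ne_zero
  obtain ⟨q, Q, W, R, Z, e, _, _, _, _, _, _, _, _, _, _, _, _, _, hE⟩ :=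
    exists_monomials hq hr hrs n 0 0
  simp only [withKappa, anFp, crHm, byBoson, kappa, qnum, Pi.zero_apply, qp_pow]
  simp only [mul_add, mul_sub, add_mul, sub_mul, mul_neg, neg_mul, neg_add, neg_sub, neg_neg,
    qp_add, qp_sub, qp_neg, mul_one, one_mul, mul_zero, zero_mul, add_zero, zero_add, qp_zero,
    mul_left_comm _ (2 : ℂ), hE]
  field_simp
  try ring

lemma contraction_Hp_Fm (hq : h.re < 0) (hr : 0 < r) (hrs : 0 < r - k) :
    Contraction (withKappa h k (anHp h r k)) (crFm h k)
      (fun x => qPoch (qp h (-(-2 - k / 2)) * x) (qp h (2 * r)))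
      (fun x => qPoch (qp h (-(2 - k / 2)) * x) (qp h (2 * r))) := by
  refine contraction_of_logSeries (geomBdd_withKappa (geomBdd_anHp hq hr))
    (geomBdd_crFm hq)
    (logSeries_qPoch h (-(2 - k / 2)) (-(-2 - k / 2)) (norm_qp_two_mul_lt_one hq hr)) fun n => ?_
  have hn : ((n : ℕ) : ℂ) ≠ 0 := Nat.cast_ne_zero.mpr n.ne_zero
  obtain ⟨q, Q, W, R, Z, e, _, _, _, _, _, _, _, _, _, _, _, _, _, hE⟩ :=
    exists_monomials hq hr hrs n 0 0
  simp only [withKappa, anHp, crFm, byBoson, kappa, qnum, Pi.zero_apply, qp_pow]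
  simp only [mul_add, mul_sub, add_mul, sub_mul, mul_neg, neg_mul, neg_add, neg_sub, neg_neg,
    qp_add, qp_sub, qp_neg, mul_one, one_mul, mul_zero, zero_mul, add_zero, zero_add, qp_zero,
    mul_left_comm _ (2 : ℂ), hE]
  field_simp
  try ring

lemma contraction_Fm_Hp (hq : h.re < 0) (hr : 0 < r) (hrs : 0 < r - k) :
    Contraction (withKappa h k (anFm h r k)) (crHp h r k)
      (fun x => tailPoch h (2 * r) (2 - k / 2) x)
      (fun x => tailPoch h (2 * r) (-2 - k / 2) x) := by
  refine contraction_of_logSeries (geomBdd_withKappa (geomBdd_anFm hq hr))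
    (geomBdd_crHp hq hrs)
    (logSeries_tailPoch (-2 - k / 2) (2 - k / 2) (norm_qp_two_mul_lt_one hq hr)) fun n => ?_
  have hn : ((n : ℕ) : ℂ) ≠ 0 := Nat.cast_ne_zero.mpr n.ne_zero
  obtain ⟨q, Q, W, R, Z, e, _, _, _, _, _, _, _, _, _, _, _, _, _, hE⟩ :=
    exists_monomials hq hr hrs n 0 0
  simp only [withKappa, anFm, crHp, byBoson, kappa, qnum, Pi.zero_apply, qp_pow]
  simp only [mul_add, mul_sub, add_mul, sub_mul, mul_neg, neg_mul, neg_add, neg_sub, neg_neg,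
    qp_add, qp_sub, qp_neg, mul_one, one_mul, mul_zero, zero_mul, add_zero, zero_add, qp_zero,
    mul_left_comm _ (2 : ℂ), hE]
  field_simp
  try ring

lemma contraction_Hm_Fm (hq : h.re < 0) (hr : 0 < r) (hrs : 0 < r - k) :
    Contraction (withKappa h k (anHm h r k)) (crFm h k)
      (fun x => tailPoch h (2 * r) (-(-2 + k / 2)) x)
      (fun x => tailPoch h (2 * r) (-(2 + k / 2)) x) := by
  refine contraction_of_logSeries (geomBdd_withKappa (geomBdd_anHm hq hr))
    (geomBdd_crFm hq)
    (logSeries_tailPoch (-(2 + k / 2)) (-(-2 + k / 2)) (norm_qp_two_mul_lt_one hq hr)) fun n => ?_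
  have hn : ((n : ℕ) : ℂ) ≠ 0 := Nat.cast_ne_zero.mpr n.ne_zero
  obtain ⟨q, Q, W, R, Z, e, _, _, _, _, _, _, _, _, _, _, _, _, _, hE⟩ :=
    exists_monomials hq hr hrs n 0 0
  simp only [withKappa, anHm, crFm, byBoson, kappa, qnum, Pi.zero_apply, qp_pow]
  simp only [mul_add, mul_sub, add_mul, sub_mul, mul_neg, neg_mul, neg_add, neg_sub, neg_neg,
    qp_add, qp_sub, qp_neg, mul_one, one_mul, mul_zero, zero_mul, add_zero, zero_add, qp_zero,
    mul_left_comm _ (2 : ℂ), hE]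
  field_simp
  try ring

lemma contraction_Fm_Hm (hq : h.re < 0) (hr : 0 < r) (hrs : 0 < r - k) :
    Contraction (withKappa h k (anFm h r k)) (crHm h r k)
      (fun x => qPoch (qp h (2 + k / 2) * x) (qp h (2 * r)))
      (fun x => qPoch (qp h (-2 + k / 2) * x) (qp h (2 * r))) := by
  refine contraction_of_logSeries (geomBdd_withKappa (geomBdd_anFm hq hr))
    (geomBdd_crHm hq hrs)
    (logSeries_qPoch h (-2 + k / 2) (2 + k / 2) (norm_qp_two_mul_lt_one hq hr)) fun n => ?_
  have hn : ((n : ℕ) : ℂ) ≠ 0 := Nat.cast_ne_zero.mpr n.ne_zero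
  obtain ⟨q, Q, W, R, Z, e, _, _, _, _, _, _, _, _, _, _, _, _, _, hE⟩ :=
    exists_monomials hq hr hrs n 0 0
  simp only [withKappa, anFm, crHm, byBoson, kappa, qnum, Pi.zero_apply, qp_pow]
  simp only [mul_add, mul_sub, add_mul, sub_mul, mul_neg, neg_mul, neg_add, neg_sub, neg_neg,
    qp_add, qp_sub, qp_neg, mul_one, one_mul, mul_zero, zero_mul, add_zero, zero_add, qp_zero,
    mul_left_comm _ (2 : ℂ), hE]
  field_simp
  try ring

lemma contraction_E_E (hq : h.re < 0) (hr : 0 < r) (hrs : 0 < r - k) (ε ε' : ℂ) :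
    Contraction (withKappa h k (anE h ε)) (crE h r k ε')
      (fun x => tailPoch h (2 * (r - k)) (-2) x * (1 - qp h (ε' - ε) * x))
      (fun x => tailPoch h (2 * (r - k)) 2 x * (1 - qp h (2) * x)) := by
  refine contraction_of_logSeries (geomBdd_withKappa (geomBdd_anE hq ε))
    (geomBdd_crE hq hrs ε')
    ((logSeries_tailPoch 2 (-2) (norm_qp_two_mul_sub_lt_one hq hrs)).add
      (logSeries_linear h (2) (ε' - ε))) fun n => ?_
  have hn : ((n : ℕ) : ℂ) ≠ 0 := Nat.cast_ne_zero.mpr n.ne_zero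
  have hε := qp_ne_zero h (n * ε)
  have hε' := qp_ne_zero h (n * ε')
  obtain ⟨q, Q, W, R, Z, e, _, _, _, _, _, _, _, _, _, _, _, _, _, hE⟩ :=
    exists_monomials hq hr hrs n 0 0
  simp only [withKappa, anE, crE, byBoson, kappa, qnum, Pi.zero_apply, qp_pow]
  simp only [mul_add, mul_sub, add_mul, sub_mul, mul_neg, neg_mul, neg_add, neg_sub, neg_neg,
    qp_add, qp_sub, qp_neg, mul_one, one_mul, mul_zero, zero_mul, add_zero, zero_add, qp_zero,
    mul_left_comm _ (2 : ℂ), hE]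
  field_simp
  try ring

lemma contraction_Fp_Fp (hq : h.re < 0) (hr : 0 < r) (hrs : 0 < r - k) :
    Contraction (withKappa h k (anFp h r k)) (crFp h k)
      (fun x => tailPoch h (2 * r) 2 x * (1 - qp h (0) * x))
      (fun x => tailPoch h (2 * r) (-2) x * (1 - qp h (-2) * x)) := by
  refine contraction_of_logSeries (geomBdd_withKappa (geomBdd_anFp hq hr))
    (geomBdd_crFp hq)
    ((logSeries_tailPoch (-2) 2 (norm_qp_two_mul_lt_one hq hr)).add
      (logSeries_linear h (-2) (0))) fun n => ?_
  have hn : ((n : ℕ) : ℂ) ≠ 0 := Nat.cast_ne_zero.mpr n.ne_zero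
  obtain ⟨q, Q, W, R, Z, e, _, _, _, _, _, _, _, _, _, _, _, _, _, hE⟩ :=
    exists_monomials hq hr hrs n 0 0
  simp only [withKappa, anFp, crFp, byBoson, kappa, qnum, Pi.zero_apply, qp_pow]
  simp only [mul_add, mul_sub, add_mul, sub_mul, mul_neg, neg_mul, neg_add, neg_sub, neg_neg,
    qp_add, qp_sub, qp_neg, mul_one, one_mul, mul_zero, zero_mul, add_zero, zero_add, qp_zero,
    mul_left_comm _ (2 : ℂ), hE]
  field_simp
  try ring

lemma contraction_Fm_Fm (hq : h.re < 0) (hr : 0 < r) (hrs : 0 < r - k) :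
    Contraction (withKappa h k (anFm h r k)) (crFm h k)
      (fun x => tailPoch h (2 * r) 2 x * (1 - qp h (0) * x))
      (fun x => tailPoch h (2 * r) (-2) x * (1 - qp h (-2) * x)) := by
  refine contraction_of_logSeries (geomBdd_withKappa (geomBdd_anFm hq hr))
    (geomBdd_crFm hq)
    ((logSeries_tailPoch (-2) 2 (norm_qp_two_mul_lt_one hq hr)).add
      (logSeries_linear h (-2) (0))) fun n => ?_
  have hn : ((n : ℕ) : ℂ) ≠ 0 := Nat.cast_ne_zero.mpr n.ne_zero
  obtain ⟨q, Q, W, R, Z, e, _, _, _, _, _, _, _, _, _, _, _, _, _, hE⟩ :=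
    exists_monomials hq hr hrs n 0 0
  simp only [withKappa, anFm, crFm, byBoson, kappa, qnum, Pi.zero_apply, qp_pow]
  simp only [mul_add, mul_sub, add_mul, sub_mul, mul_neg, neg_mul, neg_add, neg_sub, neg_neg,
    qp_add, qp_sub, qp_neg, mul_one, one_mul, mul_zero, zero_mul, add_zero, zero_add, qp_zero,
    mul_left_comm _ (2 : ℂ), hE]
  field_simp
  try ring

lemma contraction_Fm_Fp (hq : h.re < 0) (hr : 0 < r) (hrs : 0 < r - k) :
    Contraction (withKappa h k (anFm h r k)) (crFp h k)
      (fun x => tailPoch h (2 * r) 2 x)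
      (fun x => tailPoch h (2 * r) (-2) x) := by
  refine contraction_of_logSeries (geomBdd_withKappa (geomBdd_anFm hq hr))
    (geomBdd_crFp hq)
    (logSeries_tailPoch (-2) 2 (norm_qp_two_mul_lt_one hq hr)) fun n => ?_
  have hn : ((n : ℕ) : ℂ) ≠ 0 := Nat.cast_ne_zero.mpr n.ne_zero
  obtain ⟨q, Q, W, R, Z, e, _, _, _, _, _, _, _, _, _, _, _, _, _, hE⟩ :=
    exists_monomials hq hr hrs n 0 0
  simp only [withKappa, anFm, crFp, byBoson, kappa, qnum, Pi.zero_apply, qp_pow]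
  simp only [mul_add, mul_sub, add_mul, sub_mul, mul_neg, neg_mul, neg_add, neg_sub, neg_neg,
    qp_add, qp_sub, qp_neg, mul_one, one_mul, mul_zero, zero_mul, add_zero, zero_add, qp_zero,
    mul_left_comm _ (2 : ℂ), hE]
  field_simp
  try ring

lemma contraction_Fp_Fm (hq : h.re < 0) (hr : 0 < r) (hrs : 0 < r - k) :
    Contraction (withKappa h k (anFp h r k)) (crFm h k)
      (fun x => qPoch (qp h (2) * x) (qp h (2 * r)))
      (fun x => qPoch (qp h (-2) * x) (qp h (2 * r))) := by
  refine contraction_of_logSeries (geomBdd_withKappa (geomBdd_anFp hq hr))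
    (geomBdd_crFm hq)
    (logSeries_qPoch h (-2) 2 (norm_qp_two_mul_lt_one hq hr)) fun n => ?_
  have hn : ((n : ℕ) : ℂ) ≠ 0 := Nat.cast_ne_zero.mpr n.ne_zero
  obtain ⟨q, Q, W, R, Z, e, _, _, _, _, _, _, _, _, _, _, _, _, _, hE⟩ :=
    exists_monomials hq hr hrs n 0 0
  simp only [withKappa, anFp, crFm, byBoson, kappa, qnum, Pi.zero_apply, qp_pow]
  simp only [mul_add, mul_sub, add_mul, sub_mul, mul_neg, neg_mul, neg_add, neg_sub, neg_neg,
    qp_add, qp_sub, qp_neg, mul_one, one_mul, mul_zero, zero_mul, add_zero, zero_add, qp_zero,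
    mul_left_comm _ (2 : ℂ), hE]
  field_simp
  try ring

lemma contraction_Ep_Fp (hq : h.re < 0) (hr : 0 < r) (hrs : 0 < r - k) :
    Contraction (withKappa h k (anE h 1)) (crFp h k)
      (fun x => (1 - qp h (k + 2) * x))
      (fun x => (1 - qp h (k) * x)) := by
  refine contraction_of_logSeries (geomBdd_withKappa (geomBdd_anE hq 1))
    (geomBdd_crFp hq)
    (logSeries_linear h (k) (k + 2)) fun n => ?_
  have hn : ((n : ℕ) : ℂ) ≠ 0 := Nat.cast_ne_zero.mpr n.ne_zero
  obtain ⟨q, Q, W, R, Z, e, _, _, _, _, _, _, _, _, _, _, _, _, _, hE⟩ :=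
    exists_monomials hq hr hrs n 0 0
  simp only [withKappa, anE, crFp, byBoson, kappa, qnum, Pi.zero_apply, qp_pow]
  simp only [mul_add, mul_sub, add_mul, sub_mul, mul_neg, neg_mul, neg_add, neg_sub, neg_neg,
    qp_add, qp_sub, qp_neg, mul_one, one_mul, mul_zero, zero_mul, add_zero, zero_add, qp_zero,
    mul_left_comm _ (2 : ℂ), hE]
  field_simp
  try ring

lemma contraction_Em_Fm (hq : h.re < 0) (hr : 0 < r) (hrs : 0 < r - k) :
    Contraction (withKappa h k (anE h (-1))) (crFm h k)
      (fun x => (1 - qp h (-k - 2) * x))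
      (fun x => (1 - qp h (-k) * x)) := by
  refine contraction_of_logSeries (geomBdd_withKappa (geomBdd_anE hq (-1)))
    (geomBdd_crFm hq)
    (logSeries_linear h (-k) (-k - 2)) fun n => ?_
  have hn : ((n : ℕ) : ℂ) ≠ 0 := Nat.cast_ne_zero.mpr n.ne_zero
  obtain ⟨q, Q, W, R, Z, e, _, _, _, _, _, _, _, _, _, _, _, _, _, hE⟩ :=
    exists_monomials hq hr hrs n 0 0
  simp only [withKappa, anE, crFm, byBoson, kappa, qnum, Pi.zero_apply, qp_pow]
  simp only [mul_add, mul_sub, add_mul, sub_mul, mul_neg, neg_mul, neg_add, neg_sub, neg_neg,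
    qp_add, qp_sub, qp_neg, mul_one, one_mul, mul_zero, zero_mul, add_zero, zero_add, qp_zero,
    mul_left_comm _ (2 : ℂ), hE]
  field_simp
  try ring

lemma contraction_Fm_Em (hq : h.re < 0) (hr : 0 < r) (hrs : 0 < r - k) :
    Contraction (withKappa h k (anFm h r k)) (crE h r k (-1))
      (fun x => (1 - qp h (k + 2) * x))
      (fun x => (1 - qp h (k) * x)) := by
  refine contraction_of_logSeries (geomBdd_withKappa (geomBdd_anFm hq hr))
    (geomBdd_crE hq hrs (-1))
    (logSeries_linear h (k) (k + 2)) fun n => ?_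
  have hn : ((n : ℕ) : ℂ) ≠ 0 := Nat.cast_ne_zero.mpr n.ne_zero
  obtain ⟨q, Q, W, R, Z, e, _, _, _, _, _, _, _, _, _, _, _, _, _, hE⟩ :=
    exists_monomials hq hr hrs n 0 0
  simp only [withKappa, anFm, crE, byBoson, kappa, qnum, Pi.zero_apply, qp_pow]
  simp only [mul_add, mul_sub, add_mul, sub_mul, mul_neg, neg_mul, neg_add, neg_sub, neg_neg,
    qp_add, qp_sub, qp_neg, mul_one, one_mul, mul_zero, zero_mul, add_zero, zero_add, qp_zero,
    mul_left_comm _ (2 : ℂ), hE]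
  field_simp
  try ring

lemma contraction_Fp_Ep (hq : h.re < 0) (hr : 0 < r) (hrs : 0 < r - k) :
    Contraction (withKappa h k (anFp h r k)) (crE h r k 1)
      (fun x => (1 - qp h (-k - 2) * x))
      (fun x => (1 - qp h (-k) * x)) := by
  refine contraction_of_logSeries (geomBdd_withKappa (geomBdd_anFp hq hr))
    (geomBdd_crE hq hrs 1)
    (logSeries_linear h (-k) (-k - 2)) fun n => ?_
  have hn : ((n : ℕ) : ℂ) ≠ 0 := Nat.cast_ne_zero.mpr n.ne_zero
  obtain ⟨q, Q, W, R, Z, e, _, _, _, _, _, _, _, _, _, _, _, _, _, hE⟩ :=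
    exists_monomials hq hr hrs n 0 0
  simp only [withKappa, anFp, crE, byBoson, kappa, qnum, Pi.zero_apply, qp_pow]
  simp only [mul_add, mul_sub, add_mul, sub_mul, mul_neg, neg_mul, neg_add, neg_sub, neg_neg,
    qp_add, qp_sub, qp_neg, mul_one, one_mul, mul_zero, zero_mul, add_zero, zero_add, qp_zero,
    mul_left_comm _ (2 : ℂ), hE]
  field_simp
  try ring

lemma contraction_Ep_Fm (hq : h.re < 0) (hr : 0 < r) (hrs : 0 < r - k) :
    Contraction (withKappa h k (anE h 1)) (crFm h k)
      (fun _ => 1)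
      (fun _ => 1) := by
  refine contraction_of_logSeries (geomBdd_withKappa (geomBdd_anE hq 1))
    (geomBdd_crFm hq)
    LogSeries.zero fun n => ?_
  have hn : ((n : ℕ) : ℂ) ≠ 0 := Nat.cast_ne_zero.mpr n.ne_zero
  obtain ⟨q, Q, W, R, Z, e, _, _, _, _, _, _, _, _, _, _, _, _, _, hE⟩ :=
    exists_monomials hq hr hrs n 0 0
  simp only [withKappa, anE, crFm, byBoson, kappa, qnum, Pi.zero_apply, qp_pow]
  simp only [mul_add, mul_sub, add_mul, sub_mul, mul_neg, neg_mul, neg_add, neg_sub, neg_neg,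
    qp_add, qp_sub, qp_neg, mul_one, one_mul, mul_zero, zero_mul, add_zero, zero_add, qp_zero,
    mul_left_comm _ (2 : ℂ), hE]
  field_simp
  try ring

lemma contraction_Em_Fp (hq : h.re < 0) (hr : 0 < r) (hrs : 0 < r - k) :
    Contraction (withKappa h k (anE h (-1))) (crFp h k)
      (fun _ => 1)
      (fun _ => 1) := by
  refine contraction_of_logSeries (geomBdd_withKappa (geomBdd_anE hq (-1)))
    (geomBdd_crFp hq)
    LogSeries.zero fun n => ?_
  have hn : ((n : ℕ) : ℂ) ≠ 0 := Nat.cast_ne_zero.mpr n.ne_zero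
  obtain ⟨q, Q, W, R, Z, e, _, _, _, _, _, _, _, _, _, _, _, _, _, hE⟩ :=
    exists_monomials hq hr hrs n 0 0
  simp only [withKappa, anE, crFp, byBoson, kappa, qnum, Pi.zero_apply, qp_pow]
  simp only [mul_add, mul_sub, add_mul, sub_mul, mul_neg, neg_mul, neg_add, neg_sub, neg_neg,
    qp_add, qp_sub, qp_neg, mul_one, one_mul, mul_zero, zero_mul, add_zero, zero_add, qp_zero,
    mul_left_comm _ (2 : ℂ), hE]
  field_simp
  try ring

lemma contraction_Fm_Ep (hq : h.re < 0) (hr : 0 < r) (hrs : 0 < r - k) :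
    Contraction (withKappa h k (anFm h r k)) (crE h r k 1)
      (fun _ => 1)
      (fun _ => 1) := by
  refine contraction_of_logSeries (geomBdd_withKappa (geomBdd_anFm hq hr))
    (geomBdd_crE hq hrs 1)
    LogSeries.zero fun n => ?_
  have hn : ((n : ℕ) : ℂ) ≠ 0 := Nat.cast_ne_zero.mpr n.ne_zero
  obtain ⟨q, Q, W, R, Z, e, _, _, _, _, _, _, _, _, _, _, _, _, _, hE⟩ :=
    exists_monomials hq hr hrs n 0 0
  simp only [withKappa, anFm, crE, byBoson, kappa, qnum, Pi.zero_apply, qp_pow]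
  simp only [mul_add, mul_sub, add_mul, sub_mul, mul_neg, neg_mul, neg_add, neg_sub, neg_neg,
    qp_add, qp_sub, qp_neg, mul_one, one_mul, mul_zero, zero_mul, add_zero, zero_add, qp_zero,
    mul_left_comm _ (2 : ℂ), hE]
  field_simp
  try ring

lemma contraction_Fp_Em (hq : h.re < 0) (hr : 0 < r) (hrs : 0 < r - k) :
    Contraction (withKappa h k (anFp h r k)) (crE h r k (-1))
      (fun _ => 1)
      (fun _ => 1) := by
  refine contraction_of_logSeries (geomBdd_withKappa (geomBdd_anFp hq hr))
    (geomBdd_crE hq hrs (-1))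
    LogSeries.zero fun n => ?_
  have hn : ((n : ℕ) : ℂ) ≠ 0 := Nat.cast_ne_zero.mpr n.ne_zero
  obtain ⟨q, Q, W, R, Z, e, _, _, _, _, _, _, _, _, _, _, _, _, _, hE⟩ :=
    exists_monomials hq hr hrs n 0 0
  simp only [withKappa, anFp, crE, byBoson, kappa, qnum, Pi.zero_apply, qp_pow]
  simp only [mul_add, mul_sub, add_mul, sub_mul, mul_neg, neg_mul, neg_add, neg_sub, neg_neg,
    qp_add, qp_sub, qp_neg, mul_one, one_mul, mul_zero, zero_mul, add_zero, zero_add, qp_zero,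
    mul_left_comm _ (2 : ℂ), hE]
  field_simp
  try ring

end

/-! ### Exchange relations of vertex operators -/

lemma differentiable_qp (h : ℂ) : Differentiable ℂ (qp h) := by
  unfold qp
  fun_prop

@[fun_prop]
lemma differentiable_qp_comp {X : Type*} [NormedAddCommGroup X] [NormedSpace ℂ X] {f : X → ℂ}
    (h : ℂ)
    (hf : Differentiable ℂ f) : Differentiable ℂ fun x => qp h (f x) :=
  (differentiable_qp h).comp hf

lemma differentiable_divPow {X : Type*} [NormedAddCommGroup X] [NormedSpace ℂ X] {x : X → Mode → ℂ}
    (hx : ∀ i, Differentiable ℂ fun p => x p i) (e : Mode →₀ ℕ) :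
    Differentiable ℂ fun p => divPow (x p) e := by
  unfold divPow Finsupp.prod
  induction e.support using Finset.induction_on with
  | empty => simp only [Finset.prod_empty, differentiable_const]
  | insert i S hi ih =>
    simp only [Finset.prod_insert hi, smul_eq_mul] at ih ⊢
    exact (((hx i).pow _).const_mul _).mul ih

lemma differentiable_matEl {X : Type*} [NormedAddCommGroup X] [NormedSpace ℂ X]
    {x c : X → Mode → ℂ} (hx : ∀ i, Differentiable ℂ fun p => x p i)
    (hc : ∀ i, Differentiable ℂ fun p => c p i) (s t : Mode →₀ ℕ) :
    Differentiable ℂ fun p => matEl (x p) (c p) s t := by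
  simp only [matEl_eq_sum]
  refine Differentiable.fun_sum fun p _ => (differentiable_divPow hx _).mul ?_
  split_ifs
  · exact (differentiable_divPow hc _).const_mul _
  · exact differentiable_const _

/-- `N_A / D_A` and `N_B / D_B`, functions of `w / z` and of `z / w`, have continuations whose ratio
is `num / den`, a function of `x` with `z / w = q ^ (2x)`; moreover multiplying them by `den` and
`num` removes all poles. -/
def Balanced (h : ℂ) (NA DA NB DB num den : ℂ → ℂ) : Prop :=
  ∃ G cA cB : ℂ → ℂ, Differentiable ℂ G ∧
    ∀ x, den x = cA x * DA (qp h (2 * x))⁻¹ ∧ G x = cA x * NA (qp h (2 * x))⁻¹ ∧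
      num x = cB x * DB (qp h (2 * x)) ∧ G x = cB x * NB (qp h (2 * x))

lemma Balanced.mul {h : ℂ} {NA DA NB DB num den NA' DA' NB' DB' num' den' : ℂ → ℂ}
    (H : Balanced h NA DA NB DB num den) (H' : Balanced h NA' DA' NB' DB' num' den') :
    Balanced h (fun x => NA x * NA' x) (fun x => DA x * DA' x) (fun x => NB x * NB' x)
      (fun x => DB x * DB' x) (fun x => num x * num' x) (fun x => den x * den' x) := by
  obtain ⟨G, cA, cB, hG, hx⟩ := H
  obtain ⟨G', cA', cB', hG', hx'⟩ := H'
  refine ⟨fun x => G x * G' x, fun x => cA x * cA' x, fun x => cB x * cB' x, hG.mul hG',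
    fun x => ⟨?_, ?_, ?_, ?_⟩⟩
  · simp only [(hx x).1, (hx' x).1]
    ring
  · simp only [(hx x).2.1, (hx' x).2.1]
    ring
  · simp only [(hx x).2.2.1, (hx' x).2.2.1]
    ring
  · simp only
    rw [(hx x).2.2.2, (hx' x).2.2.2]
    ring

lemma exists_radius {P Q : ℂ → Prop} (hP : ∀ᶠ x in 𝓝 (0 : ℂ), P x)
    (hQ : ∀ᶠ x in 𝓝 (0 : ℂ), Q x) : ∃ ρ : ℝ, 0 < ρ ∧ ∀ x : ℂ, ‖x‖ < ρ → P x ∧ Q x := by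
  obtain ⟨ρ, hρ, hb⟩ := Metric.eventually_nhds_iff.mp (hP.and hQ)
  exact ⟨ρ, hρ, fun x hx => hb (by simpa using hx)⟩

lemma norm_ratio_lt {h u v : ℂ} {ρ : ℝ} (huv : ‖qp h (2 * v)‖ < ρ * ‖qp h (2 * u)‖) :
    ‖qp h (2 * v) * (qp h (2 * u))⁻¹‖ < ρ := by
  rw [norm_mul, norm_inv, ← div_eq_mul_inv, div_lt_iff₀ (norm_pos_iff.mpr (qp_ne_zero _ _))]
  exact huv

lemma vtx_mul_vtx {h : ℂ} {σA σB : Charge} {χA χB : ℂ → Charge → ℂ} {gA fA gB fB : Mode → ℂ}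
    {u v L : ℂ}
    (hL : HasSum (fun i : Mode => fA i * gB i * (qp h (2 * v) * (qp h (2 * u))⁻¹) ^ (i.2 : ℕ)) L)
    (s t : State) :
    HasSum (fun m => vtx h σA χA gA fA u s m * vtx h σB χB gB fB v m t)
      (Complex.exp L * vop (σA + σB) (fun μ => χA u (μ + σB) * χB v μ)
        (fun i => gA i * qp h (2 * u) ^ (i.2 : ℕ) + gB i * qp h (2 * v) ^ (i.2 : ℕ))
        (fun i => fA i * (qp h (2 * u))⁻¹ ^ (i.2 : ℕ) + fB i * (qp h (2 * v))⁻¹ ^ (i.2 : ℕ))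
        s t) := by
  refine hasSum_vop_mul_vop (hasSum_of_eq hL (fun i => ?_) rfl) s t
  rw [mul_pow]
  ring

/-- Two vertex operators whose contractions are `N_A / D_A` and `N_B / D_B` satisfy an exchange
relation; `ζ_A` and `ζ_B` come from moving the zero modes past each other. -/
theorem exchange_vtx {h : ℂ} {σA σB : Charge} {χA χB : ℂ → Charge → ℂ} {gA fA gB fB : Mode → ℂ}
    {NA DA NB DB num num' den ζA ζB : ℂ → ℂ}
    (cAB : Contraction fA gB NA DA) (cBA : Contraction fB gA NB DB)
    (dA : ∀ μ, Differentiable ℂ fun u => χA u μ) (dB : ∀ μ, Differentiable ℂ fun u => χB u μ)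
    (sA : ∀ u μ, χA u (μ + σB) = ζA u * χA u μ) (sB : ∀ v μ, χB v (μ + σA) = ζB v * χB v μ)
    (H : Balanced h NA DA NB DB num' den)
    (hz : ∀ u v, ζB v * num (u - v) = ζA u * num' (u - v)) :
    Exchange h (vtx h σA χA gA fA) (vtx h σB χB gB fB) num den := by
  obtain ⟨G, cA, cB, hG, hx⟩ := H
  obtain ⟨ρ, hρ, hb⟩ := exists_radius cAB cBA
  refine ⟨ρ, hρ, fun s t => ?_⟩
  set M : ℂ × ℂ → ℂ := fun p => matEl
    (fun i => gA i * qp h (2 * p.1) ^ (i.2 : ℕ) + gB i * qp h (2 * p.2) ^ (i.2 : ℕ))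
    (fun i => fA i * (qp h (2 * p.1))⁻¹ ^ (i.2 : ℕ) + fB i * (qp h (2 * p.2))⁻¹ ^ (i.2 : ℕ))
    s.2 t.2 with hM
  have dM : Differentiable ℂ M := by
    refine differentiable_matEl (fun i => ?_) (fun i => ?_) _ _
    · fun_prop
    · simp only [← qp_neg]
      fun_prop
  refine ⟨fun p => if s.1 = t.1 + (σA + σB) then
    G (p.1 - p.2) * (χA p.1 (t.1 + σB) * χB p.2 t.1 * M p) else 0, ?_, ?_, ?_⟩
  · split_ifs
    · have h1 : Differentiable ℂ fun p : ℂ × ℂ => G (p.1 - p.2) :=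
        hG.comp (differentiable_fst.sub differentiable_snd)
      have h2 : Differentiable ℂ fun p : ℂ × ℂ => χA p.1 (t.1 + σB) :=
        (dA _).comp differentiable_fst
      have h3 : Differentiable ℂ fun p : ℂ × ℂ => χB p.2 t.1 := (dB _).comp differentiable_snd
      exact h1.mul ((h2.mul h3).mul dM)
    · exact differentiable_const _
  · intro u v huv
    obtain ⟨L, hL, hE⟩ := (hb _ (norm_ratio_lt huv)).1
    have hS := vtx_mul_vtx (σA := σA) (σB := σB) (χA := χA) (χB := χB) (gA := gA) (fB := fB) hL s t
    refine ⟨hS.summable, ?_⟩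
    rw [opMul, hS.tsum_eq]
    have hxy : qp h (2 * v) * (qp h (2 * u))⁻¹ = (qp h (2 * (u - v)))⁻¹ := by
      rw [mul_sub, qp_sub, mul_inv, inv_inv, mul_comm]
    rw [hxy] at hE
    simp only [vop]
    split_ifs
    · rw [(hx _).1, (hx _).2.1, ← hE]
      ring
    · simp
  · intro u v huv
    obtain ⟨L, hL, hE⟩ := (hb _ (norm_ratio_lt huv)).2
    have hS := vtx_mul_vtx (σA := σB) (σB := σA) (χA := χB) (χB := χA) (gA := gB) (fB := fA) hL s t
    refine ⟨hS.summable, ?_⟩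
    rw [opMul, hS.tsum_eq]
    have hxy : qp h (2 * u) * (qp h (2 * v))⁻¹ = qp h (2 * (u - v)) := by
      rw [mul_sub, qp_sub]
    rw [hxy] at hE
    simp only [vop, add_comm σB σA]
    split_ifs
    · have e1 : (fun i : Mode => gB i * qp h (2 * v) ^ (i.2 : ℕ) +
            gA i * qp h (2 * u) ^ (i.2 : ℕ)) =
          fun i => gA i * qp h (2 * u) ^ (i.2 : ℕ) + gB i * qp h (2 * v) ^ (i.2 : ℕ) :=
        funext fun i => add_comm _ _
      have e2 : (fun i : Mode => fB i * (qp h (2 * v))⁻¹ ^ (i.2 : ℕ) +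
            fA i * (qp h (2 * u))⁻¹ ^ (i.2 : ℕ)) =
          fun i => fA i * (qp h (2 * u))⁻¹ ^ (i.2 : ℕ) + fB i * (qp h (2 * v))⁻¹ ^ (i.2 : ℕ) :=
        funext fun i => add_comm _ _
      simp only [hM, e1, e2, sA, sB]
      have h3 : G (u - v) = cB (u - v) * (Complex.exp L * DB (qp h (2 * (u - v)))) := by
        rw [(hx _).2.2.2, hE]
      have h4 := hz u v
      rw [(hx _).2.2.1] at h4
      rw [h3]
      linear_combination (Complex.exp L * χB v t.1 * χA u t.1 * matEl
        (fun i => gA i * qp h (2 * u) ^ (i.2 : ℕ) + gB i * qp h (2 * v) ^ (i.2 : ℕ))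
        (fun i => fA i * (qp h (2 * u))⁻¹ ^ (i.2 : ℕ) + fB i * (qp h (2 * v))⁻¹ ^ (i.2 : ℕ))
        s.2 t.2) * h4
    · simp

section Closure

variable {ι : Type} {h : ℂ} {A A' B B' : ℂ → Op ι} {num den : ℂ → ℂ}

lemma Exchange.sub_left (H : Exchange h A B num den) (H' : Exchange h A' B num den) :
    Exchange h (fun u => A u - A' u) B num den := by
  obtain ⟨ρ, hρ, H⟩ := H
  obtain ⟨ρ', hρ', H'⟩ := H'
  refine ⟨min ρ ρ', lt_min hρ hρ', fun s t => ?_⟩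
  obtain ⟨N, hN, h1, h2⟩ := H s t
  obtain ⟨N', hN', h1', h2'⟩ := H' s t
  have hle : ∀ x y : ℝ, 0 ≤ y → x < min ρ ρ' * y → x < ρ * y ∧ x < ρ' * y := fun x y hy hx =>
    ⟨hx.trans_le (mul_le_mul_of_nonneg_right (min_le_left _ _) hy),
      hx.trans_le (mul_le_mul_of_nonneg_right (min_le_right _ _) hy)⟩
  refine ⟨fun p => N p - N' p, hN.sub hN', fun u v huv => ?_, fun u v huv => ?_⟩
  · obtain ⟨a1, a2⟩ := hle _ _ (norm_nonneg _) huv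
    obtain ⟨b1, c1⟩ := h1 u v a1
    obtain ⟨b2, c2⟩ := h1' u v a2
    have e : (fun m => (A u - A' u) s m * B v m t) =
        fun m => A u s m * B v m t - A' u s m * B v m t := funext fun m => sub_mul _ _ _
    refine ⟨by rw [e]; exact b1.sub b2, ?_⟩
    change _ = N (u, v) - N' (u, v)
    rw [← c1, ← c2, opMul, opMul, opMul, e, b1.tsum_sub b2, mul_sub]
  · obtain ⟨a1, a2⟩ := hle _ _ (norm_nonneg _) huv
    obtain ⟨b1, c1⟩ := h2 u v a1
    obtain ⟨b2, c2⟩ := h2' u v a2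
    have e : (fun m => B v s m * (A u - A' u) m t) =
        fun m => B v s m * A u m t - B v s m * A' u m t := funext fun m => mul_sub _ _ _
    refine ⟨by rw [e]; exact b1.sub b2, ?_⟩
    change _ = N (u, v) - N' (u, v)
    rw [← c1, ← c2, opMul, opMul, opMul, e, b1.tsum_sub b2, mul_sub]

lemma Exchange.swap (H : Exchange h A B num den) :
    Exchange h B A (fun x => den (-x)) (fun x => num (-x)) := by
  obtain ⟨ρ, hρ, H⟩ := H
  refine ⟨ρ, hρ, fun s t => ?_⟩
  obtain ⟨N, hN, h1, h2⟩ := H s t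
  refine ⟨fun p => N (p.2, p.1), hN.comp (differentiable_snd.prodMk differentiable_fst),
    fun u v huv => ?_, fun u v huv => ?_⟩
  · simpa only [neg_sub] using h2 v u huv
  · simpa only [neg_sub] using h1 v u huv

lemma Exchange.sub_right (H : Exchange h A B num den) (H' : Exchange h A B' num den) :
    Exchange h A (fun u => B u - B' u) num den := by
  simpa only [neg_neg] using (H.swap.sub_left H'.swap).swap

/-- The numerator and the denominator of an exchange relation may be multiplied by a common entire
function. -/
lemma Exchange.gauge (H : Exchange h A B num den) {num' den' : ℂ → ℂ} (g : ℂ → ℂ)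
    (hg : Differentiable ℂ g) (hn : ∀ x, num' x = g x * num x) (hd : ∀ x, den' x = g x * den x) :
    Exchange h A B num' den' := by
  obtain ⟨ρ, hρ, H⟩ := H
  refine ⟨ρ, hρ, fun s t => ?_⟩
  obtain ⟨N, hN, h1, h2⟩ := H s t
  refine ⟨fun p => g (p.1 - p.2) * N p,
    (hg.comp (differentiable_fst.sub differentiable_snd)).mul hN, fun u v huv => ?_,
    fun u v huv => ?_⟩
  · obtain ⟨a, b⟩ := h1 u v huv
    exact ⟨a, by rw [hd, mul_assoc, b]⟩
  · obtain ⟨a, b⟩ := h2 u v huv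
    exact ⟨a, by rw [hn, mul_assoc, b]⟩

end Closure

/-! ### Quotients of theta functions -/

lemma differentiable_tailPoch {h τ : ℂ} (hτ : ‖qp h τ‖ < 1) (a : ℂ) :
    Differentiable ℂ (tailPoch h τ a) :=
  (differentiable_qPoch hτ).comp (differentiable_id.const_mul _)

lemma differentiable_tailPoch_qp {h τ : ℂ} (hτ : ‖qp h τ‖ < 1) (a : ℂ) :
    Differentiable ℂ fun x => tailPoch h τ a (qp h (2 * x)) :=
  (differentiable_tailPoch hτ a).comp (by fun_prop)

lemma differentiable_tailPoch_qp_inv {h τ : ℂ} (hτ : ‖qp h τ‖ < 1) (a : ℂ) :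
    Differentiable ℂ fun x => tailPoch h τ a (qp h (2 * x))⁻¹ := by
  simp only [← qp_neg]
  exact (differentiable_tailPoch hτ a).comp (by fun_prop)

lemma bigTheta_qp_split {h τ : ℂ} (hτ : ‖qp h τ‖ < 1) (a x : ℂ) :
    bigTheta (qp h τ) (qp h (a + 2 * x)) =
      (1 - qp h a * qp h (2 * x)) * tailPoch h τ a (qp h (2 * x)) *
        tailPoch h τ (-a) (qp h (2 * x))⁻¹ * qPoch (qp h τ) (qp h τ) := by
  rw [qp_add, bigTheta_split hτ]

/-- The factor `1 - q ^ a z / w` of the theta function is expanded in powers of `w / z`. -/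
lemma balanced_theta_left {h τ : ℂ} (hτ : ‖qp h τ‖ < 1) (a b : ℂ) :
    Balanced h (fun x => qPoch (qp h (-b) * x) (qp h τ)) (fun x => qPoch (qp h (-a) * x) (qp h τ))
      (fun x => tailPoch h τ a x) (fun x => tailPoch h τ b x)
      (fun x => qp h (a - b) * bigTheta (qp h τ) (qp h (b + 2 * x)))
      (fun x => bigTheta (qp h τ) (qp h (a + 2 * x))) := by
  refine ⟨fun x => qp h (a - b) * ((1 - qp h b * qp h (2 * x)) * tailPoch h τ a (qp h (2 * x)) *
      tailPoch h τ (-b) (qp h (2 * x))⁻¹ * qPoch (qp h τ) (qp h τ)),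
    fun x => -(qp h a * qp h (2 * x) * tailPoch h τ a (qp h (2 * x)) * qPoch (qp h τ) (qp h τ)),
    fun x => qp h (a - b) * ((1 - qp h b * qp h (2 * x)) * tailPoch h τ (-b) (qp h (2 * x))⁻¹ *
      qPoch (qp h τ) (qp h τ)), ?_, fun x => ⟨?_, ?_, ?_, ?_⟩⟩
  · have h1 := differentiable_tailPoch_qp hτ a
    have h2 := differentiable_tailPoch_qp_inv hτ (-b)
    fun_prop
  · have h1 := qp_ne_zero h a
    have h2 := qp_ne_zero h (2 * x)
    simp only [bigTheta_qp_split hτ, qPoch_split hτ]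
    simp only [qp_neg h a]
    field_simp
    ring
  · have h0 := qp_ne_zero h b
    have h2 := qp_ne_zero h (2 * x)
    simp only [qPoch_split hτ]
    simp only [qp_neg h b, qp_sub]
    field_simp
    ring
  · simp only [bigTheta_qp_split hτ]
    ring
  · ring

/-- The factor `1 - q ^ b z / w` of the theta function is expanded in powers of `z / w`. -/
lemma balanced_theta_right {h τ : ℂ} (hτ : ‖qp h τ‖ < 1) (a b : ℂ) :
    Balanced h (fun x => tailPoch h τ (-b) x) (fun x => tailPoch h τ (-a) x)
      (fun x => qPoch (qp h a * x) (qp h τ)) (fun x => qPoch (qp h b * x) (qp h τ))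
      (fun x => bigTheta (qp h τ) (qp h (b + 2 * x)))
      (fun x => bigTheta (qp h τ) (qp h (a + 2 * x))) := by
  refine ⟨fun x => (1 - qp h a * qp h (2 * x)) * tailPoch h τ a (qp h (2 * x)) *
      tailPoch h τ (-b) (qp h (2 * x))⁻¹ * qPoch (qp h τ) (qp h τ),
    fun x => (1 - qp h a * qp h (2 * x)) * tailPoch h τ a (qp h (2 * x)) * qPoch (qp h τ) (qp h τ),
    fun x => tailPoch h τ (-b) (qp h (2 * x))⁻¹ * qPoch (qp h τ) (qp h τ), ?_,
    fun x => ⟨?_, ?_, ?_, ?_⟩⟩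
  · have h1 := differentiable_tailPoch_qp hτ a
    have h2 := differentiable_tailPoch_qp_inv hτ (-b)
    fun_prop
  · simp only [bigTheta_qp_split hτ]
    ring
  · ring
  · simp only [bigTheta_qp_split hτ, qPoch_split hτ]
    ring
  · simp only [qPoch_split hτ]
    ring

/-- Contractions with a common linear denominator and different linear numerators; the zero of the
denominator is a pole of both orderings. -/
lemma balanced_theta_linear {h τ : ℂ} (hτ : ‖qp h τ‖ < 1) (a b d : ℂ) :
    Balanced h (fun x => tailPoch h τ (-b) x * (1 - qp h d * x))
      (fun x => tailPoch h τ (-a) x * (1 - qp h (-a) * x))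
      (fun x => tailPoch h τ a x * (1 - qp h (-d) * x))
      (fun x => tailPoch h τ b x * (1 - qp h b * x))
      (fun x => qp h (a + d) * bigTheta (qp h τ) (qp h (b + 2 * x)))
      (fun x => bigTheta (qp h τ) (qp h (a + 2 * x))) := by
  refine ⟨fun x => qp h (a + d) * ((1 - qp h (-d) * qp h (2 * x)) *
      tailPoch h τ a (qp h (2 * x)) * tailPoch h τ (-b) (qp h (2 * x))⁻¹ * qPoch (qp h τ) (qp h τ)),
    fun x => -(qp h a * qp h (2 * x) * tailPoch h τ a (qp h (2 * x)) * qPoch (qp h τ) (qp h τ)),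
    fun x => qp h (a + d) * (tailPoch h τ (-b) (qp h (2 * x))⁻¹ * qPoch (qp h τ) (qp h τ)), ?_,
    fun x => ⟨?_, ?_, ?_, ?_⟩⟩
  · have h1 := differentiable_tailPoch_qp hτ a
    have h2 := differentiable_tailPoch_qp_inv hτ (-b)
    fun_prop
  · have h1 := qp_ne_zero h a
    have h2 := qp_ne_zero h (2 * x)
    simp only [bigTheta_qp_split hτ, qp_neg h a]
    field_simp
    ring
  · have h0 := qp_ne_zero h d
    have h2 := qp_ne_zero h (2 * x)
    simp only [qp_neg h d, qp_add]
    field_simp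
    ring
  · simp only [bigTheta_qp_split hτ]
    ring
  · ring

/-- Two theta quotients whose poles `1 - q ^ (±a) z / w` cancel each other. -/
lemma balanced_theta_theta {h τ τ' : ℂ} (hτ : ‖qp h τ‖ < 1) (hτ' : ‖qp h τ'‖ < 1) (a : ℂ) :
    Balanced h (fun x => tailPoch h τ (-a) x * tailPoch h τ' a x)
      (fun x => tailPoch h τ a x * tailPoch h τ' (-a) x)
      (fun x => tailPoch h τ (-a) x * tailPoch h τ' a x)
      (fun x => tailPoch h τ a x * tailPoch h τ' (-a) x)
      (fun x => bigTheta (qp h τ') (qp h (-a + 2 * x)) * bigTheta (qp h τ) (qp h (a + 2 * x)))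
      (fun x => bigTheta (qp h τ') (qp h (a + 2 * x)) *
        bigTheta (qp h τ) (qp h (-a + 2 * x))) := by
  refine ⟨fun x => (1 - qp h a * qp h (2 * x)) * (1 - qp h (-a) * qp h (2 * x)) *
      tailPoch h τ' a (qp h (2 * x)) * tailPoch h τ (-a) (qp h (2 * x)) *
      tailPoch h τ' a (qp h (2 * x))⁻¹ * tailPoch h τ (-a) (qp h (2 * x))⁻¹ *
      (qPoch (qp h τ) (qp h τ) * qPoch (qp h τ') (qp h τ')),
    fun x => (1 - qp h a * qp h (2 * x)) * (1 - qp h (-a) * qp h (2 * x)) *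
      tailPoch h τ' a (qp h (2 * x)) * tailPoch h τ (-a) (qp h (2 * x)) *
      (qPoch (qp h τ) (qp h τ) * qPoch (qp h τ') (qp h τ')),
    fun x => (1 - qp h a * qp h (2 * x)) * (1 - qp h (-a) * qp h (2 * x)) *
      tailPoch h τ' a (qp h (2 * x))⁻¹ * tailPoch h τ (-a) (qp h (2 * x))⁻¹ *
      (qPoch (qp h τ) (qp h τ) * qPoch (qp h τ') (qp h τ')), ?_, fun x => ⟨?_, ?_, ?_, ?_⟩⟩
  · have h1 := differentiable_tailPoch_qp hτ' a
    have h2 := differentiable_tailPoch_qp_inv hτ' a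
    have h3 := differentiable_tailPoch_qp hτ (-a)
    have h4 := differentiable_tailPoch_qp_inv hτ (-a)
    fun_prop
  · simp only [bigTheta_qp_split hτ, bigTheta_qp_split hτ', neg_neg]
    ring
  · ring
  · simp only [bigTheta_qp_split hτ, bigTheta_qp_split hτ', neg_neg]
    ring
  · ring

/-! ### The exchange relations of the currents -/

section

variable {h : ℂ} {r k : ℝ}

lemma pDiag_add_chH (μ : Charge) : pDiag (μ + chH) = pDiag μ := by
  simp [pDiag, pEig, chH]

lemma pHat_add_chH (μ : Charge) : pHat (μ + chH) = pHat μ - 2 := by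
  simp only [pHat, pEig, chH, Pi.add_apply]
  ring

lemma pDiag_add_chE (μ : Charge) : pDiag (μ + chE) = pDiag μ + 2 := by
  simp only [pDiag, pEig, chE, Pi.add_apply]
  ring

lemma pHat_add_chE (μ : Charge) : pHat (μ + chE) = pHat μ - 2 := by
  simp only [pHat, pEig, chE, Pi.add_apply]
  ring

lemma pDiag_add_chF (μ : Charge) : pDiag (μ + chF) = pDiag μ - 2 := by
  simp only [pDiag, pEig, chF, Pi.add_apply]
  ring

lemma pHat_add_chF (μ : Charge) : pHat (μ + chF) = pHat μ := by
  simp [pHat, pEig, chF]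

lemma zmHp_add_chH (u : ℂ) (μ : Charge) : zmHp h r k u (μ + chH) =
    qp h ((r - k / 2 + 2 * u) * (2 / (r - k) - 2 / r)) * zmHp h r k u μ := by
  rw [zmHp, zmHp, ← qp_add, pDiag_add_chH, pHat_add_chH]
  congr 1
  ring

lemma zmHm_add_chH (u : ℂ) (μ : Charge) : zmHm h r k u (μ + chH) =
    qp h ((-(r - k / 2) + 2 * u) * (2 / (r - k) - 2 / r)) * zmHm h r k u μ := by
  rw [zmHm, zmHm, ← qp_add, pDiag_add_chH, pHat_add_chH]
  congr 1
  ring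

lemma zmHp_add_chE (u : ℂ) (μ : Charge) : zmHp h r k u (μ + chE) =
    qp h (2 + (-(k / 2) + 2 * u) * (2 / r) + (r - k / 2 + 2 * u) * (2 / (r - k) - 2 / r)) *
      zmHp h r k u μ := by
  rw [zmHp, zmHp, ← qp_add, pDiag_add_chE, pHat_add_chE]
  congr 1
  ring

lemma zmHm_add_chE (u : ℂ) (μ : Charge) : zmHm h r k u (μ + chE) =
    qp h (-2 + (k / 2 + 2 * u) * (2 / r) + (-(r - k / 2) + 2 * u) * (2 / (r - k) - 2 / r)) *
      zmHm h r k u μ := by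
  rw [zmHm, zmHm, ← qp_add, pDiag_add_chE, pHat_add_chE]
  congr 1
  ring

lemma zmHp_add_chF (u : ℂ) (μ : Charge) : zmHp h r k u (μ + chF) =
    qp h (-2 - (-(k / 2) + 2 * u) * (2 / r)) * zmHp h r k u μ := by
  rw [zmHp, zmHp, ← qp_add, pDiag_add_chF, pHat_add_chF]
  congr 1
  ring

lemma zmHm_add_chF (u : ℂ) (μ : Charge) : zmHm h r k u (μ + chF) =
    qp h (2 - (k / 2 + 2 * u) * (2 / r)) * zmHm h r k u μ := by
  rw [zmHm, zmHm, ← qp_add, pDiag_add_chF, pHat_add_chF]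
  congr 1
  ring

lemma zmE_add_chH (ε u : ℂ) (μ : Charge) : zmE h r k ε u (μ + chH) =
    qp h (2 * u * (2 / (r - k))) * zmE h r k ε u μ := by
  rw [zmE, zmE, mul_left_comm, ← qp_add, pHat_add_chH]
  simp only [pEig, chH, Pi.add_apply, add_zero]
  congr 2
  ring

lemma zmE_add_chE (ε u : ℂ) (μ : Charge) : zmE h r k ε u (μ + chE) =
    qp h (ε + 2 * u * (2 / (r - k))) * zmE h r k ε u μ := by
  rw [zmE, zmE, mul_left_comm, ← qp_add, pHat_add_chE]
  simp only [pEig, chE, Pi.add_apply]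
  congr 2
  ring

lemma zmE_add_chF (ε u : ℂ) (μ : Charge) : zmE h r k ε u (μ + chF) =
    qp h (-ε) * zmE h r k ε u μ := by
  rw [zmE, zmE, mul_left_comm, ← qp_add, pHat_add_chF]
  simp only [pEig, chF, Pi.add_apply]
  congr 2
  ring

lemma zmF_add_chH (ε u : ℂ) (μ : Charge) : zmF h r k ε u (μ + chH) =
    qp h (-(2 * u * (2 / r))) * zmF h r k ε u μ := by
  rw [zmF, zmF, mul_left_comm, ← qp_add, pHat_add_chH, pDiag_add_chH]
  simp only [pEig, chH, Pi.add_apply, add_zero]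
  congr 2
  ring

lemma zmF_add_chE (ε u : ℂ) (μ : Charge) : zmF h r k ε u (μ + chE) =
    qp h ε * zmF h r k ε u μ := by
  rw [zmF, zmF, mul_left_comm, ← qp_add, pHat_add_chE, pDiag_add_chE]
  simp only [pEig, chE, Pi.add_apply, add_zero]
  congr 2
  ring

lemma zmF_add_chF (ε u : ℂ) (μ : Charge) : zmF h r k ε u (μ + chF) =
    qp h (-ε - 2 * u * (2 / r)) * zmF h r k ε u μ := by
  rw [zmF, zmF, mul_left_comm, ← qp_add, pHat_add_chF, pDiag_add_chF]
  simp only [pEig, chF, Pi.add_apply, add_zero]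
  congr 2
  ring

lemma differentiable_zmHp (μ : Charge) : Differentiable ℂ fun u => zmHp h r k u μ := by
  unfold zmHp
  fun_prop

lemma differentiable_zmHm (μ : Charge) : Differentiable ℂ fun u => zmHm h r k u μ := by
  unfold zmHm
  fun_prop

lemma differentiable_zmE (ε : ℂ) (μ : Charge) : Differentiable ℂ fun u => zmE h r k ε u μ := by
  unfold zmE
  fun_prop

lemma differentiable_zmF (ε : ℂ) (μ : Charge) : Differentiable ℂ fun u => zmF h r k ε u μ := by
  unfold zmF
  fun_prop

lemma mul_qp_mul_eq {a b c d T : ℂ} (e : a + b = c + d) :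
    qp h a * (qp h b * T) = qp h c * (qp h d * T) := by
  rw [← mul_assoc, ← mul_assoc, ← qp_add, ← qp_add, e]

lemma mul_qp_mul_qp_mul_eq {a b b' c d T : ℂ} (e : a + (b + b') = c + d) :
    qp h a * (qp h b * qp h b' * T) = qp h c * (qp h d * T) := by
  rw [← qp_add]
  exact mul_qp_mul_eq e

section Exchange

variable (hq : h.re < 0) (hr : 0 < r) (hrs : 0 < r - k)

include hq hr hrs

lemma exchange_Hp_Hp : Exchange h (vHp h r k) (vHp h r k)
    (fun x => qp h (2 * x * (2 * (1 / (r - k) - 1 / r))) *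
      (bigTheta (qp h (2 * r)) (qp h (-2 + 2 * x)) *
        bigTheta (qp h (2 * (r - k))) (qp h (2 + 2 * x))))
    (fun x => bigTheta (qp h (2 * r)) (qp h (2 + 2 * x)) *
      bigTheta (qp h (2 * (r - k))) (qp h (-2 + 2 * x))) :=
  exchange_vtx (contraction_Hp_Hp hq hr hrs) (contraction_Hp_Hp hq hr hrs)
    differentiable_zmHp differentiable_zmHp zmHp_add_chH zmHp_add_chH
    (balanced_theta_theta (norm_qp_two_mul_sub_lt_one hq hrs) (norm_qp_two_mul_lt_one hq hr) 2)
    fun u v => by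
      rw [← mul_assoc, ← qp_add]
      congr 2
      ring

lemma exchange_Hm_Hm : Exchange h (vHm h r k) (vHm h r k)
    (fun x => qp h (2 * x * (2 * (1 / (r - k) - 1 / r))) *
      (bigTheta (qp h (2 * r)) (qp h (-2 + 2 * x)) *
        bigTheta (qp h (2 * (r - k))) (qp h (2 + 2 * x))))
    (fun x => bigTheta (qp h (2 * r)) (qp h (2 + 2 * x)) *
      bigTheta (qp h (2 * (r - k))) (qp h (-2 + 2 * x))) :=
  exchange_vtx (contraction_Hm_Hm hq hr hrs) (contraction_Hm_Hm hq hr hrs)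
    differentiable_zmHm differentiable_zmHm zmHm_add_chH zmHm_add_chH
    (balanced_theta_theta (norm_qp_two_mul_sub_lt_one hq hrs) (norm_qp_two_mul_lt_one hq hr) 2)
    fun u v => by
      rw [← mul_assoc, ← qp_add]
      congr 2
      ring

omit hq hrs hr in
/-- Quasi-periodicity: `Θ_t(t y) = -y⁻¹ Θ_t(y)`. -/
lemma bigTheta_mul {τ : ℂ} (hτ : ‖qp h τ‖ < 1) (a : ℂ) :
    bigTheta (qp h τ) (qp h (τ + a)) = -qp h (-a) * bigTheta (qp h τ) (qp h a) := by
  have h1 := qPoch_split hτ 0 (qp h a)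
  have h2 := qPoch_split hτ 0 (qp h (-a))
  simp only [tailPoch, add_zero, qp_zero, one_mul, ← qp_add] at h1 h2
  have e1 : qp h τ * (qp h (τ + a))⁻¹ = qp h (-a) := by
    rw [← qp_neg, ← qp_add]
    congr 1
    ring
  have e2 : qp h τ * (qp h a)⁻¹ = qp h (τ + -a) := by rw [← qp_neg, ← qp_add]
  have h0 := qp_ne_zero h a
  rw [bigTheta, bigTheta, e1, e2, h1, h2, qp_neg]
  field_simp
  ring

lemma exchange_Hp_Hm : Exchange h (vHp h r k) (vHm h r k)
    (fun x => qp h (2 * k * (1 / (r - k) + 1 / r)) * qp h (2 * x * (2 * (1 / (r - k) - 1 / r))) *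
      (bigTheta (qp h (2 * r)) (qp h (-2 - k + 2 * x)) *
        bigTheta (qp h (2 * (r - k))) (qp h (2 + k + 2 * x))))
    (fun x => bigTheta (qp h (2 * r)) (qp h (2 - k + 2 * x)) *
      bigTheta (qp h (2 * (r - k))) (qp h (-2 + k + 2 * x))) := by
  have hp := norm_qp_two_mul_lt_one hq hr
  have hps := norm_qp_two_mul_sub_lt_one hq hrs
  have hr' : (r : ℂ) ≠ 0 := Complex.ofReal_ne_zero.mpr hr.ne'
  have hrs' : (r : ℂ) - k ≠ 0 := by
    rw [← Complex.ofReal_sub]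
    exact Complex.ofReal_ne_zero.mpr hrs.ne'
  have H := (balanced_theta_left hps (-2 + k) (2 + k)).mul (balanced_theta_left hp (2 - k) (-2 - k))
  simp only [mul_comm (bigTheta (qp h (2 * (r - k))) _)] at H
  refine exchange_vtx (contraction_Hp_Hm hq hr hrs) (contraction_Hm_Hp hq hr hrs)
    differentiable_zmHp differentiable_zmHm zmHp_add_chH zmHm_add_chH H fun u v => ?_
  rw [mul_mul_mul_comm (qp h (-2 + k - (2 + k))), ← qp_add h (-2 + k - (2 + k)),
    mul_comm (bigTheta (qp h (2 * (r - k))) _)]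
  refine mul_qp_mul_qp_mul_eq ?_
  field_simp
  ring

/-- Both sides of `exchange_Hp_Hm` are shifted by one quasi-period in each theta function; the
factors produced have the same product `(z / w)⁻²` in the numerator and in the denominator. -/
lemma exchange_Hp_Hm_quasiperiod : Exchange h (vHp h r k) (vHm h r k)
    (fun x => qp h (2 * k * (1 / (r - k) + 1 / r)) * qp h (2 * x * (2 * (1 / (r - k) - 1 / r))) *
      (bigTheta (qp h (2 * r)) (qp h (2 * r - 2 - k + 2 * x)) *
        bigTheta (qp h (2 * (r - k))) (qp h (2 * (r - k) + 2 + k + 2 * x))))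
    (fun x => bigTheta (qp h (2 * r)) (qp h (2 * r + 2 - k + 2 * x)) *
      bigTheta (qp h (2 * (r - k))) (qp h (2 * (r - k) - 2 + k + 2 * x))) := by
  have hp := norm_qp_two_mul_lt_one hq hr
  have hps := norm_qp_two_mul_sub_lt_one hq hrs
  refine (exchange_Hp_Hm hq hr hrs).gauge (fun x => qp h (-(4 * x))) (by fun_prop)
    (fun x => ?_) fun x => ?_
  · rw [show (2 * r - 2 - k + 2 * x : ℂ) = 2 * r + (-2 - k + 2 * x) by ring,
      show (2 * (r - k) + 2 + k + 2 * x : ℂ) = 2 * (r - k) + (2 + k + 2 * x) by ring,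
      bigTheta_mul hp, bigTheta_mul hps,
      show -(4 * x) = -(-2 - k + 2 * x) + -(2 + k + 2 * x) by ring, qp_add h (-(-2 - k + 2 * x))]
    ring
  · rw [show (2 * r + 2 - k + 2 * x : ℂ) = 2 * r + (2 - k + 2 * x) by ring,
      show (2 * (r - k) - 2 + k + 2 * x : ℂ) = 2 * (r - k) + (-2 + k + 2 * x) by ring,
      bigTheta_mul hp, bigTheta_mul hps,
      show -(4 * x) = -(2 - k + 2 * x) + -(-2 + k + 2 * x) by ring, qp_add h (-(2 - k + 2 * x))]
    ring

lemma exchange_Hp_E (ε : ℂ) : Exchange h (vHp h r k) (vE h r k ε)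
    (fun x => qp h (k / (r - k) - 2) * qp h (2 * x * (2 / (r - k))) *
      bigTheta (qp h (2 * (r - k))) (qp h (2 + k / 2 + 2 * x)))
    (fun x => bigTheta (qp h (2 * (r - k))) (qp h (-2 + k / 2 + 2 * x))) := by
  have hr' : (r : ℂ) ≠ 0 := Complex.ofReal_ne_zero.mpr hr.ne'
  have hrs' : (r : ℂ) - k ≠ 0 := by
    rw [← Complex.ofReal_sub]
    exact Complex.ofReal_ne_zero.mpr hrs.ne'
  refine exchange_vtx (contraction_Hp_E hq hr hrs ε) (contraction_E_Hp hq hr hrs ε)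
    differentiable_zmHp (differentiable_zmE ε) zmHp_add_chE (zmE_add_chH ε)
    (balanced_theta_left (norm_qp_two_mul_sub_lt_one hq hrs) _ _) fun u v => ?_
  refine mul_qp_mul_qp_mul_eq ?_
  field_simp
  ring

lemma exchange_Hm_E (ε : ℂ) : Exchange h (vHm h r k) (vE h r k ε)
    (fun x => qp h (-(k / (r - k)) - 2) * qp h (2 * x * (2 / (r - k))) *
      bigTheta (qp h (2 * (r - k))) (qp h (2 - k / 2 + 2 * x)))
    (fun x => bigTheta (qp h (2 * (r - k))) (qp h (-2 - k / 2 + 2 * x))) := by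
  have hr' : (r : ℂ) ≠ 0 := Complex.ofReal_ne_zero.mpr hr.ne'
  have hrs' : (r : ℂ) - k ≠ 0 := by
    rw [← Complex.ofReal_sub]
    exact Complex.ofReal_ne_zero.mpr hrs.ne'
  refine exchange_vtx (contraction_Hm_E hq hr hrs ε) (contraction_E_Hm hq hr hrs ε)
    differentiable_zmHm (differentiable_zmE ε) zmHm_add_chE (zmE_add_chH ε)
    (balanced_theta_right (norm_qp_two_mul_sub_lt_one hq hrs) _ _) fun u v => ?_
  rw [← mul_assoc, ← qp_add, ← qp_add]
  congr 2
  field_simp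
  ring

lemma exchange_Hp_Fp : Exchange h (vHp h r k) (vFp h r k)
    (fun x => qp h (k / r + 2) * qp h (2 * x * (-(2 / r))) *
      bigTheta (qp h (2 * r)) (qp h (-2 - k / 2 + 2 * x)))
    (fun x => bigTheta (qp h (2 * r)) (qp h (2 - k / 2 + 2 * x))) := by
  refine exchange_vtx (contraction_Hp_Fp hq hr hrs) (contraction_Fp_Hp hq hr hrs)
    differentiable_zmHp (differentiable_zmF 1) zmHp_add_chF (zmF_add_chH 1)
    (balanced_theta_left (norm_qp_two_mul_lt_one hq hr) _ _) fun u v => ?_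
  refine mul_qp_mul_qp_mul_eq ?_
  ring

lemma exchange_Hp_Fm : Exchange h (vHp h r k) (vFm h r k)
    (fun x => qp h (k / r + 2) * qp h (2 * x * (-(2 / r))) *
      bigTheta (qp h (2 * r)) (qp h (-2 - k / 2 + 2 * x)))
    (fun x => bigTheta (qp h (2 * r)) (qp h (2 - k / 2 + 2 * x))) := by
  refine exchange_vtx (contraction_Hp_Fm hq hr hrs) (contraction_Fm_Hp hq hr hrs)
    differentiable_zmHp (differentiable_zmF (-1)) zmHp_add_chF (zmF_add_chH (-1))
    (balanced_theta_left (norm_qp_two_mul_lt_one hq hr) _ _) fun u v => ?_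
  refine mul_qp_mul_qp_mul_eq ?_
  ring

lemma exchange_Hm_Fp : Exchange h (vHm h r k) (vFp h r k)
    (fun x => qp h (-(k / r) + 2) * qp h (2 * x * (-(2 / r))) *
      bigTheta (qp h (2 * r)) (qp h (-2 + k / 2 + 2 * x)))
    (fun x => bigTheta (qp h (2 * r)) (qp h (2 + k / 2 + 2 * x))) := by
  refine exchange_vtx (contraction_Hm_Fp hq hr hrs) (contraction_Fp_Hm hq hr hrs)
    differentiable_zmHm (differentiable_zmF 1) zmHm_add_chF (zmF_add_chH 1)
    (balanced_theta_right (norm_qp_two_mul_lt_one hq hr) _ _) fun u v => ?_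
  rw [← mul_assoc, ← qp_add, ← qp_add]
  congr 2
  ring

lemma exchange_Hm_Fm : Exchange h (vHm h r k) (vFm h r k)
    (fun x => qp h (-(k / r) + 2) * qp h (2 * x * (-(2 / r))) *
      bigTheta (qp h (2 * r)) (qp h (-2 + k / 2 + 2 * x)))
    (fun x => bigTheta (qp h (2 * r)) (qp h (2 + k / 2 + 2 * x))) := by
  refine exchange_vtx (contraction_Hm_Fm hq hr hrs) (contraction_Fm_Hm hq hr hrs)
    differentiable_zmHm (differentiable_zmF (-1)) zmHm_add_chF (zmF_add_chH (-1))
    (balanced_theta_right (norm_qp_two_mul_lt_one hq hr) _ _) fun u v => ?_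
  rw [← mul_assoc, ← qp_add, ← qp_add]
  congr 2
  ring

lemma exchange_E_E (ε ε' : ℂ) : Exchange h (vE h r k ε) (vE h r k ε')
    (fun x => qp h (-2) * qp h (2 * x * (2 / (r - k))) *
      bigTheta (qp h (2 * (r - k))) (qp h (2 + 2 * x)))
    (fun x => bigTheta (qp h (2 * (r - k))) (qp h (-2 + 2 * x))) := by
  have H := balanced_theta_linear (norm_qp_two_mul_sub_lt_one hq hrs) (-2) 2 (ε' - ε)
  simp only [neg_neg, neg_sub] at H
  refine exchange_vtx (contraction_E_E hq hr hrs ε ε') (contraction_E_E hq hr hrs ε' ε)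
    (differentiable_zmE ε) (differentiable_zmE ε') (zmE_add_chE ε) (zmE_add_chE ε') H fun u v => ?_
  refine mul_qp_mul_qp_mul_eq ?_
  ring

lemma exchange_Fp_Fp : Exchange h (vFp h r k) (vFp h r k)
    (fun x => qp h 2 * qp h (2 * x * (-(2 / r))) *
      bigTheta (qp h (2 * r)) (qp h (-2 + 2 * x)))
    (fun x => bigTheta (qp h (2 * r)) (qp h (2 + 2 * x))) := by
  have H := balanced_theta_linear (norm_qp_two_mul_lt_one hq hr) 2 (-2) 0
  simp only [neg_neg, neg_zero] at H
  refine exchange_vtx (contraction_Fp_Fp hq hr hrs) (contraction_Fp_Fp hq hr hrs)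
    (differentiable_zmF 1) (differentiable_zmF 1) (zmF_add_chF 1) (zmF_add_chF 1) H fun u v => ?_
  refine mul_qp_mul_qp_mul_eq ?_
  ring

lemma exchange_Fm_Fm : Exchange h (vFm h r k) (vFm h r k)
    (fun x => qp h 2 * qp h (2 * x * (-(2 / r))) *
      bigTheta (qp h (2 * r)) (qp h (-2 + 2 * x)))
    (fun x => bigTheta (qp h (2 * r)) (qp h (2 + 2 * x))) := by
  have H := balanced_theta_linear (norm_qp_two_mul_lt_one hq hr) 2 (-2) 0
  simp only [neg_neg, neg_zero] at H
  refine exchange_vtx (contraction_Fm_Fm hq hr hrs) (contraction_Fm_Fm hq hr hrs)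
    (differentiable_zmF (-1)) (differentiable_zmF (-1)) (zmF_add_chF (-1)) (zmF_add_chF (-1)) H
    fun u v => ?_
  refine mul_qp_mul_qp_mul_eq ?_
  ring

lemma exchange_Fp_Fm : Exchange h (vFp h r k) (vFm h r k)
    (fun x => qp h 2 * qp h (2 * x * (-(2 / r))) *
      bigTheta (qp h (2 * r)) (qp h (-2 + 2 * x)))
    (fun x => bigTheta (qp h (2 * r)) (qp h (2 + 2 * x))) := by
  have H := balanced_theta_left (norm_qp_two_mul_lt_one hq hr) 2 (-2)
  simp only [neg_neg] at H
  refine exchange_vtx (contraction_Fp_Fm hq hr hrs) (contraction_Fm_Fp hq hr hrs)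
    (differentiable_zmF 1) (differentiable_zmF (-1)) (zmF_add_chF 1) (zmF_add_chF (-1)) H
    fun u v => ?_
  refine mul_qp_mul_qp_mul_eq ?_
  ring

lemma exchange_Fm_Fp : Exchange h (vFm h r k) (vFp h r k)
    (fun x => qp h 2 * qp h (2 * x * (-(2 / r))) *
      bigTheta (qp h (2 * r)) (qp h (-2 + 2 * x)))
    (fun x => bigTheta (qp h (2 * r)) (qp h (2 + 2 * x))) := by
  have H := balanced_theta_right (norm_qp_two_mul_lt_one hq hr) 2 (-2)
  simp only [neg_neg] at H
  refine exchange_vtx (contraction_Fm_Fp hq hr hrs) (contraction_Fp_Fm hq hr hrs)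
    (differentiable_zmF (-1)) (differentiable_zmF 1) (zmF_add_chF (-1)) (zmF_add_chF 1) H
    fun u v => ?_
  rw [← mul_assoc, ← qp_add, ← qp_add]
  congr 2
  ring

end Exchange

end

/-! ### Additive and multiplicative theta functions -/

section

variable {h : ℂ} {r k : ℝ}

lemma theta_eq (h ν u : ℂ) : theta h ν u =
    (qPoch (qp h (2 * ν)) (qp h (2 * ν)) ^ 3)⁻¹ *
      (qp h (u ^ 2 / ν - u) * bigTheta (qp h (2 * ν)) (qp h (2 * u))) := by
  rw [theta]
  ring

/-- From `Θ` to `θ`: the relation is multiplied by the Gaussian factor of the denominator, and `he`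
says that the factor of the numerator is the product of that one and the power `q ^ e` in the
relation. -/
lemma Exchange.one_theta {ι : Type} {A B : ℂ → Op ι} {ν a b : ℂ} {κ e α β : ℂ → ℂ}
    (H : Exchange h A B (fun x => κ x * bigTheta (qp h (2 * ν)) (qp h (b + 2 * x)))
      (fun x => bigTheta (qp h (2 * ν)) (qp h (a + 2 * x))))
    (hκ : ∀ x, κ x = qp h (e x)) (hα : ∀ x, a + 2 * x = 2 * α x) (hβ : ∀ x, b + 2 * x = 2 * β x)
    (dα : Differentiable ℂ α)
    (he : ∀ x, β x ^ 2 / ν - β x = α x ^ 2 / ν - α x + e x) :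
    Exchange h A B (fun x => theta h ν (β x)) (fun x => theta h ν (α x)) := by
  refine H.gauge (fun x => (qPoch (qp h (2 * ν)) (qp h (2 * ν)) ^ 3)⁻¹ *
    qp h (α x ^ 2 / ν - α x)) (by simp only [div_eq_mul_inv]; fun_prop) (fun x => ?_) fun x => ?_
  · rw [theta_eq, he, qp_add, hκ, hβ]
    ring
  · rw [theta_eq, hα]
    ring

/-- The analogue of `Exchange.one_theta` for products of two theta functions. -/
lemma Exchange.two_thetas {ι : Type} {A B : ℂ → Op ι} {ν a b ν' a' b' : ℂ}
    {κ e α β α' β' : ℂ → ℂ}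
    (H : Exchange h A B
      (fun x => κ x * (bigTheta (qp h (2 * ν)) (qp h (b + 2 * x)) *
        bigTheta (qp h (2 * ν')) (qp h (b' + 2 * x))))
      (fun x => bigTheta (qp h (2 * ν)) (qp h (a + 2 * x)) *
        bigTheta (qp h (2 * ν')) (qp h (a' + 2 * x))))
    (hκ : ∀ x, κ x = qp h (e x)) (hα : ∀ x, a + 2 * x = 2 * α x) (hβ : ∀ x, b + 2 * x = 2 * β x)
    (hα' : ∀ x, a' + 2 * x = 2 * α' x) (hβ' : ∀ x, b' + 2 * x = 2 * β' x)
    (dα : Differentiable ℂ α) (dα' : Differentiable ℂ α')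
    (he : ∀ x, (β x ^ 2 / ν - β x) + (β' x ^ 2 / ν' - β' x) =
      (α x ^ 2 / ν - α x) + (α' x ^ 2 / ν' - α' x) + e x) :
    Exchange h A B (fun x => theta h ν (β x) * theta h ν' (β' x))
      (fun x => theta h ν (α x) * theta h ν' (α' x)) := by
  refine H.gauge (fun x => (qPoch (qp h (2 * ν)) (qp h (2 * ν)) ^ 3)⁻¹ *
      (qPoch (qp h (2 * ν')) (qp h (2 * ν')) ^ 3)⁻¹ *
      qp h ((α x ^ 2 / ν - α x) + (α' x ^ 2 / ν' - α' x)))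
    (by simp only [div_eq_mul_inv]; fun_prop) (fun x => ?_) fun x => ?_
  · have h1 : qp h (β x ^ 2 / ν - β x) * qp h (β' x ^ 2 / ν' - β' x) =
        qp h ((α x ^ 2 / ν - α x) + (α' x ^ 2 / ν' - α' x)) * qp h (e x) := by
      rw [← qp_add, ← qp_add, he]
    rw [theta_eq, theta_eq, hκ, hβ, hβ']
    linear_combination ((qPoch (qp h (2 * ν)) (qp h (2 * ν)) ^ 3)⁻¹ *
      (qPoch (qp h (2 * ν')) (qp h (2 * ν')) ^ 3)⁻¹ * bigTheta (qp h (2 * ν)) (qp h (2 * β x)) *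
      bigTheta (qp h (2 * ν')) (qp h (2 * β' x))) * h1
  · rw [theta_eq, theta_eq, hα, hα', qp_add]
    ring

section Currents

variable (hq : h.re < 0) (hr : 0 < r) (hrs : 0 < r - k)

include hq hr hrs

lemma HPlus_eq_vHp : HPlus h r k = vHp h r k := funext (HPlus_eq hq hr hrs)

lemma HMinus_eq_vHm : HMinus h r k = vHm h r k := funext (HMinus_eq hq hr hrs)

lemma ECur_eq_sub : ECur h r k = fun u => vE h r k 1 u - vE h r k (-1) u :=
  funext (ECur_eq hq hr hrs)

lemma FCur_eq_sub : FCur h r k = fun u => vFm h r k u - vFp h r k u :=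
  funext (FCur_eq hq hr hrs)

/-- The exchange relations of the currents follow from those of their vertex operators, which are
the same for all summands. -/
theorem isRealization_of_commEF
    (H : CommEF h k (HPlus h r k) (HMinus h r k) (ECur h r k) (FCur h r k) (zExp r k) (wExp r)) :
    IsRealization h r k (HPlus h r k) (HMinus h r k) (ECur h r k) (FCur h r k)
      (zExp r k) (wExp r) where
  HpHp := by
    rw [HPlus_eq_vHp hq hr hrs]
    exact exchange_Hp_Hp hq hr hrs
  HmHm := by
    rw [HMinus_eq_vHm hq hr hrs]
    exact exchange_Hm_Hm hq hr hrs
  HpHm := by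
    rw [HPlus_eq_vHp hq hr hrs, HMinus_eq_vHm hq hr hrs]
    exact exchange_Hp_Hm_quasiperiod hq hr hrs
  HpE := by
    rw [HPlus_eq_vHp hq hr hrs, ECur_eq_sub hq hr hrs]
    exact (exchange_Hp_E hq hr hrs 1).sub_right (exchange_Hp_E hq hr hrs (-1))
  HmE := by
    rw [HMinus_eq_vHm hq hr hrs, ECur_eq_sub hq hr hrs]
    exact (exchange_Hm_E hq hr hrs 1).sub_right (exchange_Hm_E hq hr hrs (-1))
  HpF := by
    rw [HPlus_eq_vHp hq hr hrs, FCur_eq_sub hq hr hrs]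
    exact (exchange_Hp_Fm hq hr hrs).sub_right (exchange_Hp_Fp hq hr hrs)
  HmF := by
    rw [HMinus_eq_vHm hq hr hrs, FCur_eq_sub hq hr hrs]
    exact (exchange_Hm_Fm hq hr hrs).sub_right (exchange_Hm_Fp hq hr hrs)
  EF := H
  EE := by
    rw [ECur_eq_sub hq hr hrs]
    have := exchange_E_E hq hr hrs
    exact ((this 1 1).sub_right (this 1 (-1))).sub_left ((this (-1) 1).sub_right (this (-1) (-1)))
  FF := by
    rw [FCur_eq_sub hq hr hrs]
    exact ((exchange_Fm_Fm hq hr hrs).sub_right (exchange_Fm_Fp hq hr hrs)).sub_left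
      ((exchange_Fp_Fm hq hr hrs).sub_right (exchange_Fp_Fp hq hr hrs))

/-- The Gaussian prefactors of `θ` account for the fractional powers of `z / w`. For `H^+` and `H^-`
the form without the quasi-periods `p` and `p^*` is the one that matches `θ`. -/
theorem thetaRelations_of_isRealization
    (H : IsRealization h r k (HPlus h r k) (HMinus h r k) (ECur h r k) (FCur h r k)
      (zExp r k) (wExp r)) :
    ThetaRelations h r k (HPlus h r k) (HMinus h r k) (ECur h r k) (FCur h r k)
      (zExp r k) (wExp r) := by
  have hr' : (r : ℂ) ≠ 0 := Complex.ofReal_ne_zero.mpr hr.ne'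
  have hrs' : (r : ℂ) - k ≠ 0 := by
    rw [← Complex.ofReal_sub]
    exact Complex.ofReal_ne_zero.mpr hrs.ne'
  refine ⟨?_, ?_, ?_, ?_, ?_, ?_, ?_, H.EF, ?_, ?_⟩
  · refine H.HpHp.two_thetas (fun x => rfl) (fun x => ?_) (fun x => ?_) (fun x => ?_)
      (fun x => ?_) (by fun_prop) (by fun_prop) fun x => ?_
    all_goals ring
  · refine H.HmHm.two_thetas (fun x => rfl) (fun x => ?_) (fun x => ?_) (fun x => ?_)
      (fun x => ?_) (by fun_prop) (by fun_prop) fun x => ?_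
    all_goals ring
  · rw [HPlus_eq_vHp hq hr hrs, HMinus_eq_vHm hq hr hrs]
    refine (exchange_Hp_Hm hq hr hrs).two_thetas (fun x => (qp_add h _ _).symm) (fun x => ?_)
      (fun x => ?_) (fun x => ?_) (fun x => ?_) (by fun_prop) (by fun_prop) fun x => ?_
    on_goal 5 => field_simp
    all_goals ring
  · refine H.HpE.one_theta (fun x => (qp_add h _ _).symm) (fun x => ?_) (fun x => ?_) (by fun_prop)
      fun x => ?_
    on_goal 3 => field_simp
    all_goals ring
  · refine H.HmE.one_theta (fun x => (qp_add h _ _).symm) (fun x => ?_) (fun x => ?_) (by fun_prop)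
      fun x => ?_
    on_goal 3 => field_simp
    all_goals ring
  · refine H.HpF.one_theta (fun x => (qp_add h _ _).symm) (fun x => ?_) (fun x => ?_) (by fun_prop)
      fun x => ?_
    all_goals ring
  · refine H.HmF.one_theta (fun x => (qp_add h _ _).symm) (fun x => ?_) (fun x => ?_) (by fun_prop)
      fun x => ?_
    all_goals ring
  · refine H.EE.one_theta (fun x => (qp_add h _ _).symm) (fun x => ?_) (fun x => ?_) (by fun_prop)
      fun x => ?_
    all_goals ring
  · refine H.FF.one_theta (fun x => (qp_add h _ _).symm) (fun x => ?_) (fun x => ?_) (by fun_prop)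
      fun x => ?_
    all_goals ring

end Currents

end

/-! ### Modes of vertex operators -/

/-- The coefficient of `z ^ α` in a vertex operator whose zero-mode factor is `C(p) z ^ e(p)`. -/
def modes (σ : Charge) (C e : Charge → ℂ) (g f : Mode → ℂ) : ℂ → Op State := fun α s t =>
  if s.1 = t.1 + σ ∧ α = e t.1 + level s.2 - level t.2 then C t.1 * matEl g f s.2 t.2 else 0

/-- Between two basis vectors a vertex operator is a single power of `z`, fixed by their levels and
by the zero modes. -/
lemma hasModes_vtx {h : ℂ} {σ : Charge} {χ : ℂ → Charge → ℂ} {e : Charge → ℂ} (g f : Mode → ℂ)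
    (hχ : ∀ u μ, χ u μ = χ 0 μ * qp h (2 * u * e μ)) :
    HasModes h (vtx h σ χ g f) (modes σ (χ 0) e g f) := by
  intro s t
  have hs : ∀ α, α ≠ e t.1 + level s.2 - level t.2 → modes σ (χ 0) e g f α s t = 0 := by
    intro α hα
    simp [modes, hα]
  refine ⟨(Set.finite_singleton (e t.1 + level s.2 - level t.2 : ℂ)).subset fun α hα => ?_,
    fun u => ?_⟩
  · by_contra hne
    exact hα (hs α hne)
  · rw [finsum_eq_single _ (e t.1 + level s.2 - level t.2 : ℂ) fun α hα => by
        rw [hs α hα, zero_mul],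
      vtx_apply]
    by_cases h1 : s.1 = t.1 + σ
    · have h2 : (2 * u * (e t.1 + level s.2 - level t.2) : ℂ) =
          2 * u * e t.1 + 2 * u * ((level s.2 : ℂ) - level t.2) := by ring
      simp only [modes, h1, true_and, if_true, hχ u, h2, qp_add]
      ring
    · simp [modes, h1]

lemma HasModes.sub {ι : Type} {h : ℂ} {A B M M' : ℂ → Op ι} (HA : HasModes h A M)
    (HB : HasModes h B M') : HasModes h (fun u => A u - B u) (fun α => M α - M' α) := by
  intro s t
  obtain ⟨f1, h1⟩ := HA s t
  obtain ⟨f2, h2⟩ := HB s t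
  refine ⟨(f1.union f2).subset (Function.support_sub (fun α => M α s t) fun α => M' α s t),
    fun u => ?_⟩
  have e : (fun α => (M α - M' α) s t * qp h (2 * u * α)) =
      fun α => M α s t * qp h (2 * u * α) - M' α s t * qp h (2 * u * α) :=
    funext fun α => sub_mul _ _ _
  rw [e, finsum_sub_distrib (f1.subset (Function.support_mul_subset_left _ _))
    (f2.subset (Function.support_mul_subset_left _ _)), ← h1, ← h2]
  rfl

/-- A finitely supported family and its sum. -/
def HasFinsum {ι : Type} (f : ι → ℂ) (a : ℂ) : Prop :=
  (Function.support f).Finite ∧ ∑ᶠ i, f i = a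

lemma HasFinsum.sub {ι : Type} {f g : ι → ℂ} {a b : ℂ} (hf : HasFinsum f a) (hg : HasFinsum g b) :
    HasFinsum (fun i => f i - g i) (a - b) :=
  ⟨(hf.1.union hg.1).subset (Function.support_sub f g), by
    rw [finsum_sub_distrib hf.1 hg.1, hf.2, hg.2]⟩

/-- The sum of `f` over the occupation numbers of level `ν`; it vanishes unless `ν ∈ ℕ`. -/
def levelSum (f : (Mode →₀ ℕ) → ℂ) (ν : ℂ) : ℂ := ∑ᶠ e, if (level e : ℂ) = ν then f e else 0

lemma finite_support_level (f : (Mode →₀ ℕ) → ℂ) (ν : ℂ) :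
    (Function.support fun e => if (level e : ℂ) = ν then f e else 0).Finite := by
  by_cases hν : ∃ n : ℕ, (n : ℂ) = ν
  · obtain ⟨n, rfl⟩ := hν
    refine (finite_level_eq n).subset fun e he => ?_
    by_contra hne
    exact he (if_neg fun h' => hne (Nat.cast_injective h'))
  · refine Set.finite_empty.subset fun e he => ?_
    exact he (if_neg fun h' => hν ⟨_, h'⟩)

lemma levelSum_eq_zero (f : (Mode →₀ ℕ) → ℂ) {ν : ℂ} (hν : ∀ n : ℕ, (n : ℂ) ≠ ν) :
    levelSum f ν = 0 := by
  simp [levelSum, hν]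

/-- The modes of a product of two vertex operators are sums over the intermediate states of one
level. -/
lemma hasFinsum_modes_mul (σA σB : Charge) (CA CB eA eB : Charge → ℂ) (gA fA gB fB : Mode → ℂ)
    (α β : ℂ) (s t : State) :
    HasFinsum (fun m => modes σA CA eA gA fA α s m * modes σB CB eB gB fB β m t)
      (if s.1 = t.1 + (σA + σB) ∧ α + β = eA (t.1 + σB) + eB t.1 + level s.2 - level t.2 then
        CA (t.1 + σB) * CB t.1 * levelSum (fun e => matEl gA fA s.2 e * matEl gB fB e t.2)
          (β - eB t.1 + level t.2) else 0) := by
  set ν : ℂ := β - eB t.1 + level t.2 with hν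
  set K : (Mode →₀ ℕ) → ℂ := fun e => matEl gA fA s.2 e * matEl gB fB e t.2 with hK
  have hinj : Function.Injective (fun e : Mode →₀ ℕ => ((t.1 + σB, e) : State)) :=
    Prod.mk_right_injective _
  set c : ℂ := if s.1 = t.1 + (σA + σB) ∧
    α + β = eA (t.1 + σB) + eB t.1 + level s.2 - level t.2 then
      CA (t.1 + σB) * CB t.1 else 0 with hc
  have hval : ∀ e, modes σA CA eA gA fA α s (t.1 + σB, e) * modes σB CB eB gB fB β (t.1 + σB, e) t =
      c * (if (level e : ℂ) = ν then K e else 0) := by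
    intro e
    have h1 : (s.1 = t.1 + σB + σA) ↔ s.1 = t.1 + (σA + σB) := by rw [add_comm σA, add_assoc]
    have h2 : (β = eB t.1 + level e - level t.2) ↔ (level e : ℂ) = ν := by
      rw [hν]
      constructor <;> intro h'
      · rw [h']
        ring
      · rw [h']
        ring
    simp only [modes, true_and, h1, h2, hc]
    by_cases h3 : (level e : ℂ) = ν
    · have h4 : (α = eA (t.1 + σB) + level s.2 - ν) ↔
          α + β = eA (t.1 + σB) + eB t.1 + level s.2 - level t.2 := by
        rw [hν]
        constructor <;> intro h'
        · linear_combination h'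
        · linear_combination h'
      simp only [h3, h4, if_true]
      split_ifs
      · rw [hK]
        ring
      · ring
    · simp [h3]
  have hsupp : Function.support
      (fun m => modes σA CA eA gA fA α s m * modes σB CB eB gB fB β m t) ⊆
      (fun e => (t.1 + σB, e)) ''
        (Function.support fun e => if (level e : ℂ) = ν then K e else 0) := by
    rintro ⟨μ, e⟩ hm
    have hμ : μ = t.1 + σB := by
      by_contra hne
      exact hm (by simp [modes, hne])
    subst hμ
    refine ⟨e, fun h0 => hm ?_, rfl⟩
    have := hval e
    simp only at h0 this ⊢
    rw [this, h0, mul_zero]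
  have hfin := ((finite_support_level K ν).image fun e => ((t.1 + σB, e) : State)).subset hsupp
  refine ⟨hfin, ?_⟩
  have hsub : Function.support
      (fun m => modes σA CA eA gA fA α s m * modes σB CB eB gB fB β m t) ⊆
      Set.range fun e : Mode →₀ ℕ => ((t.1 + σB, e) : State) :=
    hsupp.trans (Set.image_subset_range _ _)
  have h1 : ∑' m, modes σA CA eA gA fA α s m * modes σB CB eB gB fB β m t =
      ∑ᶠ m, modes σA CA eA gA fA α s m * modes σB CB eB gB fB β m t := tsum_eq_finsum hfin
  have h2 : ∑' e, (if (level e : ℂ) = ν then K e else 0) = levelSum K ν :=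
    tsum_eq_finsum (finite_support_level K ν)
  rw [← h1, ← hinj.tsum_eq hsub, tsum_congr hval, tsum_mul_left, h2, hc]
  simp only [ite_mul, zero_mul]

/-! ### Sums over levels as power series coefficients -/

lemma hasSum_levelSum {f : (Mode →₀ ℕ) → ℂ} {x S : ℂ} (H : HasSum (fun e => f e * x ^ level e) S) :
    HasSum (fun n : ℕ => levelSum f (n : ℂ) * x ^ n) S := by
  refine hasSum_of_eq (H.tsum_fiberwise level) (fun n => ?_) rfl
  have h1 : levelSum f (n : ℂ) = ∑' e, if (level e : ℂ) = n then f e else 0 :=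
    (tsum_eq_finsum (finite_support_level f n)).symm
  rw [h1, ← tsum_mul_right, tsum_subtype (level ⁻¹' {n}) fun e => f e * x ^ level e]
  refine tsum_congr fun e => ?_
  by_cases he : level e = n
  · simp [he]
  · simp [he]

/-- A power series that vanishes on a punctured neighbourhood of `0` has zero coefficients. -/
lemma eq_zero_of_hasSum_zero {u : ℕ → ℂ} (H : ∀ᶠ x in 𝓝[≠] (0 : ℂ), HasSum (fun n => u n * x ^ n) 0)
    (n : ℕ) : u n = 0 := by
  set p : FormalMultilinearSeries ℂ ℂ ℂ := FormalMultilinearSeries.ofScalars ℂ u with hp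
  set F : ℂ → ℂ := fun x => ∑' n, u n * x ^ n with hF
  have h0 : ∀ᶠ x in 𝓝[≠] (0 : ℂ), F x = 0 := H.mono fun x hx => hx.tsum_eq
  have h1 : ∀ᶠ x in 𝓝 (0 : ℂ), HasSum (fun n => u n * x ^ n) (F x) := by
    rw [eventually_nhdsWithin_iff] at H
    filter_upwards [H] with x hx
    by_cases hx0 : x = 0
    · subst hx0
      exact (summable_of_ne_finset_zero (s := {0}) fun n hn => by
        simp at hn
        simp [hn]).hasSum
    · exact (hx hx0).summable.hasSum
  have h2 : HasFPowerSeriesAt F p 0 := by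
    rw [hasFPowerSeriesAt_iff]
    filter_upwards [h1] with x hx
    simpa [hp, mul_comm] using hx
  have h3 : ∀ᶠ x in 𝓝 (0 : ℂ), F x = 0 := by
    rcases h2.analyticAt.eventually_eq_zero_or_eventually_ne_zero with h' | h'
    · exact h'
    · obtain ⟨x, hx, hx'⟩ := (h0.and h').exists
      exact absurd hx hx'
  have h4 := h2.locally_zero_iff.mp h3
  have h5 : p.coeff n = 0 := by
    rw [h4]
    rfl
  simpa [hp] using h5

lemma hasSum_shift {A : ℤ → ℂ} {x S : ℂ} (h0 : A (-1) = 0)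
    (H : HasSum (fun n : ℕ => A n * x ^ n) S) :
    HasSum (fun n : ℕ => A (n - 1) * x ^ n) (x * S) := by
  rw [← hasSum_nat_add_iff' 1]
  refine hasSum_of_eq (H.mul_left x) (fun n => ?_) ?_
  · push_cast
    rw [add_sub_cancel_right]
    ring
  · simp [h0]

/-- A power series with coefficients `A` that equals `(1 - d x) / (1 - c x)` times one with
coefficients `p`. -/
lemma recursion_of_hasSum {A p : ℤ → ℂ} (hA : ∀ N < 0, A N = 0) (hp : ∀ N < 0, p N = 0) {c d : ℂ}
    (H : ∀ᶠ x in 𝓝[≠] (0 : ℂ), ∃ S S', HasSum (fun n : ℕ => A n * x ^ n) S ∧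
      HasSum (fun n : ℕ => p n * x ^ n) S' ∧ S * (1 - c * x) = (1 - d * x) * S') (N : ℤ) :
    A N - c * A (N - 1) = p N - d * p (N - 1) := by
  rcases lt_or_ge N 0 with hN | hN
  · rw [hA N hN, hA _ (by omega), hp N hN, hp _ (by omega)]
    ring
  · lift N to ℕ using hN
    have := eq_zero_of_hasSum_zero
      (u := fun n : ℕ => (A n - c * A (n - 1)) - (p n - d * p (n - 1))) (H.mono ?_) N
    · exact sub_eq_zero.mp this
    · rintro x ⟨S, S', hS, hS', hE⟩
      have h1 := hasSum_shift (hA (-1) (by omega)) hS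
      have h2 := hasSum_shift (hp (-1) (by omega)) hS'
      refine hasSum_of_eq ((hS.sub (h1.mul_left c)).sub (hS'.sub (h2.mul_left d))) (fun n => ?_) ?_
      · ring
      · linear_combination -hE

/-- The two orderings of a pair of vertex operators with a simple pole differ by a multiple of a
geometric sequence, that is, of a delta function. -/
lemma commutator_of_recursion {A B p : ℤ → ℂ} {Q c : ℂ} (hQ : Q ≠ 0) (hc : c ≠ 0) (L : ℕ)
    (hA : ∀ N < 0, A N = 0) (hB : ∀ N < 0, B N = 0) (hp : ∀ N < 0, p N = 0)
    (hpL : ∀ N > (L : ℤ), p N = 0)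
    (rA : ∀ N, A N - c * A (N - 1) = p N - Q ^ 2 * c * p (N - 1))
    (rB : ∀ N, B N - c⁻¹ * B (N - 1) = p (L - N) - (Q ^ 2)⁻¹ * c⁻¹ * p (L - (N - 1))) (N : ℤ) :
    Q⁻¹ * A N - Q * B (L - N) =
      (Q⁻¹ - Q) * (c ^ N * ∑ j ∈ Finset.range (L + 1), p j * c⁻¹ ^ j) := by
  have step : ∀ N : ℤ, Q⁻¹ * A N - Q * B (L - N) =
      c * (Q⁻¹ * A (N - 1) - Q * B (L - (N - 1))) := by
    intro N
    have h1 := rA N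
    have h2 := rB (L - (N - 1))
    rw [show (L : ℤ) - (N - 1) - 1 = L - N by ring, show (L : ℤ) - (L - (N - 1)) = N - 1 by ring,
      show (L : ℤ) - (L - N) = N by ring] at h2
    have h3 : c * B (L - (N - 1)) - B (L - N) = c * p (N - 1) - (Q ^ 2)⁻¹ * p N := by
      field_simp at h2 ⊢
      linear_combination h2
    have h4 : Q * ((Q ^ 2)⁻¹ * p N) = Q⁻¹ * p N := by
      field_simp
    have h5 : Q⁻¹ * (Q ^ 2 * c * p (N - 1)) = Q * (c * p (N - 1)) := by
      field_simp
    linear_combination Q⁻¹ * h1 + Q * h3 - h4 - h5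
  have geom : ∀ N : ℤ, Q⁻¹ * A N - Q * B (L - N) = c ^ N * (Q⁻¹ * A 0 - Q * B L) := by
    intro N
    induction N using Int.induction_on with
    | zero => simp
    | succ n ih =>
      rw [step, add_sub_cancel_right, ih, zpow_add_one₀ hc]
      ring
    | pred n ih =>
      have h1 := step (-n)
      rw [ih] at h1
      rw [zpow_sub_one₀ hc, mul_right_comm, h1]
      field_simp
  have closed : ∀ n : ℕ, A n = Q ^ 2 * p n +
      (1 - Q ^ 2) * (c ^ n * ∑ j ∈ Finset.range (n + 1), p j * c⁻¹ ^ j) := by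
    intro n
    induction n with
    | zero =>
      have := rA 0
      rw [hA (0 - 1) (by omega), hp (0 - 1) (by omega)] at this
      simp only [Nat.cast_zero, zero_add, Finset.sum_range_one, pow_zero]
      linear_combination this
    | succ n ih =>
      have h1 := rA (n + 1)
      rw [add_sub_cancel_right, ih] at h1
      rw [Finset.sum_range_succ]
      push_cast
      have h2 : c ^ (n + 1) * c⁻¹ ^ (n + 1) = 1 := by rw [← mul_pow, mul_inv_cancel₀ hc, one_pow]
      linear_combination h1 + (Q ^ 2 - 1) * p (n + 1) * h2
  have h0 : B 0 = p L := by
    have := rB 0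
    rwa [hB (0 - 1) (by omega), hpL (L - (0 - 1)) (by omega), sub_zero, mul_zero, sub_zero,
      mul_zero,
      sub_zero] at this
  have h1 := geom L
  rw [sub_self, h0, closed L, zpow_natCast] at h1
  have hcL : c ^ L ≠ 0 := pow_ne_zero _ hc
  have h2 : Q⁻¹ * Q ^ 2 = Q := by field_simp
  have h3 : Q⁻¹ * A 0 - Q * B L = (Q⁻¹ - Q) * ∑ j ∈ Finset.range (L + 1), p j * c⁻¹ ^ j := by
    refine mul_left_cancel₀ hcL ?_
    rw [← h1]
    linear_combination (p L - c ^ L * ∑ j ∈ Finset.range (L + 1), p j * c⁻¹ ^ j) * h2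
  rw [geom, h3]
  ring

/-! ### Matrix elements as polynomials in the ratio of the arguments -/

open Polynomial in
lemma eval_divPow (x : ℂ) (y : Mode → ℂ[X]) (e : Mode →₀ ℕ) :
    (divPow y e).eval x = divPow (fun i => (y i).eval x) e := by
  simp only [divPow, Finsupp.prod, eval_prod, eval_smul, eval_pow]

open Polynomial in
lemma natDegree_divPow_le {y : Mode → ℂ[X]} (hy : ∀ i, (y i).natDegree ≤ (i.2 : ℕ))
    (e : Mode →₀ ℕ) : (divPow y e).natDegree ≤ level e := by
  refine (natDegree_prod_le _ _).trans (Finset.sum_le_sum fun i _ => ?_)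
  exact (natDegree_smul_le _ _).trans (natDegree_pow_le.trans (Nat.mul_le_mul_left _ (hy i)))

open Polynomial in
/-- The matrix element of a normal-ordered product of vertex operators, as a function of the ratio
`x` of their arguments, is a polynomial up to the factor `x ^ (-level t)`. -/
lemma exists_polynomial_matEl (gA gB fA fB : Mode → ℂ) (s t : Mode →₀ ℕ) :
    ∃ P : ℂ[X], P.natDegree ≤ level s + level t ∧ ∀ x ≠ 0, P.eval x = x ^ level t *
      matEl (fun i => gA i + gB i * x ^ (i.2 : ℕ))
        (fun i => fA i + fB i * x⁻¹ ^ (i.2 : ℕ)) s t := by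
  refine ⟨∑ p ∈ Finset.HasAntidiagonal.antidiagonal s,
    divPow (fun i => C (gA i) + C (gB i) * X ^ (i.2 : ℕ)) p.1 *
    (if p.2 ≤ t then C (occFact t * (occFact p.2)⁻¹) *
      divPow (fun i => C (fA i) * X ^ (i.2 : ℕ) + C (fB i)) (t - p.2) * X ^ level p.2 else 0),
    natDegree_sum_le_of_forall_le _ _ fun p hp => ?_, fun x hx => ?_⟩
  · rw [Finset.HasAntidiagonal.mem_antidiagonal] at hp
    have h1 : (divPow (fun i : Mode => C (gA i) + C (gB i) * X ^ (i.2 : ℕ)) p.1).natDegree ≤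
        level p.1 := natDegree_divPow_le (fun i => by compute_degree) _
    have h2 : (divPow (fun i : Mode => C (fA i) * X ^ (i.2 : ℕ) + C (fB i)) (t - p.2)).natDegree ≤
        level (t - p.2) := natDegree_divPow_le (fun i => by compute_degree) _
    have h3 : level s = level p.1 + level p.2 := by rw [← hp, level_add]
    split_ifs with hle
    · have h4 : level t = level (t - p.2) + level p.2 := by
        rw [← level_add, tsub_add_cancel_of_le hle]
      refine natDegree_mul_le.trans ?_
      have h5 := natDegree_mul_le (p := C (occFact t * (occFact p.2)⁻¹) *
        divPow (fun i : Mode => C (fA i) * X ^ (i.2 : ℕ) + C (fB i)) (t - p.2))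
        (q := (X : ℂ[X]) ^ level p.2)
      have h6 := natDegree_C_mul_le (occFact t * (occFact p.2)⁻¹)
        (divPow (fun i : Mode => C (fA i) * X ^ (i.2 : ℕ) + C (fB i)) (t - p.2))
      rw [natDegree_X_pow] at h5
      omega
    · simp
  · rw [eval_finsetSum, matEl_eq_sum, Finset.mul_sum]
    refine Finset.sum_congr rfl fun p _ => ?_
    rw [eval_mul, eval_divPow]
    split_ifs with hle
    · have h4 : level t = level (t - p.2) + level p.2 := by
        rw [← level_add, tsub_add_cancel_of_le hle]
      have h5 : divPow (fun i : Mode => fA i * x ^ (i.2 : ℕ) + fB i) (t - p.2) =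
          divPow (fun i => fA i + fB i * x⁻¹ ^ (i.2 : ℕ)) (t - p.2) * x ^ level (t - p.2) := by
        rw [← divPow_scale]
        congr 1
        funext i
        rw [inv_pow]
        field_simp
      simp only [eval_mul, eval_divPow, eval_add, eval_C, eval_pow, eval_X, h5]
      rw [h4, pow_add]
      ring
    · simp

/-- The coefficients of the two products of vertex operators with linear contractions, in terms of
the polynomial matrix element of the normal-ordered product. -/
lemma exists_levelSum_recursion {gA fA gB fB : Mode → ℂ} {c d c' d' : ℂ}
    (hAB : Contraction fA gB (fun x => 1 - d * x) (fun x => 1 - c * x))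
    (hBA : Contraction fB gA (fun x => 1 - d' * x) (fun x => 1 - c' * x)) (s t : Mode →₀ ℕ) :
    ∃ p : ℤ → ℂ, (∀ N < 0, p N = 0) ∧ (∀ N > ((level s + level t : ℕ) : ℤ), p N = 0) ∧
      (∀ x ≠ 0, ∑ j ∈ Finset.range (level s + level t + 1), p j * x ^ j = x ^ level t *
        matEl (fun i => gA i + gB i * x ^ (i.2 : ℕ)) (fun i => fA i + fB i * x⁻¹ ^ (i.2 : ℕ)) s t) ∧
      (∀ N : ℤ, levelSum (fun e => matEl gA fA s e * matEl gB fB e t) N -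
          c * levelSum (fun e => matEl gA fA s e * matEl gB fB e t) ((N - 1 : ℤ) : ℂ) =
        p N - d * p (N - 1)) ∧
      ∀ N : ℤ, levelSum (fun e => matEl gB fB s e * matEl gA fA e t) N -
          c' * levelSum (fun e => matEl gB fB s e * matEl gA fA e t) ((N - 1 : ℤ) : ℂ) =
        p ((level s + level t : ℕ) - N) - d' * p ((level s + level t : ℕ) - (N - 1)) := by
  obtain ⟨P, hP, hPx⟩ := exists_polynomial_matEl gA gB fA fB s t
  set L := level s + level t with hL
  set p : ℤ → ℂ := fun N => if 0 ≤ N then P.coeff N.toNat else 0 with hpdef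
  have hp : ∀ N < 0, p N = 0 := fun N hN => if_neg (by omega)
  have hpn : ∀ n : ℕ, p n = P.coeff n := fun n => by simp [hpdef]
  have hpL : ∀ N > (L : ℤ), p N = 0 := fun N hN => by
    rw [hpdef]
    simp only
    rw [if_pos (by omega), Polynomial.coeff_eq_zero_of_natDegree_lt (by omega)]
  have hsum : ∀ x, ∑ j ∈ Finset.range (L + 1), p j * x ^ j = P.eval x := fun x => by
    rw [Polynomial.eval_eq_sum_range' (n := L + 1) (by omega)]
    exact Finset.sum_congr rfl fun j _ => by rw [hpn]
  have hneg : ∀ (f : (Mode →₀ ℕ) → ℂ) (N : ℤ), N < 0 → levelSum f (N : ℂ) = 0 := fun f N hN =>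
    levelSum_eq_zero f fun n hn => by
      have : (n : ℤ) = N := by exact_mod_cast hn
      omega
  -- the generating function of either product is the exponential of the contraction times the
  -- matrix element of the normal-ordered product
  have gen : ∀ (g f g' f' : Mode → ℂ) (x ℓ : ℂ), x ≠ 0 →
      HasSum (fun i : Mode => f i * g' i * x ^ (i.2 : ℕ)) ℓ →
      HasSum (fun n : ℕ => levelSum (fun e => matEl g f s e * matEl g' f' e t) ((n : ℤ) : ℂ) *
        x ^ n)
        (Complex.exp ℓ * (x ^ level t * matEl (fun i => g i + g' i * x ^ (i.2 : ℕ))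
          (fun i => f i + f' i * x⁻¹ ^ (i.2 : ℕ)) s t)) := by
    intro g f g' f' x ℓ hx hℓ
    have h1 := (hasSum_matEl_mul_matEl (x := g) (c' := fun i => f' i * x⁻¹ ^ (i.2 : ℕ))
      (hasSum_of_eq hℓ (g := fun i => f i * (g' i * x ^ (i.2 : ℕ))) (fun i => by ring) rfl)
      s t).mul_right (x ^ level t)
    have h2 : HasSum (fun e => matEl g f s e * matEl g' f' e t * x ^ level e)
        (Complex.exp ℓ * (x ^ level t * matEl (fun i => g i + g' i * x ^ (i.2 : ℕ))
          (fun i => f i + f' i * x⁻¹ ^ (i.2 : ℕ)) s t)) := by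
      refine hasSum_of_eq h1 (fun e => ?_) ?_
      · rw [mul_assoc, mul_assoc, ← matEl_scale g' f' hx]
      · rw [mul_comm (x ^ level t), mul_assoc]
        rfl
    simpa only [Int.cast_natCast] using hasSum_levelSum h2
  refine ⟨p, hp, hpL, fun x hx => by rw [hsum, hPx x hx], ?_, ?_⟩
  · refine recursion_of_hasSum
      (A := fun N : ℤ => levelSum (fun e => matEl gA fA s e * matEl gB fB e t) (N : ℂ))
      (hneg _) hp ?_
    filter_upwards [eventually_nhdsWithin_of_eventually_nhds hAB, self_mem_nhdsWithin]
      with x ⟨ℓ, hℓ, hE⟩ hx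
    refine ⟨_, _, gen gA fA gB fB x ℓ hx hℓ, hasSum_sum_of_ne_finset_zero
      (s := Finset.range (L + 1)) fun n hn => ?_, ?_⟩
    · rw [hpL _ (by simp at hn; omega), zero_mul]
    · rw [hsum, hPx x hx, ← hE]
      ring
  · have := recursion_of_hasSum
      (A := fun N : ℤ => levelSum (fun e => matEl gB fB s e * matEl gA fA e t) (N : ℂ))
      (p := fun N => p (L - N)) (c := c') (d := d')
      (hneg _) (fun N hN => hpL _ (by omega)) ?_
    · exact this
    filter_upwards [eventually_nhdsWithin_of_eventually_nhds hBA, self_mem_nhdsWithin]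
      with y ⟨ℓ, hℓ, hE⟩ hy
    refine ⟨_, _, gen gB fB gA fA y ℓ hy hℓ, hasSum_sum_of_ne_finset_zero
      (s := Finset.range (L + 1)) fun n hn => ?_, ?_⟩
    · rw [hp _ (by simp at hn; omega), zero_mul]
    · have h1 : ∑ n ∈ Finset.range (L + 1), p (L - n) * y ^ n = y ^ L * P.eval y⁻¹ := by
        rw [← hsum, Finset.mul_sum, ← Finset.sum_range_reflect]
        refine Finset.sum_congr rfl fun j hj => ?_
        have hj' : j ≤ L := by simp at hj; omega
        rw [show L + 1 - 1 - j = L - j by omega, Nat.cast_sub hj', sub_sub_cancel,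
          show y ^ L = y ^ (L - j) * y ^ j by rw [← pow_add, Nat.sub_add_cancel hj'], inv_pow]
        have := pow_ne_zero j hy
        field_simp
      have hyi : (y⁻¹ : ℂ) ≠ 0 := inv_ne_zero hy
      have h2 := matEl_scale (fun i => gA i + gB i * y⁻¹ ^ (i.2 : ℕ))
        (fun i => fA i + fB i * y⁻¹⁻¹ ^ (i.2 : ℕ)) hy s t
      have h3 : (fun i : Mode => (gA i + gB i * y⁻¹ ^ (i.2 : ℕ)) * y ^ (i.2 : ℕ)) =
          fun i => gB i + gA i * y ^ (i.2 : ℕ) := by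
        funext i
        have := pow_ne_zero (i.2 : ℕ) hy
        rw [inv_pow]
        field_simp
        ring
      have h4 : (fun i : Mode => (fA i + fB i * y⁻¹⁻¹ ^ (i.2 : ℕ)) * y⁻¹ ^ (i.2 : ℕ)) =
          fun i => fB i + fA i * y⁻¹ ^ (i.2 : ℕ) := by
        funext i
        have := pow_ne_zero (i.2 : ℕ) hy
        rw [inv_inv, inv_pow]
        field_simp
        ring
      rw [h3, h4] at h2
      rw [h1, hPx _ hyi, ← hE, mul_comm (y ^ level t), h2, hL, pow_add, inv_pow]
      have := pow_ne_zero (level t) hy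
      field_simp

/-- Linear contractions with inverse poles: the two orderings, weighted by the factors `Q⁻¹` and `Q`
from the zero modes, differ by a delta function times the normal-ordered product at the pole `x =
c⁻¹`. In the second ordering the intermediate level is `level s + level t - N`. -/
lemma levelSum_commutator {gA fA gB fB : Mode → ℂ} {Q c : ℂ} (hQ : Q ≠ 0) (hc : c ≠ 0)
    (hAB : Contraction fA gB (fun x => 1 - Q ^ 2 * c * x) (fun x => 1 - c * x))
    (hBA : Contraction fB gA (fun x => 1 - (Q ^ 2)⁻¹ * c⁻¹ * x) (fun x => 1 - c⁻¹ * x))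
    (s t : Mode →₀ ℕ) (N : ℤ) :
    Q⁻¹ * levelSum (fun e => matEl gA fA s e * matEl gB fB e t) N -
        Q * levelSum (fun e => matEl gB fB s e * matEl gA fA e t) (level s + level t - N) =
      (Q⁻¹ - Q) * (c ^ N * (c⁻¹ ^ level t * matEl (fun i => gA i + gB i * c⁻¹ ^ (i.2 : ℕ))
        (fun i => fA i + fB i * c ^ (i.2 : ℕ)) s t)) := by
  obtain ⟨p, hp, hpL, hsum, rA, rB⟩ := exists_levelSum_recursion hAB hBA s t
  have hneg : ∀ (f : (Mode →₀ ℕ) → ℂ) (N : ℤ), N < 0 → levelSum f (N : ℂ) = 0 := fun f N hN =>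
    levelSum_eq_zero f fun n hn => by
      have : (n : ℤ) = N := by exact_mod_cast hn
      omega
  have := commutator_of_recursion hQ hc (level s + level t)
    (A := fun N : ℤ => levelSum (fun e => matEl gA fA s e * matEl gB fB e t) (N : ℂ))
    (B := fun N : ℤ => levelSum (fun e => matEl gB fB s e * matEl gA fA e t) (N : ℂ))
    (hneg _) (hneg _) hp hpL rA rB N
  rw [hsum _ (inv_ne_zero hc)] at this
  simpa using this

/-- Vertex operators without contractions commute, mode by mode. -/
lemma levelSum_comm_of_no_contraction {gA fA gB fB : Mode → ℂ}
    (hAB : Contraction fA gB (fun _ => 1) (fun _ => 1))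
    (hBA : Contraction fB gA (fun _ => 1) (fun _ => 1)) (s t : Mode →₀ ℕ) (N : ℤ) :
    levelSum (fun e => matEl gA fA s e * matEl gB fB e t) N =
      levelSum (fun e => matEl gB fB s e * matEl gA fA e t) (level s + level t - N) := by
  obtain ⟨p, -, -, -, rA, rB⟩ := exists_levelSum_recursion (c := 0) (d := 0) (c' := 0) (d' := 0)
    (by simpa using hAB) (by simpa using hBA) s t
  have h1 := rA N
  have h2 := rB ((level s + level t : ℕ) - N)
  simp only [zero_mul, sub_zero, sub_sub_cancel] at h1 h2
  rw [h1, ← h2]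
  push_cast
  rfl

/-! ### The commutator of `E` and `F` -/

section

variable {h : ℂ} {r k : ℝ}

/-- The power of `z` in the zero-mode factor of `H^±`. -/
def expH (r k : ℝ) (μ : Charge) : ℂ := pDiag μ / r + (pHat μ / r - pHat μ / (r - k))

/-- The power of `z` in the zero-mode factor of `E`. -/
def expE (r k : ℝ) (μ : Charge) : ℂ := -(pEig μ .b + pEig μ .c + 1) - pHat μ / (r - k)

/-- The power of `z` in the zero-mode factor of `F`. -/
def expF (r : ℝ) (μ : Charge) : ℂ := pEig μ .b + pEig μ .c - 1 + pDiag μ / r + pHat μ / r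

lemma zmHp_eq (u : ℂ) (μ : Charge) :
    zmHp h r k u μ = zmHp h r k 0 μ * qp h (2 * u * expH r k μ) := by
  rw [zmHp, zmHp, ← qp_add, expH]
  congr 1
  ring

lemma zmHm_eq (u : ℂ) (μ : Charge) :
    zmHm h r k u μ = zmHm h r k 0 μ * qp h (2 * u * expH r k μ) := by
  rw [zmHm, zmHm, ← qp_add, expH]
  congr 1
  ring

lemma zmE_eq (ε u : ℂ) (μ : Charge) :
    zmE h r k ε u μ = zmE h r k ε 0 μ * qp h (2 * u * expE r k μ) := by
  rw [zmE, zmE, mul_assoc (-(qp h 1 - qp h (-1))⁻¹), ← qp_add, expE]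
  congr 2
  ring

lemma zmF_eq (ε u : ℂ) (μ : Charge) :
    zmF h r k ε u μ = zmF h r k ε 0 μ * qp h (2 * u * expF r μ) := by
  rw [zmF, zmF, mul_assoc (-(qp h 1 - qp h (-1))⁻¹), ← qp_add, expF]
  congr 2
  ring

lemma expE_add_chF (μ : Charge) : expE r k (μ + chF) = expE r k μ := by
  rw [expE, expE, pHat_add_chF]
  simp only [pEig, chF, Pi.add_apply]
  ring

lemma expF_add_chE (μ : Charge) : expF r (μ + chE) = expF r μ := by
  rw [expF, expF, pHat_add_chE, pDiag_add_chE]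
  simp only [pEig, chE, Pi.add_apply]
  ring

lemma expE_add_expF (μ : Charge) : expE r k μ + expF r μ = expH r k μ - 2 := by
  rw [expE, expF, expH]
  ring

lemma chE_add_chF : chE + chF = chH := by
  funext i
  cases i <;> simp [chE, chF, chH]

lemma chF_add_chE : chF + chE = chH := by rw [add_comm, chE_add_chF]

section

variable (hq : h.re < 0) (hr : 0 < r) (hrs : 0 < r - k)

include hq hr hrs

/-- At the pole `w = q ^ (-k) z` of the product of `E` and `F` the creation parts merge into that of
`H^+` at `q ^ (-k/2) z`. -/
lemma crE_add_crFp (i : Mode) :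
    crE h r k 1 i + crFp h k i * qp h (-k) ^ (i.2 : ℕ) =
      crHp h r k i * qp h (-(k / 2)) ^ (i.2 : ℕ) := by
  obtain ⟨B, n⟩ := i
  obtain ⟨q, Q, W, R, Z, e, _, _, _, _, _, _, _, _, _, _, _, _, _, hE⟩ :=
    exists_monomials hq hr hrs n 0 0
  cases B <;>
  · simp only [crE, crFp, crHp, byBoson, qnum, Pi.zero_apply, qp_pow]
    simp only [mul_add, mul_sub, add_mul, sub_mul, mul_neg, neg_mul, neg_add, neg_sub, neg_neg,
      qp_add, qp_sub, qp_neg, mul_one, one_mul, mul_zero, zero_mul, add_zero, zero_add, qp_zero,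
      mul_left_comm _ (2 : ℂ), hE]
    field_simp
    try ring

/-- The annihilation parts merge into that of `H^+` at the same pole. -/
lemma anE_add_anFp (i : Mode) : anE h 1 i + anFp h r k i * (qp h (-k))⁻¹ ^ (i.2 : ℕ) =
    anHp h r k i * (qp h (-(k / 2)))⁻¹ ^ (i.2 : ℕ) := by
  obtain ⟨B, n⟩ := i
  obtain ⟨q, Q, W, R, Z, e, _, _, _, _, _, _, _, _, _, _, _, _, _, hE⟩ :=
    exists_monomials hq hr hrs n 0 0
  rw [← qp_neg, ← qp_neg]
  cases B <;>
  · simp only [anE, anFp, anHp, byBoson, qnum, Pi.zero_apply, qp_pow]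
    simp only [mul_add, mul_sub, add_mul, sub_mul, mul_neg, neg_mul, neg_add, neg_sub, neg_neg,
      qp_add, qp_sub, qp_neg, mul_one, one_mul, mul_zero, zero_mul, add_zero, zero_add, qp_zero,
      mul_left_comm _ (2 : ℂ), hE]
    field_simp
    try ring

/-- At the pole `w = q ^ k z` the creation parts merge into that of `H^-` at `q ^ (k/2) z`. -/
lemma crE_add_crFm (i : Mode) :
    crE h r k (-1) i + crFm h k i * qp h k ^ (i.2 : ℕ) =
      crHm h r k i * qp h (k / 2) ^ (i.2 : ℕ) := by
  obtain ⟨B, n⟩ := i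
  obtain ⟨q, Q, W, R, Z, e, _, _, _, _, _, _, _, _, _, _, _, _, _, hE⟩ :=
    exists_monomials hq hr hrs n 0 0
  cases B <;>
  · simp only [crE, crFm, crHm, byBoson, qnum, Pi.zero_apply, qp_pow]
    simp only [mul_add, mul_sub, add_mul, sub_mul, mul_neg, neg_mul, neg_add, neg_sub, neg_neg,
      qp_add, qp_sub, qp_neg, mul_one, one_mul, mul_zero, zero_mul, add_zero, zero_add, qp_zero,
      mul_left_comm _ (2 : ℂ), hE]
    field_simp
    try ring

/-- The annihilation parts merge into that of `H^-` at the same pole. -/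
lemma anE_add_anFm (i : Mode) : anE h (-1) i + anFm h r k i * (qp h k)⁻¹ ^ (i.2 : ℕ) =
    anHm h r k i * (qp h (k / 2))⁻¹ ^ (i.2 : ℕ) := by
  obtain ⟨B, n⟩ := i
  obtain ⟨q, Q, W, R, Z, e, _, _, _, _, _, _, _, _, _, _, _, _, _, hE⟩ :=
    exists_monomials hq hr hrs n 0 0
  rw [← qp_neg, ← qp_neg]
  cases B <;>
  · simp only [anE, anFm, anHm, byBoson, qnum, Pi.zero_apply, qp_pow]
    simp only [mul_add, mul_sub, add_mul, sub_mul, mul_neg, neg_mul, neg_add, neg_sub, neg_neg,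
      qp_add, qp_sub, qp_neg, mul_one, one_mul, mul_zero, zero_mul, add_zero, zero_add, qp_zero,
      mul_left_comm _ (2 : ℂ), hE]
    field_simp
    try ring

/-- The delta function with residue `H^+`; the powers of `q` evaluate the homogeneous matrix
elements at the pole. -/
lemma levelSum_commutator_plus (s t : Mode →₀ ℕ) (N : ℤ) :
    qp h (-1) * levelSum (fun e => matEl (crE h r k 1) (withKappa h k (anE h 1)) s e *
        matEl (crFp h k) (withKappa h k (anFp h r k)) e t) N -
      qp h 1 * levelSum (fun e => matEl (crFp h k) (withKappa h k (anFp h r k)) s e *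
        matEl (crE h r k 1) (withKappa h k (anE h 1)) e t) (level s + level t - N) =
    (qp h (-1) - qp h 1) * (qp h (k * N - k * level t - k / 2 * (level s - level t)) *
      matEl (crHp h r k) (withKappa h k (anHp h r k)) s t) := by
  have hAB := contraction_Ep_Fp hq hr hrs
  have hBA := contraction_Fp_Ep hq hr hrs
  have e1 : qp h (k + 2) = qp h 1 ^ 2 * qp h k := by
    rw [qp_pow, ← qp_add]
    congr 1
    push_cast
    ring
  have e2 : qp h (-k - 2) = (qp h 1 ^ 2)⁻¹ * (qp h k)⁻¹ := by
    rw [← mul_inv, ← e1, ← qp_neg]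
    congr 1
    ring
  rw [e1] at hAB
  rw [e2, qp_neg h k] at hBA
  have H := levelSum_commutator (qp_ne_zero h 1) (qp_ne_zero h k) hAB hBA s t N
  rw [← qp_neg] at H
  rw [H]
  have e3 : (fun i => crE h r k 1 i + crFp h k i * (qp h k)⁻¹ ^ (i.2 : ℕ)) =
      fun i => crHp h r k i * qp h (-(k / 2)) ^ (i.2 : ℕ) := by
    rw [← qp_neg]
    exact funext (crE_add_crFp hq hr hrs)
  have e4 : (fun i => withKappa h k (anE h 1) i +
        withKappa h k (anFp h r k) i * qp h k ^ (i.2 : ℕ)) =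
      fun i => withKappa h k (anHp h r k) i * (qp h (-(k / 2)))⁻¹ ^ (i.2 : ℕ) := by
    funext i
    have := anE_add_anFp hq hr hrs i
    rw [qp_neg h k, inv_inv] at this
    simp only [withKappa]
    linear_combination kappa h k i * this
  have e5 := matEl_scale (crHp h r k) (withKappa h k (anHp h r k)) (qp_ne_zero h (-(k / 2))) s t
  have e6 : matEl (fun i => crHp h r k i * qp h (-(k / 2)) ^ (i.2 : ℕ))
      (fun i => withKappa h k (anHp h r k) i * (qp h (-(k / 2)))⁻¹ ^ (i.2 : ℕ)) s t =
      qp h (-(k / 2) * (level s - level t)) *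
        matEl (crHp h r k) (withKappa h k (anHp h r k)) s t := by
    rw [qp_pow, qp_pow] at e5
    rw [show (-(k / 2) * (level s - level t) : ℂ) = level s * -(k / 2) - level t * -(k / 2) by ring,
      qp_sub, mul_right_comm, mul_comm (qp h _) (matEl _ _ _ _), ← e5,
      mul_inv_cancel_right₀ (qp_ne_zero _ _)]
  have e7 : qp h k ^ N = qp h (k * N) := by
    rw [qp, qp, ← Complex.exp_int_mul]
    congr 1
    ring
  rw [e3, e4, e6, e7, ← qp_neg, qp_pow, ← mul_assoc (qp h (level t * -(k : ℂ))), ← qp_add,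
    ← mul_assoc (qp h (k * (N : ℂ))), ← qp_add]
  congr 3
  ring

/-- The delta function with residue `H^-`. -/
lemma levelSum_commutator_minus (s t : Mode →₀ ℕ) (N : ℤ) :
    qp h 1 * levelSum (fun e => matEl (crE h r k (-1)) (withKappa h k (anE h (-1))) s e *
        matEl (crFm h k) (withKappa h k (anFm h r k)) e t) N -
      qp h (-1) * levelSum (fun e => matEl (crFm h k) (withKappa h k (anFm h r k)) s e *
        matEl (crE h r k (-1)) (withKappa h k (anE h (-1))) e t) (level s + level t - N) =
    (qp h 1 - qp h (-1)) * (qp h (-(k * N - k * level t - k / 2 * (level s - level t))) *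
      matEl (crHm h r k) (withKappa h k (anHm h r k)) s t) := by
  have hAB := contraction_Em_Fm hq hr hrs
  have hBA := contraction_Fm_Em hq hr hrs
  have e1 : qp h (-k - 2) = qp h (-1) ^ 2 * qp h (-k) := by
    rw [qp_pow, ← qp_add]
    congr 1
    push_cast
    ring
  have e2 : qp h (k + 2) = (qp h (-1) ^ 2)⁻¹ * (qp h (-k))⁻¹ := by
    rw [← mul_inv, ← e1, ← qp_neg]
    congr 1
    ring
  have e0 : qp h k = (qp h (-k))⁻¹ := by rw [← qp_neg, neg_neg]
  rw [e1] at hAB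
  rw [e2, e0] at hBA
  have H := levelSum_commutator (qp_ne_zero h (-1)) (qp_ne_zero h (-k)) hAB hBA s t N
  rw [← qp_neg, neg_neg] at H
  rw [H]
  have e3 : (fun i => crE h r k (-1) i + crFm h k i * (qp h (-k))⁻¹ ^ (i.2 : ℕ)) =
      fun i => crHm h r k i * qp h (k / 2) ^ (i.2 : ℕ) := by
    rw [← e0]
    exact funext (crE_add_crFm hq hr hrs)
  have e4 : (fun i => withKappa h k (anE h (-1)) i +
        withKappa h k (anFm h r k) i * qp h (-k) ^ (i.2 : ℕ)) =
      fun i => withKappa h k (anHm h r k) i * (qp h (k / 2))⁻¹ ^ (i.2 : ℕ) := by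
    funext i
    have := anE_add_anFm hq hr hrs i
    rw [e0, inv_inv] at this
    simp only [withKappa]
    linear_combination kappa h k i * this
  have e5 := matEl_scale (crHm h r k) (withKappa h k (anHm h r k)) (qp_ne_zero h (k / 2)) s t
  have e6 : matEl (fun i => crHm h r k i * qp h (k / 2) ^ (i.2 : ℕ))
      (fun i => withKappa h k (anHm h r k) i * (qp h (k / 2))⁻¹ ^ (i.2 : ℕ)) s t =
      qp h (k / 2 * (level s - level t)) *
        matEl (crHm h r k) (withKappa h k (anHm h r k)) s t := by
    rw [qp_pow, qp_pow] at e5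
    rw [show (k / 2 * (level s - level t) : ℂ) = level s * (k / 2) - level t * (k / 2) by ring,
      qp_sub, mul_right_comm, mul_comm (qp h _) (matEl _ _ _ _), ← e5,
      mul_inv_cancel_right₀ (qp_ne_zero _ _)]
  have e7 : qp h (-k) ^ N = qp h (-k * N) := by
    rw [qp, qp, ← Complex.exp_int_mul]
    congr 1
    ring
  rw [e3, e4, e6, e7, ← e0, qp_pow, ← mul_assoc (qp h (level t * (k : ℂ))), ← qp_add,
    ← mul_assoc (qp h (-k * (N : ℂ))), ← qp_add]
  congr 3
  ring

end

lemma hasFinsum_E_F (ε ε' : ℂ) (gE fE gF fF : Mode → ℂ) (α β : ℂ) (s t : State) :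
    HasFinsum (fun m => modes chE (zmE h r k ε 0) (expE r k) gE fE α s m *
        modes chF (zmF h r k ε' 0) (expF r) gF fF β m t)
      (if s.1 = t.1 + chH ∧ α + β = expH r k t.1 - 2 + level s.2 - level t.2 then
        qp h (-ε) * (zmE h r k ε 0 t.1 * zmF h r k ε' 0 t.1) *
          levelSum (fun e => matEl gE fE s.2 e * matEl gF fF e t.2) (β - expF r t.1 + level t.2)
      else 0) := by
  have H := hasFinsum_modes_mul chE chF (zmE h r k ε 0) (zmF h r k ε' 0) (expE r k) (expF r)
    gE fE gF fF α β s t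
  rw [chE_add_chF, expE_add_chF, expE_add_expF, zmE_add_chF, mul_assoc (qp h (-ε))] at H
  exact H

lemma hasFinsum_F_E (ε ε' : ℂ) (gE fE gF fF : Mode → ℂ) (α β : ℂ) (s t : State) :
    HasFinsum (fun m => modes chF (zmF h r k ε' 0) (expF r) gF fF β s m *
        modes chE (zmE h r k ε 0) (expE r k) gE fE α m t)
      (if s.1 = t.1 + chH ∧ α + β = expH r k t.1 - 2 + level s.2 - level t.2 then
        qp h ε' * (zmE h r k ε 0 t.1 * zmF h r k ε' 0 t.1) *
          levelSum (fun e => matEl gF fF s.2 e * matEl gE fE e t.2) (α - expE r k t.1 + level t.2)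
      else 0) := by
  have H := hasFinsum_modes_mul chF chE (zmF h r k ε' 0) (zmE h r k ε 0) (expF r) (expE r k)
    gF fF gE fE β α s t
  rw [chF_add_chE, expF_add_chE, add_comm (expF r t.1), expE_add_expF, zmF_add_chE,
    mul_assoc (qp h ε'), add_comm β, mul_comm (zmF h r k ε' 0 t.1)] at H
  exact H

lemma zmE_mul_zmF (ε : ℂ) (μ : Charge) :
    zmE h r k ε 0 μ * zmF h r k ε 0 μ = (qp h 1 - qp h (-1))⁻¹ ^ 2 *
      qp h (ε * ((k + 2) * pEig μ .b + k * pEig μ .c + pEig μ .a)) := by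
  rw [zmE, zmF, mul_mul_mul_comm, ← qp_add, neg_mul_neg, ← sq]
  congr 2
  ring

end

/-! ### The delta functions -/

section

variable {h : ℂ} {r k : ℝ}

lemma deltaCoeff_of_int {ε j : ℂ} (n : ℤ) (hj : j = ε + n) : deltaCoeff ε j = 1 :=
  if_pos ⟨n, hj⟩

/-- The modes of `H^+` in the delta function term, as they come out of the commutator. -/
lemma deltaLeft_modes (hr : 0 < r) (hrs : 0 < r - k) {α β : ℂ} {s t : State} {N : ℤ}
    (hs : s.1 = t.1 + chH) (hαβ : α + β = expH r k t.1 - 2 + level s.2 - level t.2)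
    (hN : β - expF r t.1 + level t.2 = N) (g f : Mode → ℂ) :
    deltaLeft h (-wExp r t) (-k) (-(k / 2)) (modes chH (zmHp h r k 0) (expH r k) g f)
        (α + 1) (β + 1) s t =
      qp h ((k + 2) * pEig t.1 .b + k * pEig t.1 .c + pEig t.1 .a) *
        (qp h (k * N - k * level t.2 - k / 2 * (level s.2 - level t.2)) * matEl g f s.2 t.2) := by
  have hr' : (r : ℂ) ≠ 0 := Complex.ofReal_ne_zero.mpr hr.ne'
  have hrs' : (r : ℂ) - k ≠ 0 := by
    rw [← Complex.ofReal_sub]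
    exact Complex.ofReal_ne_zero.mpr hrs.ne'
  have h1 : deltaCoeff (-wExp r t) (-(β + 1)) = 1 := by
    refine deltaCoeff_of_int (level t.2 - N) ?_
    push_cast
    rw [← hN, expF, wExp]
    ring
  have h2 : α + 1 + (β + 1) = expH r k t.1 + level s.2 - level t.2 := by linear_combination hαβ
  have h3 : β + 1 = N + (expF r t.1 + 1) - level t.2 := by linear_combination hN
  rw [deltaLeft, h1, one_mul, modes, if_pos ⟨hs, h2⟩, h2, h3, zmHp, ← mul_assoc, ← mul_assoc,
    ← mul_assoc, ← qp_add, ← qp_add, ← qp_add]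
  congr 2
  simp only [expH, expF, pDiag]
  field_simp
  ring

/-- The modes of `H^-` in the delta function term, as they come out of the commutator. -/
lemma deltaRight_modes (hr : 0 < r) (hrs : 0 < r - k) {α β : ℂ} {s t : State} {N : ℤ}
    (hs : s.1 = t.1 + chH) (hαβ : α + β = expH r k t.1 - 2 + level s.2 - level t.2)
    (hN : β - expF r t.1 + level t.2 = N) (g f : Mode → ℂ) :
    deltaRight h (zExp r k t) k (-(k / 2)) (modes chH (zmHm h r k 0) (expH r k) g f)
        (α + 1) (β + 1) s t =
      qp h (-((k + 2) * pEig t.1 .b + k * pEig t.1 .c + pEig t.1 .a)) *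
        (qp h (-(k * N - k * level t.2 - k / 2 * (level s.2 - level t.2))) *
          matEl g f s.2 t.2) := by
  have hr' : (r : ℂ) ≠ 0 := Complex.ofReal_ne_zero.mpr hr.ne'
  have hrs' : (r : ℂ) - k ≠ 0 := by
    rw [← Complex.ofReal_sub]
    exact Complex.ofReal_ne_zero.mpr hrs.ne'
  have h3 : α + 1 = expE r k t.1 + 1 + level s.2 - N := by
    linear_combination hαβ - hN - expE_add_expF (r := r) (k := k) t.1
  have h1 : deltaCoeff (zExp r k t) (α + 1) = 1 := by
    refine deltaCoeff_of_int (level s.2 - N) ?_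
    push_cast
    rw [h3, expE, zExp]
    ring
  have h2 : α + 1 + (β + 1) = expH r k t.1 + level s.2 - level t.2 := by linear_combination hαβ
  rw [deltaRight, h1, one_mul, modes, if_pos ⟨hs, h2⟩, h2, h3, zmHm, ← mul_assoc, ← mul_assoc,
    ← mul_assoc, ← qp_add, ← qp_add, ← qp_add]
  congr 2
  simp only [expH, expE, pDiag]
  field_simp
  ring

lemma deltaLeft_eq_zero {ε x y : ℂ} {M : ℂ → Op State} {a b : ℂ} {s t : State}
    (H : M (a + b) s t = 0) : deltaLeft h ε x y M a b s t = 0 := by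
  rw [deltaLeft, H, mul_zero, mul_zero]

lemma deltaRight_eq_zero {ε x y : ℂ} {M : ℂ → Op State} {a b : ℂ} {s t : State}
    (H : M (a + b) s t = 0) : deltaRight h ε x y M a b s t = 0 := by
  rw [deltaRight, H, mul_zero, mul_zero]

/-- The sum over the four pairs of summands of `E` and `F`: the pairs with `ε = 1`, `a_+` and `ε =
-1`, `a_-` give the two delta functions, the mixed pairs commute. -/
theorem commEF_currents (hq : h.re < 0) (hr : 0 < r) (hrs : 0 < r - k) :
    CommEF h k (HPlus h r k) (HMinus h r k) (ECur h r k) (FCur h r k) (zExp r k) (wExp r) := by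
  rw [HPlus_eq_vHp hq hr hrs, HMinus_eq_vHm hq hr hrs, ECur_eq_sub hq hr hrs,
    FCur_eq_sub hq hr hrs]
  refine ⟨_, _, _, _, hasModes_vtx _ _ zmHp_eq, hasModes_vtx _ _ zmHm_eq,
    (hasModes_vtx _ _ (zmE_eq 1)).sub (hasModes_vtx _ _ (zmE_eq (-1))),
    (hasModes_vtx _ _ (zmF_eq (-1))).sub (hasModes_vtx _ _ (zmF_eq 1)), fun α β s t => ?_⟩
  have EF := fun ε ε' gE fE gF fF =>
    hasFinsum_E_F (h := h) (r := r) (k := k) ε ε' gE fE gF fF α β s t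
  have FE := fun ε ε' gE fE gF fF =>
    hasFinsum_F_E (h := h) (r := r) (k := k) ε ε' gE fE gF fF α β s t
  have hp := levelSum_commutator_plus hq hr hrs s.2 t.2
  have hm := levelSum_commutator_minus hq hr hrs s.2 t.2
  have hpm := levelSum_comm_of_no_contraction (contraction_Ep_Fm hq hr hrs)
    (contraction_Fm_Ep hq hr hrs) s.2 t.2
  have hmp := levelSum_comm_of_no_contraction (contraction_Em_Fp hq hr hrs)
    (contraction_Fp_Em hq hr hrs) s.2 t.2
  set gP := crE h r k 1
  set fP := withKappa h k (anE h 1)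
  set gM := crE h r k (-1)
  set fM := withKappa h k (anE h (-1))
  set gP' := crFp h k
  set fP' := withKappa h k (anFp h r k)
  set gM' := crFm h k
  set fM' := withKappa h k (anFm h r k)
  have S1 := ((EF 1 (-1) gP fP gM' fM').sub (EF 1 1 gP fP gP' fP')).sub
    ((EF (-1) (-1) gM fM gM' fM').sub (EF (-1) 1 gM fM gP' fP'))
  have S2 := ((FE 1 (-1) gP fP gM' fM').sub (FE (-1) (-1) gM fM gM' fM')).sub
    ((FE 1 1 gP fP gP' fP').sub (FE (-1) 1 gM fM gP' fP'))
  simp only [← mul_sub, ← sub_mul] at S1 S2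
  refine ⟨S1.1, S2.1, (congrArg₂ (· - ·) S1.2 S2.2).trans ?_⟩
  by_cases hc : s.1 = t.1 + chH ∧ α + β = expH r k t.1 - 2 + level s.2 - level t.2
  · simp only [if_pos hc]
    obtain ⟨hs, hαβ⟩ := hc
    have hν : α - expE r k t.1 + level t.2 =
        level s.2 + level t.2 - (β - expF r t.1 + level t.2) := by
      linear_combination hαβ - expE_add_expF (r := r) (k := k) t.1
    by_cases hN : ∃ N : ℤ, β - expF r t.1 + level t.2 = N
    · obtain ⟨N, hN⟩ := hN
      rw [deltaLeft_modes hr hrs hs hαβ hN, deltaRight_modes hr hrs hs hαβ hN, hν, hN]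
      have zp := zmE_mul_zmF (h := h) (r := r) (k := k) 1 t.1
      have zm := zmE_mul_zmF (h := h) (r := r) (k := k) (-1) t.1
      rw [one_mul] at zp
      rw [neg_one_mul] at zm
      have hw : (qp h 1 - qp h (-1))⁻¹ ^ 2 * (qp h (-1) - qp h 1) = -(qp h 1 - qp h (-1))⁻¹ := by
        rcases eq_or_ne (qp h 1 - qp h (-1)) 0 with h0 | h0
        · rw [h0]
          simp
        · rw [← neg_sub (qp h 1)]
          field_simp
      simp only [neg_neg]
      linear_combination (-(zmE h r k 1 0 t.1 * zmF h r k 1 0 t.1)) * hp N -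
        zmE h r k (-1) 0 t.1 * zmF h r k (-1) 0 t.1 * hm N +
        qp h (-1) * (zmE h r k 1 0 t.1 * zmF h r k (-1) 0 t.1) * hpm N +
        qp h 1 * (zmE h r k (-1) 0 t.1 * zmF h r k 1 0 t.1) * hmp N -
        (qp h (-1) - qp h 1) * (qp h (k * N - k * level t.2 - k / 2 * (level s.2 - level t.2)) *
          matEl (crHp h r k) (withKappa h k (anHp h r k)) s.2 t.2) * zp -
        (qp h 1 - qp h (-1)) * (qp h (-(k * N - k * level t.2 - k / 2 * (level s.2 - level t.2))) *
          matEl (crHm h r k) (withKappa h k (anHm h r k)) s.2 t.2) * zm -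
        (qp h ((k + 2) * pEig t.1 .b + k * pEig t.1 .c + pEig t.1 .a) *
          (qp h (k * N - k * level t.2 - k / 2 * (level s.2 - level t.2)) *
          matEl (crHp h r k) (withKappa h k (anHp h r k)) s.2 t.2)) * hw +
        (qp h (-((k + 2) * pEig t.1 .b + k * pEig t.1 .c + pEig t.1 .a)) *
          (qp h (-(k * N - k * level t.2 - k / 2 * (level s.2 - level t.2))) *
          matEl (crHm h r k) (withKappa h k (anHm h r k)) s.2 t.2)) * hw
    · -- off the integral lattice there are no intermediate states, and `δ` has no such term
      have hN1 : ∀ n : ℕ, (n : ℂ) ≠ β - expF r t.1 + level t.2 := fun n hn =>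
        hN ⟨n, by rw [← hn, Int.cast_natCast]⟩
      have hN2 : ∀ n : ℕ, (n : ℂ) ≠ level s.2 + level t.2 - (β - expF r t.1 + level t.2) :=
        fun n hn => hN ⟨level s.2 + level t.2 - n, by
          push_cast
          rw [hn]
          ring⟩
      have d1 : deltaCoeff (-wExp r t) (-(β + 1)) = 0 := by
        refine if_neg ?_
        rintro ⟨n, hn⟩
        refine hN ⟨level t.2 - n, ?_⟩
        push_cast
        rw [expF]
        rw [wExp] at hn
        linear_combination -hn
      have d2 : deltaCoeff (zExp r k t) (α + 1) = 0 := by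
        refine if_neg ?_
        rintro ⟨n, hn⟩
        refine hN ⟨level s.2 - n, ?_⟩
        push_cast
        have h1 := expE_add_expF (r := r) (k := k) t.1
        rw [expE] at h1
        rw [zExp] at hn
        linear_combination hαβ - hn - h1
      rw [hν]
      simp only [levelSum_eq_zero _ hN1, levelSum_eq_zero _ hN2, deltaLeft, deltaRight, d1, d2,
        zero_mul, mul_zero, sub_self]
  · simp only [if_neg hc]
    have hM : ∀ C g f, modes chH C (expH r k) g f (α + 1 + (β + 1)) s t = 0 := fun C g f =>
      if_neg fun h' => hc ⟨h'.1, by linear_combination h'.2⟩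
    rw [deltaLeft_eq_zero (hM _ _ _), deltaRight_eq_zero (hM _ _ _)]
    simp

end

end

end EllipticWakimoto

open EllipticWakimoto in
theorem theorem1 (h : ℂ) (hq : h.re < 0) (r k : ℝ) (hr : 0 < r) (hrs : 0 < r - k)
    (hk : k ≠ -2) :
    ThetaRelations h r k (HPlus h r k) (HMinus h r k) (ECur h r k) (FCur h r k)
        (zExp r k) (wExp r) ∧
      IsRealization h r k (HPlus h r k) (HMinus h r k) (ECur h r k) (FCur h r k)
        (zExp r k) (wExp r) := by
  have HR := isRealization_of_commEF hq hr hrs (commEF_currents hq hr hrs)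
  exact ⟨thetaRelations_of_isRealization hq hr hrs HR, HR⟩
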